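/- Let $k$ be a field, $n\ge 0$ and $R_n=k[t]/(t^{n+1})$. Let $A,B$ be dg $k$-algebras and let $A_n,B_n$ be cdg deformations of $A,B$ over $R_n$, i.e. cdg $R_n$-algebra structures on $A\otimes_k R_n$, $B\otimes_k R_n$ whose multiplication, unit, predifferential and curvature reduce modulo $t$ to those of the dg algebras $A,B$ (in particular the curvature reduces to $0$). All modules are right cdg modules. Let $\operatorname{Hot}(A_n)$ be the homotopy category of cdg $A_n$-modules, and let $D^n(A_n)$ be the $n$-derived category: the quotient of $\operatorname{Hot}(A_n)$ by the modules $M$ that are $n$-acyclic, meaning that the associated graded $\operatorname{Gr}_t(M)=\bigoplus_s t^sM/t^{s+1}M$ is acyclic (equivalently, by definition of the Verdier quotient, the localization of $\operatorname{Hot}(A_n)$ at the morphisms with $n$-acyclic cone); write $Q_A\colon \operatorname{Hot}(A_n)\to D^n(A_n)$ for the quotient functor, and similarly for $B_n$. Let $X_n$ be a cdg $A_n$-$B_n$ bimodule that is projective as a graded right $B_n$-module and whose reduction $X=X_n\otimes_{R_n}k$ is cofibrant as a dg $B$-module. Then: 1. $Q_A$ admits a left adjoint $\mathbf p_n\colon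 D^n(A_n)\to\operatorname{Hot}(A_n)$ ($n$-homotopy projective resolution). 2. The functor $\operatorname{Hom}_{B_n}(X_n,-)\colon \operatorname{Hot}(B_n)\to\operatorname{Hot}(A_n)$ descends to the $n$-derived categories without any resolution: there is a functor $H=\operatorname{Hom}_{B_n}(X_n,-)\colon D^n(B_n)\to D^n(A_n)$ with $H\circ Q_B\cong Q_A\circ\operatorname{Hom}_{B_n}(X_n,-)$. 3. For every left adjoint $\mathbf p_n$ of $Q_A$, the composition $$-\otimes^{\mathrm L}_{A_n}X_n:\quad D^n(A_n)\xrightarrow{\ \mathbf p_n\ }\operatorname{Hot}(A_n)\xrightarrow{-\otimes_{A_n}X_n}\operatorname{Hot}(B_n)\xrightarrow{\ Q_B\ }D^n(B_n),$$ with the natural transformation to $Q_B(-\otimes_{A_n}X_n)$ induced by the counit $\mathbf p_nQ_A\to\mathrm{id}$, is a left derived functor of $-\otimes_{A_n}X_n$. 4. $-\otimes^{\mathrm L}_{A_n}X_n$ is left adjoint to $\operatorname{Hom}_{B_n}(X_n,-)\colon D^n(B_n)\to D^n(A_n)$. More precisely, the adjunction can be chosen so that its counit at a $B_n$-module $N$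 is the composition $$\mathbf p_n\operatorname{Hom}_{B_n}(X_n,N)\otimes_{A_n}X_n\to\operatorname{Hom}_{B_n}(X_n,N)\otimes_{A_n}X_n\to N$$ of the map induced by $\mathbf p_n\operatorname{Hom}_{B_n}(X_n,N)\to\operatorname{Hom}_{B_n}(X_n,N)$ and the evaluation $f\otimes x\mapsto f(x)$. -/

import Mathlib

open CategoryTheory
open scoped TensorProduct

universe u

noncomputable section

namespace CDG

/-- The sign `(-1)^i` as an element of the ring `R`. -/
def sgn (R : Type u) [CommRing R] (i : ℤ) : R := ((i.negOnePow : ℤ) : R)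

theorem sgn_add {R : Type u} [CommRing R] (i j : ℤ) : sgn R (i + j) = sgn R i * sgn R j := by
  simp [sgn, Int.negOnePow_add]

theorem sgn_one {R : Type u} [CommRing R] : sgn R 1 = -1 := by simp [sgn]

theorem sgn_zero {R : Type u} [CommRing R] : sgn R 0 = 1 := by simp [sgn]

theorem sgn_mul_self {R : Type u} [CommRing R] (i : ℤ) : sgn R i * sgn R i = 1 := by
  rw [sgn, ← Int.cast_mul, ← Units.val_mul, Int.units_mul_self]
  simp

/-! ### Curved dg algebras, modules and bimodules

Graded objects are families indexed by `ℤ`. An operation landing in degree `i + j` takes a proof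
of `i + j = l` and lands in degree `l`, so that no transport along equalities is needed. -/

/-- A cdg algebra over `R`: a (unital, associative) `ℤ`-graded `R`-algebra with a derivation `d` of
degree `1` and a curvature element `curv` of degree `2` such that `d curv = 0` and
`d² = [curv, -]`. -/
structure CDGAlgebra (R : Type u) [CommRing R] where
  C : ℤ → Type u
  [addCommGroup : ∀ i, AddCommGroup (C i)]
  [module : ∀ i, Module R (C i)]
  mul : ∀ {i j l : ℤ}, i + j = l → C i →ₗ[R] C j →ₗ[R] C l
  one : C 0
  d : ∀ {i j : ℤ}, i + 1 = j → C i →ₗ[R] C j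
  curv : C 2
  one_mul : ∀ {i : ℤ} (h : 0 + i = i) (a : C i), mul h one a = a
  mul_one : ∀ {i : ℤ} (h : i + 0 = i) (a : C i), mul h a one = a
  mul_assoc : ∀ {i j l ij jl m : ℤ} (h₁ : i + j = ij) (h₂ : ij + l = m) (h₃ : j + l = jl)
    (h₄ : i + jl = m) (a : C i) (b : C j) (c : C l),
    mul h₂ (mul h₁ a b) c = mul h₄ a (mul h₃ b c)
  d_mul : ∀ {i j l i' j' l' : ℤ} (h : i + j = l) (hi : i + 1 = i') (hj : j + 1 = j')
    (hl : l + 1 = l') (h₁ : i' + j = l') (h₂ : i + j' = l') (a : C i) (b : C j),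
    d hl (mul h a b) = mul h₁ (d hi a) b + sgn R i • mul h₂ a (d hj b)
  d_curv : ∀ {i : ℤ} (h : 2 + 1 = i), d h curv = 0
  d_d : ∀ {i j l : ℤ} (h : i + 1 = j) (h' : j + 1 = l) (h₁ : 2 + i = l) (h₂ : i + 2 = l) (a : C i),
    d h' (d h a) = mul h₁ curv a - mul h₂ a curv

attribute [instance] CDGAlgebra.addCommGroup CDGAlgebra.module

/-- A dg algebra is a cdg algebra with zero curvature. -/
structure DGAlgebra (R : Type u) [CommRing R] extends CDGAlgebra R where
  curv_eq_zero : curv = 0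

/-- A graded right module over the graded algebra underlying `A`. -/
structure GrModule {R : Type u} [CommRing R] (A : CDGAlgebra R) where
  C : ℤ → Type u
  [addCommGroup : ∀ i, AddCommGroup (C i)]
  [module : ∀ i, Module R (C i)]
  act : ∀ {i j l : ℤ}, i + j = l → C i →ₗ[R] A.C j →ₗ[R] C l
  act_one : ∀ {i : ℤ} (h : i + 0 = i) (m : C i), act h m A.one = m
  act_act : ∀ {i j l ij jl m : ℤ} (h₁ : i + j = ij) (h₂ : ij + l = m) (h₃ : j + l = jl)
    (h₄ : i + jl = m) (x : C i) (a : A.C j) (b : A.C l),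
    act h₂ (act h₁ x a) b = act h₄ x (A.mul h₃ a b)

attribute [instance] GrModule.addCommGroup GrModule.module

/-- A right cdg module over `A`: a graded right module with an `A`-derivation `d` of degree `1`
such that `d² m = - m * curv`. -/
structure CDGModule {R : Type u} [CommRing R] (A : CDGAlgebra R) extends GrModule A where
  d : ∀ {i j : ℤ}, i + 1 = j → C i →ₗ[R] C j
  d_act : ∀ {i j l i' j' l' : ℤ} (h : i + j = l) (hi : i + 1 = i') (hj : j + 1 = j')
    (hl : l + 1 = l') (h₁ : i' + j = l') (h₂ : i + j' = l') (m : C i) (a : A.C j),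
    d hl (act h m a) = act h₁ (d hi m) a + sgn R i • act h₂ m (A.d hj a)
  d_d : ∀ {i j l : ℤ} (h : i + 1 = j) (h' : j + 1 = l) (h₁ : i + 2 = l) (m : C i),
    d h' (d h m) = - act h₁ m A.curv

/-- A cdg `A`-`B` bimodule (over `R`): a graded bimodule with a derivation `d` of degree `1` such
that `d² x = curv_A * x - x * curv_B`. -/
structure CDGBimodule {R : Type u} [CommRing R] (A B : CDGAlgebra R) extends GrModule B where
  lact : ∀ {i j l : ℤ}, i + j = l → A.C i →ₗ[R] C j →ₗ[R] C l
  one_lact : ∀ {i : ℤ} (h : 0 + i = i) (x : C i), lact h A.one x = x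
  lact_lact : ∀ {i j l ij jl m : ℤ} (h₁ : i + j = ij) (h₂ : ij + l = m) (h₃ : j + l = jl)
    (h₄ : i + jl = m) (a : A.C i) (b : A.C j) (x : C l),
    lact h₂ (A.mul h₁ a b) x = lact h₄ a (lact h₃ b x)
  lact_act : ∀ {i j l ij jl m : ℤ} (h₁ : i + j = ij) (h₂ : ij + l = m) (h₃ : j + l = jl)
    (h₄ : i + jl = m) (a : A.C i) (x : C j) (b : B.C l),
    act h₂ (lact h₁ a x) b = lact h₄ a (act h₃ x b)
  d : ∀ {i j : ℤ}, i + 1 = j → C i →ₗ[R] C j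
  d_act : ∀ {i j l i' j' l' : ℤ} (h : i + j = l) (hi : i + 1 = i') (hj : j + 1 = j')
    (hl : l + 1 = l') (h₁ : i' + j = l') (h₂ : i + j' = l') (x : C i) (b : B.C j),
    d hl (act h x b) = act h₁ (d hi x) b + sgn R i • act h₂ x (B.d hj b)
  d_lact : ∀ {i j l i' j' l' : ℤ} (h : i + j = l) (hi : i + 1 = i') (hj : j + 1 = j')
    (hl : l + 1 = l') (h₁ : i' + j = l') (h₂ : i + j' = l') (a : A.C i) (x : C j),
    d hl (lact h a x) = lact h₁ (A.d hi a) x + sgn R i • lact h₂ a (d hj x)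
  d_d : ∀ {i j l : ℤ} (h : i + 1 = j) (h' : j + 1 = l) (h₁ : 2 + i = l) (h₂ : i + 2 = l) (x : C i),
    d h' (d h x) = lact h₁ A.curv x - act h₂ x B.curv

variable {R : Type u} [CommRing R] {A B : CDGAlgebra R}

/-! ### Morphisms, homotopies and the homotopy category -/

/-- Degree `0` morphisms of graded right modules. -/
@[ext]
structure GrModule.Hom (M N : GrModule A) where
  f : ∀ i, M.C i →ₗ[R] N.C i
  f_act : ∀ {i j l : ℤ} (h : i + j = l) (m : M.C i) (a : A.C j),
    f l (M.act h m a) = N.act h (f i m) a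

/-- A graded module is projective if it has the lifting property against all surjections of graded
modules. -/
def GrModule.IsProjective (P : GrModule A) : Prop :=
  ∀ (M N : GrModule A) (p : GrModule.Hom M N) (f : GrModule.Hom P N),
    (∀ i, Function.Surjective (p.f i)) →
      ∃ g : GrModule.Hom P M, ∀ i x, p.f i (g.f i x) = f.f i x

namespace CDGModule

/-- Closed degree `0` morphisms of cdg modules. -/
@[ext]
structure Hom (M N : CDGModule A) where
  f : ∀ i, M.C i →ₗ[R] N.C i
  f_act : ∀ {i j l : ℤ} (h : i + j = l) (m : M.C i) (a : A.C j),
    f l (M.act h m a) = N.act h (f i m) a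
  f_d : ∀ {i j : ℤ} (h : i + 1 = j) (m : M.C i), f j (M.d h m) = N.d h (f i m)

/-- The category `Z⁰(A-Mod)` of right cdg modules and closed degree `0` morphisms. -/
instance : Category (CDGModule A) where
  Hom := Hom
  id M := { f := fun _ => LinearMap.id, f_act := by intros; rfl, f_d := by intros; rfl }
  comp f g :=
    { f := fun i => (g.f i).comp (f.f i)
      f_act := by intros; simp [f.f_act, g.f_act]
      f_d := by intros; simp [f.f_d, g.f_d] }

@[simp] theorem id_f (M : CDGModule A) (i : ℤ) (m : M.C i) : Hom.f (𝟙 M) i m = m := rfl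

@[simp] theorem comp_f {M N P : CDGModule A} (f : M ⟶ N) (g : N ⟶ P) (i : ℤ) (m : M.C i) :
    Hom.f (f ≫ g) i m = Hom.f g i (Hom.f f i m) := rfl

@[ext] theorem hom_ext {M N : CDGModule A} {f g : M ⟶ N}
    (h : ∀ i m, Hom.f f i m = Hom.f g i m) : f = g := by
  apply Hom.ext
  funext i
  ext m
  exact h i m

/-- A homotopy between two closed degree `0` morphisms: an `A`-linear map `h` of degree `-1` whose
differential `d h + h d` in the Hom complex is `f - g`. -/
structure Homotopy {M N : CDGModule A} (f g : M ⟶ N) where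
  h : ∀ {i j : ℤ}, j + 1 = i → M.C i →ₗ[R] N.C j
  h_act : ∀ {i j l i' l' : ℤ} (e : i + j = l) (hi : i' + 1 = i) (hl : l' + 1 = l) (e' : i' + j = l')
    (m : M.C i) (a : A.C j), h hl (M.act e m a) = N.act e' (h hi m) a
  comm : ∀ {i j l : ℤ} (e : j + 1 = i) (e' : i + 1 = l) (m : M.C i),
    Hom.f f i m - Hom.f g i m = N.d e (h e m) + h e' (M.d e' m)

/-- The homotopy relation: being cohomologous in the Hom complex of the dg category of modules. -/
def homotopic (A : CDGAlgebra R) : HomRel (CDGModule A) := fun _ _ f g => Nonempty (Homotopy f g)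

instance : Congruence (homotopic A) where
  equivalence := by
    intro M N
    refine ⟨fun f => ?_, ?_, ?_⟩
    · exact ⟨{ h := fun _ => 0, h_act := by intros; simp, comm := by intros; simp }⟩
    · rintro f g ⟨s⟩
      refine ⟨{ h := fun e => - s.h e, h_act := ?_, comm := ?_ }⟩
      · intro i j l i' l' e hi hl e' m a
        simp [s.h_act e hi hl e']
      · intro i j l e e' m
        have := s.comm e e' m
        rw [← neg_sub, this]
        simp [add_comm]
    · rintro f g k ⟨s⟩ ⟨t⟩
      refine ⟨{ h := fun e => s.h e + t.h e, h_act := ?_, comm := ?_ }⟩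
      · intro i j l i' l' e hi hl e' m a
        simp [s.h_act e hi hl e', t.h_act e hi hl e']
      · intro i j l e e' m
        rw [← sub_add_sub_cancel _ (Hom.f g i m), s.comm e e', t.comm e e']
        simp only [LinearMap.add_apply, map_add]
        abel
  comp_left := by
    rintro M N P f g g' ⟨s⟩
    refine ⟨{ h := fun {i j} e => (s.h e).comp (Hom.f f i), h_act := ?_, comm := ?_ }⟩
    · intro i j l i' l' e hi hl e' m a
      simp [Hom.f_act f, s.h_act e hi hl e']
    · intro i j l e e' m
      simpa [Hom.f_d f] using s.comm e e' (Hom.f f i m)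
  comp_right := by
    rintro M N P f g k ⟨s⟩
    refine ⟨{ h := fun {i j} e => (Hom.f k j).comp (s.h e), h_act := ?_, comm := ?_ }⟩
    · intro i j l i' l' e hi hl e' m a
      simp [Hom.f_act k, s.h_act e hi hl e']
    · intro i j l e e' m
      simp only [comp_f, LinearMap.comp_apply]
      rw [← map_sub, s.comm e e', map_add, Hom.f_d k]

end CDGModule

/-- The homotopy category `Hot(A) = H⁰(A-Mod)` of right cdg modules. -/
abbrev Hot (A : CDGAlgebra R) := CategoryTheory.Quotient (CDGModule.homotopic A)

/-- The projection `Z⁰(A-Mod) ⥤ H⁰(A-Mod)`. -/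
abbrev toHot (A : CDGAlgebra R) : CDGModule A ⥤ Hot A := CategoryTheory.Quotient.functor _

namespace CDGModule

/-- The mapping cone of a closed degree `0` morphism `f : M ⟶ N`, with underlying graded module
`N ⊕ M[1]` and predifferential `(n, m) ↦ (d n + f m, - d m)`. -/
def cone {M N : CDGModule A} (f : M ⟶ N) : CDGModule A where
  C i := N.C i × M.C (i + 1)
  act {i j l} h := LinearMap.mk₂ R
    (fun x a => (N.act h x.1 a, M.act (show i + 1 + j = l + 1 by omega) x.2 a))
    (by intros; simp) (by intros; simp) (by intros; simp) (by intros; simp)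
  act_one := by
    intro i h m
    simp [N.act_one, M.act_one]
  act_act := by
    intro i j l ij jl m h₁ h₂ h₃ h₄ x a b
    simp only [LinearMap.mk₂_apply]
    rw [N.act_act h₁ h₂ h₃ h₄, M.act_act _ _ h₃ (by omega)]
  d {i j} h :=
    LinearMap.prod
      ((N.d h).comp (LinearMap.fst R _ _) +
        ((Hom.f f j).comp (by subst h; exact LinearMap.id)).comp (LinearMap.snd R _ _))
      (-(M.d (show i + 1 + 1 = j + 1 by omega)).comp (LinearMap.snd R _ _))
  d_act := by
    intro i j l i' j' l' h hi hj hl h₁ h₂ m a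
    subst hi hj hl
    ext
    · simp only [LinearMap.prod_apply, LinearMap.mk₂_apply, Function.prod, LinearMap.add_apply,
        LinearMap.comp_apply, LinearMap.fst_apply, LinearMap.snd_apply, LinearMap.id_apply,
        Prod.fst_add, Prod.smul_fst, map_add]
      rw [N.d_act h rfl rfl rfl h₁ h₂, Hom.f_act f]
      abel
    · simp only [LinearMap.prod_apply, LinearMap.mk₂_apply, Function.prod, LinearMap.neg_apply,
        LinearMap.comp_apply, LinearMap.snd_apply,
        Prod.snd_add, Prod.smul_snd, map_neg]
      rw [M.d_act _ rfl rfl rfl (by omega) (by omega), sgn_add, sgn_one]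
      module
  d_d := by
    intro i j l h h' h₁ m
    subst h h'
    ext
    · simp only [LinearMap.prod_apply, LinearMap.mk₂_apply, Function.prod, LinearMap.add_apply,
        LinearMap.comp_apply, LinearMap.fst_apply, LinearMap.snd_apply, LinearMap.id_apply,
        LinearMap.neg_apply, Prod.fst_neg, map_add, map_neg]
      rw [N.d_d _ _ h₁, Hom.f_d f]
      abel
    · simp only [LinearMap.prod_apply, LinearMap.mk₂_apply, Function.prod, LinearMap.neg_apply,
        LinearMap.comp_apply, LinearMap.snd_apply, Prod.snd_neg, map_neg, neg_neg]
      rw [M.d_d _ _ (by omega)]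

end CDGModule

/-! ### The tensor product functor -/

section Tensor

variable (M : GrModule A) (X : CDGBimodule A B)

/-- The degree `l` part of `M ⊗_R X`. -/
abbrev PreTens (l : ℤ) : Type u :=
  DirectSum {p : ℤ × ℤ // p.1 + p.2 = l} fun p => M.C p.1.1 ⊗[R] X.C p.1.2

/-- The pure tensor `m ⊗ x` in `M ⊗_R X`. -/
def preMk {i j l : ℤ} (h : i + j = l) : M.C i →ₗ[R] X.C j →ₗ[R] PreTens M X l :=
  (TensorProduct.mk R (M.C i) (X.C j)).compr₂
    (DirectSum.lof R {p : ℤ × ℤ // p.1 + p.2 = l} (fun p => M.C p.1.1 ⊗[R] X.C p.1.2) ⟨(i, j), h⟩)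

/-- The submodule of `M ⊗_R X` in degree `l` generated by all `m a ⊗ x - m ⊗ a x`. -/
def tensRel (l : ℤ) : Submodule R (PreTens M X l) :=
  Submodule.span R {z | ∃ (i a j ia aj : ℤ) (h₁ : i + a = ia) (h₂ : a + j = aj) (h₃ : ia + j = l)
    (h₄ : i + aj = l) (m : M.C i) (y : A.C a) (x : X.C j),
    z = preMk M X h₃ (M.act h₁ m y) x - preMk M X h₄ m (X.lact h₂ y x)}

/-- The degree `l` part of `M ⊗_A X`. -/
abbrev Tens (l : ℤ) : Type u := PreTens M X l ⧸ tensRel M X l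

/-- The pure tensor `m ⊗ x` in `M ⊗_A X`. -/
def tmk {i j l : ℤ} (h : i + j = l) : M.C i →ₗ[R] X.C j →ₗ[R] Tens M X l :=
  (preMk M X h).compr₂ (tensRel M X l).mkQ

variable {M X}

theorem tmk_act {i a j ia aj l : ℤ} (h₁ : i + a = ia) (h₂ : a + j = aj) (h₃ : ia + j = l)
    (h₄ : i + aj = l) (m : M.C i) (y : A.C a) (x : X.C j) :
    tmk M X h₃ (M.act h₁ m y) x = tmk M X h₄ m (X.lact h₂ y x) := by
  refine (Submodule.Quotient.eq _).2 ?_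
  exact Submodule.subset_span ⟨i, a, j, ia, aj, h₁, h₂, h₃, h₄, m, y, x, rfl⟩

theorem tens_ext {l : ℤ} {N : Type u} [AddCommGroup N] [Module R N] {f g : Tens M X l →ₗ[R] N}
    (H : ∀ (i j : ℤ) (h : i + j = l) (m : M.C i) (x : X.C j),
      f (tmk M X h m x) = g (tmk M X h m x)) : f = g := by
  apply Submodule.linearMap_qext
  apply DirectSum.linearMap_ext
  rintro ⟨⟨i, j⟩, h⟩
  apply TensorProduct.ext'
  intro m x
  exact H i j h m x

/-- The linear map out of `M ⊗_A X` given by an `A`-balanced family of bilinear maps. -/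
def tlift {l : ℤ} {N : Type u} [AddCommGroup N] [Module R N]
    (f : ∀ i j : ℤ, i + j = l → M.C i →ₗ[R] X.C j →ₗ[R] N)
    (hf : ∀ (i a j ia aj : ℤ) (h₁ : i + a = ia) (h₂ : a + j = aj) (h₃ : ia + j = l)
      (h₄ : i + aj = l) (m : M.C i) (y : A.C a) (x : X.C j),
      f ia j h₃ (M.act h₁ m y) x = f i aj h₄ m (X.lact h₂ y x)) : Tens M X l →ₗ[R] N :=
  (tensRel M X l).liftQ (DirectSum.toModule R _ N fun p => TensorProduct.lift (f _ _ p.2)) (by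
    rw [tensRel, Submodule.span_le]
    rintro _ ⟨i, a, j, ia, aj, h₁, h₂, h₃, h₄, m, y, x, rfl⟩
    simp [preMk, hf i a j ia aj h₁ h₂ h₃ h₄])

@[simp] theorem tlift_tmk {l : ℤ} {N : Type u} [AddCommGroup N] [Module R N]
    (f : ∀ i j : ℤ, i + j = l → M.C i →ₗ[R] X.C j →ₗ[R] N) (hf) {i j : ℤ} (h : i + j = l)
    (m : M.C i) (x : X.C j) : tlift (M := M) (X := X) f hf (tmk M X h m x) = f i j h m x := by
  simp [tlift, tmk, preMk]

variable (M X)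

/-- The right action of `B` on `M ⊗_A X`, as a map `b ↦ (- * b)`. -/
def tensAct {i j l : ℤ} (h : i + j = l) (b : B.C j) : Tens M X i →ₗ[R] Tens M X l :=
  tlift (fun p q e => (tmk M X (show p + (q + j) = l by omega)).compl₂ ((X.act rfl).flip b)) (by
    intro p a q pa aq h₁ h₂ h₃ h₄ m y x
    simp only [LinearMap.compl₂_apply, LinearMap.flip_apply]
    rw [tmk_act h₁ (show a + (q + j) = aq + j by omega) _ (by omega),
      X.lact_act h₂ rfl rfl (by omega)])

end Tensor

/-- The predifferential of `M ⊗_A X`. -/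
def tensD (M : CDGModule A) (X : CDGBimodule A B) {i j : ℤ} (h : i + 1 = j) :
    Tens M.toGrModule X i →ₗ[R] Tens M.toGrModule X j :=
  tlift (fun p q e =>
      (tmk M.toGrModule X (show p + 1 + q = j by omega)).comp (M.d rfl) +
        sgn R p • (tmk M.toGrModule X (show p + (q + 1) = j by omega)).compl₂ (X.d rfl)) (by
    intro p a q pa aq h₁ h₂ h₃ h₄ m y x
    simp only [LinearMap.add_apply, LinearMap.comp_apply, LinearMap.smul_apply,
      LinearMap.compl₂_apply]
    rw [M.d_act h₁ rfl rfl rfl (show p + 1 + a = pa + 1 by omega) (show p + (a + 1) = pa + 1 by omega),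
      X.d_lact h₂ rfl rfl rfl (show a + 1 + q = aq + 1 by omega) (show a + (q + 1) = aq + 1 by omega)]
    simp only [map_add, map_smul, LinearMap.add_apply, LinearMap.smul_apply]
    rw [tmk_act _ h₂ _ (by omega), tmk_act _ (show a + 1 + q = aq + 1 by omega) _ (by omega),
      tmk_act _ (show a + (q + 1) = aq + 1 by omega) _ (by omega),
      show sgn R pa = sgn R p * sgn R a by rw [← h₁, sgn_add]]
    module)

/-- The cdg module `M ⊗_A X` over `B`, for a cdg module `M` over `A` and a cdg `A`-`B` bimodule
`X`: here `(m ⊗ x) b = m ⊗ x b` and `d (m ⊗ x) = d m ⊗ x + (-1)^|m| m ⊗ d x`. -/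
def CDGModule.tensor (M : CDGModule A) (X : CDGBimodule A B) : CDGModule B where
  C l := Tens M.toGrModule X l
  act {i j l} h := LinearMap.mk₂ R (fun z b => tensAct M.toGrModule X h b z)
    (by intros; simp) (by intros; simp)
    (by
      intro z b b'
      rw [← LinearMap.add_apply]
      revert z
      rw [← LinearMap.ext_iff]
      apply tens_ext
      intro p q e m x
      simp [tensAct])
    (by
      intro c z b
      rw [← LinearMap.smul_apply]
      revert z
      rw [← LinearMap.ext_iff]
      apply tens_ext
      intro p q e m x
      simp [tensAct])
  act_one := by
    intro i h z
    simp only [LinearMap.mk₂_apply]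
    refine LinearMap.congr_fun (f := tensAct M.toGrModule X h B.one)
      (g := LinearMap.id) (tens_ext ?_) z
    intro p q e m x
    simp only [tensAct, tlift_tmk, LinearMap.compl₂_apply, LinearMap.flip_apply,
      LinearMap.id_apply]
    have : ∀ (q' : ℤ) (h : q + 0 = q') (h' : p + q' = i),
        tmk M.toGrModule X h' m (X.act h x B.one) = tmk M.toGrModule X e m x := by
      intro q' h h'
      obtain rfl : q = q' := by omega
      rw [X.act_one]
    exact this _ _ _
  act_act := by
    intro i j l ij jl n h₁ h₂ h₃ h₄ z a b
    simp only [LinearMap.mk₂_apply]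
    rw [← LinearMap.comp_apply]
    revert z
    rw [← LinearMap.ext_iff]
    apply tens_ext
    intro p q e m x
    simp only [tensAct, tlift_tmk, LinearMap.compl₂_apply, LinearMap.flip_apply,
      LinearMap.comp_apply]
    subst h₃
    have : ∀ (q' : ℤ) (h : q + j + l = q') (h' : p + q' = n) (h'' : p + (q + (j + l)) = n),
        tmk M.toGrModule X h' m (X.act h (X.act rfl x a) b) =
          tmk M.toGrModule X h'' m (X.act rfl x (B.mul rfl a b)) := by
      intro q' h h' h''
      obtain rfl : q + (j + l) = q' := by omega
      rw [X.act_act rfl h rfl rfl]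
    exact this _ _ _ _
  d h := tensD M X h
  d_act := by
    intro i j l i' j' l' h hi hj hl h₁ h₂ z b
    simp only [LinearMap.mk₂_apply]
    rw [← LinearMap.comp_apply, ← LinearMap.comp_apply, ← LinearMap.smul_apply,
      ← LinearMap.add_apply]
    revert z
    rw [← LinearMap.ext_iff]
    apply tens_ext
    intro p q e m x
    simp only [tensD, tensAct, tlift_tmk, LinearMap.compl₂_apply, LinearMap.flip_apply,
      LinearMap.comp_apply, LinearMap.add_apply, LinearMap.smul_apply, map_add, map_smul]
    rw [X.d_act rfl rfl hj rfl (show q + 1 + j = q + j + 1 by omega)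
      (show q + j' = q + j + 1 by omega)]
    simp only [map_add, map_smul]
    have : ∀ (q₁ q₂ : ℤ) (e₁ : q + 1 + j = q₁) (e₁' : p + q₁ = l') (e₂ : q + j' = q₂)
        (e₂' : p + q₂ = l') (f₁ : p + (q + 1 + j) = l') (f₂ : p + (q + j') = l'),
        tmk M.toGrModule X e₁' m (X.act e₁ (X.d rfl x) b) =
          tmk M.toGrModule X f₁ m (X.act rfl (X.d rfl x) b) ∧
        tmk M.toGrModule X e₂' m (X.act e₂ x (B.d hj b)) =
          tmk M.toGrModule X f₂ m (X.act rfl x (B.d hj b)) := by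
      intro q₁ q₂ e₁ e₁' e₂ e₂' f₁ f₂
      subst e₁ e₂
      exact ⟨rfl, rfl⟩
    rw [(this _ _ _ _ (show q + j' = q + j' from rfl) (by omega) (by omega) (by omega)).1,
      (this _ _ (show q + 1 + j = q + 1 + j from rfl) (by omega) _ _ (by omega) (by omega)).2,
      show sgn R i = sgn R p * sgn R q by rw [← e, sgn_add]]
    module
  d_d := by
    intro i j l h h' h₁ z
    simp only [LinearMap.mk₂_apply]
    rw [← LinearMap.comp_apply, ← LinearMap.neg_apply]
    revert z
    rw [← LinearMap.ext_iff]
    apply tens_ext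
    intro p q e m x
    simp only [tensD, tensAct, tlift_tmk, LinearMap.compl₂_apply, LinearMap.flip_apply,
      LinearMap.comp_apply, LinearMap.add_apply, LinearMap.smul_apply, map_add, map_smul,
      LinearMap.neg_apply]
    rw [M.d_d _ _ (show p + 2 = p + 1 + 1 by omega),
      X.d_d _ _ (show 2 + q = q + 1 + 1 by omega) (show q + 2 = q + 1 + 1 by omega)]
    simp only [map_sub, map_neg, LinearMap.neg_apply]
    rw [tmk_act _ (show 2 + q = q + 1 + 1 by omega) _ (by omega)]
    have : ∀ (q₁ : ℤ) (e₁ : q + 2 = q₁) (e₁' : p + q₁ = l) (f₁ : p + (q + 2) = l),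
        tmk M.toGrModule X e₁' m (X.act e₁ x B.curv) =
          tmk M.toGrModule X f₁ m (X.act rfl x B.curv) := by
      intro q₁ e₁ e₁' f₁
      subst e₁
      rfl
    rw [this _ _ _ (by omega), sgn_add, sgn_one]
    have hs := sgn_mul_self (R := R) p
    simp only [smul_sub, smul_add, smul_smul, hs]
    module

/-- The map `f ⊗ X : M ⊗_A X ⟶ N ⊗_A X` in degree `l`. -/
def tensMap {M N : CDGModule A} (X : CDGBimodule A B) (f : M ⟶ N) (l : ℤ) :
    Tens M.toGrModule X l →ₗ[R] Tens N.toGrModule X l :=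
  tlift (fun p _ e => (tmk N.toGrModule X e).comp (CDGModule.Hom.f f p)) (by
    intro p a q pa aq h₁ h₂ h₃ h₄ m y x
    simp only [LinearMap.comp_apply, CDGModule.Hom.f_act f]
    exact tmk_act _ _ _ _ _ _ _)

@[simp] theorem tensMap_tmk {M N : CDGModule A} (X : CDGBimodule A B) (f : M ⟶ N) {i j l : ℤ}
    (h : i + j = l) (m : M.C i) (x : X.C j) :
    tensMap X f l (tmk M.toGrModule X h m x) = tmk N.toGrModule X h (CDGModule.Hom.f f i m) x := by
  simp [tensMap]

/-- The map `h ⊗ X : M ⊗_A X ⟶ N ⊗_A X` of degree `-1` for a homotopy `h`. -/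
def tensHtpy {M N : CDGModule A} (X : CDGBimodule A B) {f g : M ⟶ N} (s : CDGModule.Homotopy f g)
    {i j : ℤ} (h : j + 1 = i) : Tens M.toGrModule X i →ₗ[R] Tens N.toGrModule X j :=
  tlift (fun p q e' =>
    (tmk N.toGrModule X (show p - 1 + q = j by omega)).comp (s.h (by omega))) (by
    intro p a q pa aq h₁ h₂ h₃ h₄ m y x
    simp only [LinearMap.comp_apply]
    rw [s.h_act h₁ (show p - 1 + 1 = p by omega) _ (by omega)]
    exact tmk_act _ _ _ _ _ _ _)

/-- The functor `- ⊗_A X` on cdg modules. -/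
def tensorFunctor (X : CDGBimodule A B) : CDGModule A ⥤ CDGModule B where
  obj M := M.tensor X
  map {M N} f :=
    { f := fun i => tensMap X f i
      f_act := by
        intro i j l h z b
        refine LinearMap.congr_fun (f := tensMap X f l ∘ₗ tensAct M.toGrModule X h b)
          (g := tensAct N.toGrModule X h b ∘ₗ tensMap X f i) (tens_ext ?_) z
        intro p q e m x
        simp [tensAct]
      f_d := by
        intro i j h z
        refine LinearMap.congr_fun (f := tensMap X f j ∘ₗ tensD M X h)
          (g := tensD N X h ∘ₗ tensMap X f i) (tens_ext ?_) z
        intro p q e m x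
        simp [tensD, CDGModule.Hom.f_d f] }
  map_id M := by
    ext i z
    refine LinearMap.congr_fun (f := tensMap X (𝟙 M) i)
      (g := LinearMap.id) (tens_ext ?_) z
    intro p q e m x
    simp
  map_comp {M N P} f g := by
    ext i z
    refine LinearMap.congr_fun (f := tensMap X (f ≫ g) i)
      (g := tensMap X g i ∘ₗ tensMap X f i) (tens_ext ?_) z
    intro p q e m x
    simp

/-- The functor `- ⊗_A X` on homotopy categories. -/
def hotTensor (X : CDGBimodule A B) : Hot A ⥤ Hot B :=
  CategoryTheory.Quotient.lift _ (tensorFunctor X ⋙ toHot _) (by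
    rintro M N f g ⟨s⟩
    apply CategoryTheory.Quotient.sound
    refine ⟨{ h := fun {i j} e => tensHtpy X s e, h_act := ?_, comm := ?_ }⟩
    · intro i j l i' l' e hi hl e' z b
      refine LinearMap.congr_fun (f := tensHtpy X s hl ∘ₗ tensAct M.toGrModule X e b)
        (g := tensAct N.toGrModule X e' b ∘ₗ tensHtpy X s hi) (tens_ext ?_) z
      intro p q e m x
      simp [tensAct, tensHtpy]
    · intro i j l e e' z
      refine LinearMap.congr_fun (f := tensMap X f i - tensMap X g i)
        (g := tensD N X e ∘ₗ tensHtpy X s e + tensHtpy X s e' ∘ₗ tensD M X e') (tens_ext ?_) z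
      intro p q e₁ m x
      have key : ∀ (p₁ p₂ : ℤ) (h₁ : p₁ + 1 = p) (h₂ : p₂ + 1 = p + 1) (h₃ : p₁ + 1 + q = i)
          (h₄ : p₂ + q = i) (h₅ : p + q = i),
          tmk N.toGrModule X h₃ (N.d rfl (s.h h₁ m)) x +
            tmk N.toGrModule X h₄ (s.h h₂ (M.d rfl m)) x =
          tmk N.toGrModule X h₅ (CDGModule.Hom.f f p m) x -
            tmk N.toGrModule X h₅ (CDGModule.Hom.f g p m) x := by
        intro p₁ p₂ h₁ h₂ h₃ h₄ h₅
        obtain rfl : p₂ = p := by omega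
        subst h₁
        rw [← LinearMap.sub_apply, ← map_sub, s.comm rfl rfl]
        simp
      have hs : sgn R (p - 1) = - sgn R p := by
        have := sgn_add (R := R) (p - 1) 1
        rw [sgn_one, sub_add_cancel] at this
        rw [this]; ring
      simp only [tensD, tensHtpy, LinearMap.sub_apply, tlift_tmk, tensMap_tmk,
        LinearMap.comp_apply, LinearMap.add_apply, LinearMap.smul_apply, LinearMap.compl₂_apply,
        map_add, map_smul]
      rw [← key (p - 1) (p + 1 - 1) (by omega) (by omega) (by omega) (by omega) (by omega), hs]
      module)

/-! ### The Hom functor -/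

section HomFunctor

/-- Degree `l` maps `f : X ⟶ N` of graded right modules: families of maps `f_{ij} : X_i → N_j`,
for `i + l = j`, such that `f (x b) = f (x) b`. -/
def homSub (X N : GrModule B) (l : ℤ) :
    Submodule R (∀ p : {p : ℤ × ℤ // p.1 + l = p.2}, (X.C p.1.1 →ₗ[R] N.C p.1.2)) where
  carrier := {f | ∀ (i b ib j jb : ℤ) (h₁ : i + b = ib) (h₂ : i + l = j) (h₃ : ib + l = jb)
    (h₄ : j + b = jb) (x : X.C i) (y : B.C b),
    f ⟨(ib, jb), h₃⟩ (X.act h₁ x y) = N.act h₄ (f ⟨(i, j), h₂⟩ x) y}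
  add_mem' := by
    intro f g hf hg i b ib j jb h₁ h₂ h₃ h₄ x y
    simp [hf i b ib j jb h₁ h₂ h₃ h₄, hg i b ib j jb h₁ h₂ h₃ h₄]
  zero_mem' := by
    intro i b ib j jb h₁ h₂ h₃ h₄ x y
    simp
  smul_mem' := by
    intro c f hf i b ib j jb h₁ h₂ h₃ h₄ x y
    simp [hf i b ib j jb h₁ h₂ h₃ h₄]

/-- The component `X_i → N_j` of a degree `l` map, where `i + l = j`. -/
def homAp {X N : GrModule B} {l : ℤ} (i j : ℤ) (h : i + l = j) :
    homSub X N l →ₗ[R] X.C i →ₗ[R] N.C j :=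
  (LinearMap.proj (⟨(i, j), h⟩ : {p : ℤ × ℤ // p.1 + l = p.2})).comp (homSub X N l).subtype

/-- Constructor for degree `l` maps of graded right modules. -/
def homMk {X N : GrModule B} {l : ℤ} (f : ∀ i j : ℤ, i + l = j → (X.C i →ₗ[R] N.C j))
    (hf : ∀ (i b ib j jb : ℤ) (h₁ : i + b = ib) (h₂ : i + l = j) (h₃ : ib + l = jb)
      (h₄ : j + b = jb) (x : X.C i) (y : B.C b),
      f ib jb h₃ (X.act h₁ x y) = N.act h₄ (f i j h₂ x) y) : homSub X N l :=
  ⟨fun p => f p.1.1 p.1.2 p.2, hf⟩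

@[simp] theorem homAp_homMk {X N : GrModule B} {l : ℤ}
    (f : ∀ i j : ℤ, i + l = j → (X.C i →ₗ[R] N.C j)) (hf) (i j : ℤ) (h : i + l = j) :
    homAp i j h (homMk (N := N) f hf) = f i j h := rfl

theorem homAp_act {X N : GrModule B} {l : ℤ} (f : homSub X N l) {i b ib j jb : ℤ}
    (h₁ : i + b = ib) (h₂ : i + l = j) (h₃ : ib + l = jb) (h₄ : j + b = jb) (x : X.C i)
    (y : B.C b) : homAp ib jb h₃ f (X.act h₁ x y) = N.act h₄ (homAp i j h₂ f x) y :=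
  f.2 _ _ _ _ _ _ _ _ _ _ _

theorem homSub_ext {X N : GrModule B} {l : ℤ} {f g : homSub X N l}
    (H : ∀ (i j : ℤ) (h : i + l = j) (x : X.C i), homAp i j h f x = homAp i j h g x) : f = g := by
  apply Subtype.ext
  funext ⟨⟨i, j⟩, h⟩
  ext x
  exact H i j h x

/-- The right action of `A` on `Hom_B(X, N)`: `(f a) (x) = f (a x)`. -/
def homAct (X : CDGBimodule A B) (N : GrModule B) {i j l : ℤ} (h : i + j = l)
    (f : homSub X.toGrModule N i) (a : A.C j) : homSub X.toGrModule N l :=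
  homMk (fun p q e => (homAp (j + p) q (by omega) f).comp (X.lact rfl a)) (by
    intro p b pb q qb h₁ h₂ h₃ h₄ x y
    simp only [LinearMap.comp_apply]
    rw [← X.lact_act rfl (show j + p + b = j + pb by omega) h₁ rfl]
    exact homAp_act _ _ _ _ _ _ _)

theorem homAct_apply (X : CDGBimodule A B) (N : GrModule B) {i j l : ℤ} (h : i + j = l)
    (f : homSub X.toGrModule N i) (a : A.C j) {p q p' : ℤ} (e : p + l = q) (e' : j + p = p')
    (e'' : p' + i = q) (x : X.C p) :
    homAp p q e (homAct X N h f a) x = homAp p' q e'' f (X.lact e' a x) := by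
  subst e'
  rfl

/-- The predifferential of `Hom_B(X, N)`: `d f = d ∘ f - (-1)^|f| f ∘ d`. -/
def homD (X : CDGBimodule A B) (N : CDGModule B) {i j : ℤ} (h : i + 1 = j)
    (f : homSub X.toGrModule N.toGrModule i) : homSub X.toGrModule N.toGrModule j :=
  homMk (fun p q e => (N.d (show p + i + 1 = q by omega)).comp (homAp p (p + i) rfl f) -
      sgn R i • (homAp (p + 1) q (by omega) f).comp (X.d rfl)) (by
    intro p b pb q qb h₁ h₂ h₃ h₄ x y
    simp only [LinearMap.comp_apply, LinearMap.sub_apply, LinearMap.smul_apply]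
    rw [homAp_act f h₁ rfl (show pb + i = pb + i from rfl) (show p + i + b = pb + i by omega),
      N.d_act _ (show p + i + 1 = q by omega) rfl _ h₄ (show p + i + (b + 1) = qb by omega),
      X.d_act h₁ rfl rfl rfl (show p + 1 + b = pb + 1 by omega)
        (show p + (b + 1) = pb + 1 by omega), map_add, map_smul,
      homAp_act f _ (show p + 1 + i = q by omega) _ h₄,
      homAp_act f _ (show p + i = p + i from rfl) _ (by omega), sgn_add]
    simp only [map_sub, map_smul, LinearMap.sub_apply, LinearMap.smul_apply]
    module)

theorem homD_apply (X : CDGBimodule A B) (N : CDGModule B) {i j : ℤ} (h : i + 1 = j)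
    (f : homSub X.toGrModule N.toGrModule i) {p q p' q' : ℤ} (e : p + j = q) (e₁ : p + i = q')
    (e₂ : q' + 1 = q) (e₃ : p + 1 = p') (e₄ : p' + i = q) (x : X.C p) :
    homAp p q e (homD X N h f) x =
      N.d e₂ (homAp p q' e₁ f x) - sgn R i • homAp p' q e₄ f (X.d e₃ x) := by
  subst e₁ e₃
  rfl

/-- The cdg module `Hom_B(X, N)` over `A`, for a cdg module `N` over `B` and a cdg `A`-`B`
bimodule `X`. -/
def CDGModule.hom (X : CDGBimodule A B) (N : CDGModule B) : CDGModule A where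
  C l := homSub X.toGrModule N.toGrModule l
  act {i j l} h := LinearMap.mk₂ R (homAct X N.toGrModule h)
    (by intros; rfl) (by intros; rfl)
    (by
      intro f a b
      apply homSub_ext
      intro p q e x
      simp [homAct])
    (by
      intro c f a
      apply homSub_ext
      intro p q e x
      simp [homAct])
  act_one := by
    intro i h f
    apply homSub_ext
    intro p q e x
    change homAp p q e (homAct X N.toGrModule h f A.one) x = homAp p q e f x
    rw [homAct_apply X N.toGrModule h f A.one e (zero_add p) e, X.one_lact]
  act_act := by
    intro i j l ij jl m h₁ h₂ h₃ h₄ f a b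
    apply homSub_ext
    intro p q e x
    change homAp p q e (homAct X N.toGrModule h₂ (homAct X N.toGrModule h₁ f a) b) x =
      homAp p q e (homAct X N.toGrModule h₄ f (A.mul h₃ a b)) x
    rw [homAct_apply X N.toGrModule h₂ _ b e rfl (by omega),
      homAct_apply X N.toGrModule h₁ f a _ (show j + (l + p) = jl + p by omega) (by omega),
      homAct_apply X N.toGrModule h₄ f _ e rfl (by omega), X.lact_lact h₃ rfl rfl (by omega)]
  d {i j} h :=
    { toFun := homD X N h
      map_add' := by
        intro f g
        apply homSub_ext
        intro p q e x
        simp only [homD, homAp_homMk,  LinearMap.sub_apply, LinearMap.comp_apply,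
          LinearMap.add_apply, LinearMap.smul_apply, map_add]
        module
      map_smul' := by
        intro c f
        apply homSub_ext
        intro p q e x
        simp only [homD, homAp_homMk,  LinearMap.sub_apply,
          LinearMap.comp_apply, LinearMap.smul_apply, map_smul, RingHom.id_apply]
        module }
  d_act := by
    intro i j l i' j' l' h hi hj hl h₁ h₂ f a
    apply homSub_ext
    intro p q e x
    change homAp p q e (homD X N hl (homAct X N.toGrModule h f a)) x =
      homAp p q e (homAct X N.toGrModule h₁ (homD X N hi f) a) x +
        sgn R i • homAp p q e (homAct X N.toGrModule h₂ f (A.d hj a)) x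
    rw [homD_apply X N hl _ e rfl (by omega) rfl (by omega),
      homAct_apply X N.toGrModule h f a rfl rfl (by omega),
      homAct_apply X N.toGrModule h f a _ (show j + (p + 1) = j + p + 1 by omega) (by omega),
      homAct_apply X N.toGrModule h₁ _ a e rfl (by omega),
      homD_apply X N hi f _ (show j + p + i = p + l by omega) (by omega) rfl (by omega),
      homAct_apply X N.toGrModule h₂ f _ e (show j' + p = j + p + 1 by omega) (by omega),
      X.d_lact rfl hj rfl rfl (by omega) (by omega), map_add, map_smul,
      show sgn R l = sgn R i * sgn R j by rw [← h, sgn_add]]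
    have hs := sgn_mul_self (R := R) j
    module
  d_d := by
    intro i j l h h' h₁ f
    apply homSub_ext
    intro p q e x
    change homAp p q e (homD X N h' (homD X N h f)) x =
      - homAp p q e (homAct X N.toGrModule h₁ f A.curv) x
    rw [homD_apply X N h' _ e rfl (by omega) rfl (by omega),
      homD_apply X N h f _ rfl (by omega) rfl (by omega),
      homD_apply X N h f _ (show p + 1 + i = p + j by omega) (by omega) rfl (by omega),
      homAct_apply X N.toGrModule h₁ f A.curv e (show 2 + p = p + 1 + 1 by omega) (by omega), map_sub, map_smul,
      N.d_d _ _ (show p + i + 2 = q by omega),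
      X.d_d _ _ (show 2 + p = p + 1 + 1 by omega) (show p + 2 = p + 1 + 1 by omega), map_sub,
      homAp_act f _ (show p + i = p + i from rfl) _ (by omega),
      show sgn R j = - sgn R i by rw [← h, sgn_add, sgn_one]; ring]
    have hs := sgn_mul_self (R := R) i
    simp only [smul_sub, smul_smul, neg_smul, neg_mul, hs]
    module

/-- Composition with a closed degree `0` morphism `N ⟶ P`, as a map `Hom_B(X, N) ⟶ Hom_B(X, P)`. -/
def homPost {N P : CDGModule B} (X : CDGBimodule A B) (f : N ⟶ P) (l : ℤ) :
    homSub X.toGrModule N.toGrModule l →ₗ[R] homSub X.toGrModule P.toGrModule l where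
  toFun g := homMk (fun i j h => (CDGModule.Hom.f f j).comp (homAp i j h g)) (by
    intro i b ib j jb h₁ h₂ h₃ h₄ x y
    simp only [LinearMap.comp_apply]
    rw [homAp_act g h₁ h₂ h₃ h₄, CDGModule.Hom.f_act f])
  map_add' := by
    intro g g'
    apply homSub_ext
    intro i j h x
    simp
  map_smul' := by
    intro c g
    apply homSub_ext
    intro i j h x
    simp

@[simp] theorem homAp_homPost {N P : CDGModule B} (X : CDGBimodule A B) (f : N ⟶ P) {l : ℤ}
    (g : homSub X.toGrModule N.toGrModule l) {i j : ℤ} (h : i + l = j) (x : X.C i) :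
    homAp i j h (homPost X f l g) x = CDGModule.Hom.f f j (homAp i j h g x) := rfl

/-- Composition with a homotopy, as a map of degree `-1`. -/
def homHtpy {N P : CDGModule B} (X : CDGBimodule A B) {f f' : N ⟶ P}
    (s : CDGModule.Homotopy f f') {l l' : ℤ} (h : l' + 1 = l) :
    homSub X.toGrModule N.toGrModule l →ₗ[R] homSub X.toGrModule P.toGrModule l' where
  toFun g := homMk (fun i j e => (s.h rfl).comp (homAp i (j + 1) (by omega) g)) (by
    intro i b ib j jb h₁ h₂ h₃ h₄ x y
    simp only [LinearMap.comp_apply]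
    rw [homAp_act g h₁ (show i + l = j + 1 by omega) _ (show j + 1 + b = jb + 1 by omega),
      s.h_act _ rfl rfl h₄])
  map_add' := by
    intro g g'
    apply homSub_ext
    intro i j h x
    simp
  map_smul' := by
    intro c g
    apply homSub_ext
    intro i j h x
    simp

theorem homAp_homHtpy {N P : CDGModule B} (X : CDGBimodule A B) {f f' : N ⟶ P}
    (s : CDGModule.Homotopy f f') {l l' : ℤ} (h : l' + 1 = l)
    (g : homSub X.toGrModule N.toGrModule l) {i j j' : ℤ} (e : i + l' = j) (e' : j + 1 = j')
    (e'' : i + l = j') (x : X.C i) :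
    homAp i j e (homHtpy X s h g) x = s.h e' (homAp i j' e'' g x) := by
  subst e'
  rfl

/-- The functor `Hom_B(X, -)` on cdg modules. -/
def homFunctor (X : CDGBimodule A B) : CDGModule B ⥤ CDGModule A where
  obj N := N.hom X
  map {N P} f :=
    { f := fun l => homPost X f l
      f_act := by
        intro i j l h g a
        revert g
        change ∀ g : homSub X.toGrModule N.toGrModule i,
          homPost X f l (homAct X N.toGrModule h g a) =
            homAct X P.toGrModule h (homPost X f i g) a
        intro g
        apply homSub_ext
        intro p q e x
        rw [homAct_apply X P.toGrModule h _ a e rfl (by omega), homAp_homPost, homAp_homPost,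
          homAct_apply X N.toGrModule h _ a e rfl (by omega)]
      f_d := by
        intro i j h g
        revert g
        change ∀ g : homSub X.toGrModule N.toGrModule i,
          homPost X f j (homD X N h g) = homD X P h (homPost X f i g)
        intro g
        apply homSub_ext
        intro p q e x
        rw [homD_apply X P h _ e rfl (by omega) rfl (by omega), homAp_homPost, homAp_homPost,
          homAp_homPost, homD_apply X N h _ e rfl (by omega) rfl (by omega), map_sub, map_smul,
          CDGModule.Hom.f_d f] }
  map_id N := by
    ext l g
    rfl
  map_comp {N P Q} f g := by
    ext l g
    rfl

/-- The functor `Hom_B(X, -)` on homotopy categories. -/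
def hotHom (X : CDGBimodule A B) : Hot B ⥤ Hot A :=
  CategoryTheory.Quotient.lift _ (homFunctor X ⋙ toHot _) (by
    rintro N P f f' ⟨s⟩
    apply CategoryTheory.Quotient.sound
    refine ⟨{ h := fun {i j} e => homHtpy X s e, h_act := ?_, comm := ?_ }⟩
    · intro i j l i' l' e hi hl e' g a
      revert g
      change ∀ g : homSub X.toGrModule N.toGrModule i,
        homHtpy X s hl (homAct X N.toGrModule e g a) =
          homAct X P.toGrModule e' (homHtpy X s hi g) a
      intro g
      apply homSub_ext
      intro p q e₁ x
      rw [homAct_apply X P.toGrModule e' _ a e₁ rfl (by omega),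
        homAp_homHtpy X s hl _ e₁ rfl (by omega), homAp_homHtpy X s hi _ _ rfl (by omega),
        homAct_apply X N.toGrModule e _ a _ rfl (by omega)]
    · intro i j l e e' g
      revert g
      change ∀ g : homSub X.toGrModule N.toGrModule i, homPost X f i g - homPost X f' i g =
        homD X P e (homHtpy X s e g) + homHtpy X s e' (homD X N e' g)
      intro g
      apply homSub_ext
      intro p q e₁ x
      simp only [map_sub, map_add, LinearMap.sub_apply, LinearMap.add_apply]
      rw [homD_apply X P e _ e₁ rfl (by omega) rfl (by omega),
        homAp_homHtpy X s e _ _ (show p + j + 1 = q by omega) e₁,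
        homAp_homHtpy X s e _ _ rfl (by omega),
        homAp_homHtpy X s e' _ _ rfl (by omega),
        homD_apply X N e' _ _ e₁ rfl rfl (by omega), homAp_homPost, homAp_homPost,
        s.comm (show p + j + 1 = q by omega) rfl,
        show sgn R i = - sgn R j by rw [← e, sgn_add, sgn_one]; ring, map_sub, map_smul]
      module)

/-- The evaluation morphism `Hom_B(X, N) ⊗_A X ⟶ N`, `f ⊗ x ↦ f (x)`, i.e. the counit of the
adjunction between `- ⊗_A X` and `Hom_B(X, -)`. -/
def evalLin (X : CDGBimodule A B) (N : CDGModule B) (l : ℤ) :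
    Tens (N.hom X).toGrModule X l →ₗ[R] N.C l :=
  tlift (M := (N.hom X).toGrModule) (fun p q h => homAp (N := N.toGrModule) q l (by omega)) (by
    intro p a q pa aq h₁ h₂ h₃ h₄ f y x
    exact homAct_apply X N.toGrModule h₁ f y _ h₂ _ x)

theorem evalLin_tmk (X : CDGBimodule A B) (N : CDGModule B) {p q l : ℤ} (h : p + q = l)
    (h' : q + p = l) (f : homSub X.toGrModule N.toGrModule p) (x : X.C q) :
    evalLin X N l (tmk (N.hom X).toGrModule X h f x) = homAp q l h' f x :=
  tlift_tmk (M := (N.hom X).toGrModule) _ _ h f x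

/-- The evaluation `Hom_B(X, N) ⊗_A X ⟶ N`, `f ⊗ x ↦ f (x)`, as a morphism of cdg modules. -/
def evalHom (X : CDGBimodule A B) (N : CDGModule B) :
    (tensorFunctor X).obj ((homFunctor X).obj N) ⟶ N where
  f l := evalLin X N l
  f_act := by
    intro i j l h z b
    refine LinearMap.congr_fun (f := evalLin X N l ∘ₗ tensAct (N.hom X).toGrModule X h b)
      (g := (N.act h).flip b ∘ₗ evalLin X N i) (tens_ext ?_) z
    intro p q e f x
    simp only [tensAct, LinearMap.comp_apply, tlift_tmk, LinearMap.compl₂_apply,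
      LinearMap.flip_apply]
    refine (evalLin_tmk X N _ (by omega) f _).trans ?_
    refine Eq.trans ?_ (congrArg (fun z => N.act h z b) (evalLin_tmk X N e (by omega) f x).symm)
    exact homAp_act (N := N.toGrModule) f _ _ _ _ x b
  f_d := by
    intro i j h z
    refine LinearMap.congr_fun (f := evalLin X N j ∘ₗ tensD (N.hom X) X h)
      (g := N.d h ∘ₗ evalLin X N i) (tens_ext ?_) z
    intro p q e f x
    simp only [tensD, LinearMap.comp_apply, tlift_tmk, LinearMap.compl₂_apply,
      LinearMap.add_apply, LinearMap.smul_apply, map_add, map_smul]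
    refine Eq.trans ?_ (congrArg (N.d h) (evalLin_tmk X N e (by omega) f x).symm)
    refine (congrArg₂ (fun a b => a + sgn R p • b)
      (evalLin_tmk X N _ (show q + (p + 1) = j by omega) (homD X N rfl f) x)
      (evalLin_tmk X N _ (show q + 1 + p = j by omega) f _)).trans ?_
    rw [homD_apply X N rfl f _ (show q + p = i by omega) h rfl (show q + 1 + p = j by omega)]
    exact sub_add_cancel _ _

end HomFunctor

/-! ### Quasi-isomorphisms and cofibrant dg modules -/

namespace CDGModule

/-- The cohomology `Ker d / Im d` in degree `i` (of interest when `d² = 0`). -/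
abbrev cohomology (M : CDGModule A) (i : ℤ) : Type u :=
  ↥(LinearMap.ker (M.d (i := i) rfl)) ⧸
    (LinearMap.range (M.d (sub_add_cancel i 1))).submoduleOf (LinearMap.ker (M.d (i := i) rfl))

/-- The map induced on cohomology by a closed degree `0` morphism. -/
def cohomologyMap {M N : CDGModule A} (f : M ⟶ N) (i : ℤ) :
    M.cohomology i →ₗ[R] N.cohomology i :=
  Submodule.mapQ _ _
    ((Hom.f f i).restrict (p := LinearMap.ker (M.d rfl)) (q := LinearMap.ker (N.d rfl)) (by
      intro m hm
      rw [LinearMap.mem_ker] at hm ⊢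
      rw [← Hom.f_d f, hm, map_zero])) (by
    rintro ⟨m, hm⟩ ⟨m', hm'⟩
    exact ⟨Hom.f f _ m', by rw [← Hom.f_d f, hm']; rfl⟩)

/-- Quasi-isomorphisms (of modules over a dg algebra). -/
def IsQuasiIso {M N : CDGModule A} (f : M ⟶ N) : Prop :=
  ∀ i, Function.Bijective (cohomologyMap f i)

/-- A module `P` over a dg algebra is cofibrant (for the projective model structure) if it has the
left lifting property against all surjective quasi-isomorphisms. -/
def IsCofibrant (P : CDGModule A) : Prop :=
  ∀ (M N : CDGModule A) (p : M ⟶ N) (f : P ⟶ N), (∀ i, Function.Surjective (Hom.f p i)) →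
    IsQuasiIso p → ∃ g : P ⟶ M, g ≫ p = f

end CDGModule

/-! ### The `t`-adic filtration and acyclicity of the associated graded -/

section Filtration

/-- The submodule `t^s M` of `M`, in degree `p`. -/
def tFil (t : R) (M : GrModule A) (s : ℕ) (p : ℤ) : Submodule R (M.C p) :=
  LinearMap.range (LinearMap.lsmul R (M.C p) (t ^ s))

theorem map_mem_tFil {t : R} {M : CDGModule A} {s : ℕ} {i j : ℤ} (h : i + 1 = j) {m : M.C i}
    (hm : m ∈ tFil t M.toGrModule s i) : M.d h m ∈ tFil t M.toGrModule s j := by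
  obtain ⟨m, rfl⟩ := hm
  exact ⟨M.d h m, by simp⟩

/-- The degree `p` part of `Gr^s_t(M) = t^s M / t^(s+1) M`. -/
abbrev grPiece (t : R) (M : GrModule A) (s : ℕ) (p : ℤ) : Type u :=
  ↥(tFil t M s p) ⧸ (tFil t M (s + 1) p).submoduleOf (tFil t M s p)

/-- The map induced by the predifferential on `Gr^s_t(M)`. -/
def grD (t : R) (M : CDGModule A) (s : ℕ) {p q : ℤ} (h : p + 1 = q) :
    grPiece t M.toGrModule s p →ₗ[R] grPiece t M.toGrModule s q :=
  Submodule.mapQ _ _ ((M.d h).restrict fun _ hm => map_mem_tFil h hm) (by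
    rintro ⟨m, hm⟩ hm'
    exact map_mem_tFil h hm')

/-- `Gr_t(M) = ⨁_s t^s M / t^(s+1) M` is acyclic: the sequence
`Gr^s_t(M)_p → Gr^s_t(M)_{p+1} → Gr^s_t(M)_{p+2}` is exact for all `s` and `p`. -/
def IsGrAcyclic (t : R) (M : CDGModule A) : Prop :=
  ∀ (s : ℕ) (p q r : ℤ) (h : p + 1 = q) (h' : q + 1 = r),
    Function.Exact (grD t M s h) (grD t M s h')

end Filtration

/-! ### Deformations over `k[t]/(t^(n+1))` and the `n`-derived category -/

/-- The ring `R_n = k[t]/(t^(n+1))`. -/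
abbrev TruncPoly (k : Type u) [Field k] (n : ℕ) : Type u :=
  Polynomial k ⧸ Ideal.span {(Polynomial.X ^ (n + 1) : Polynomial k)}

/-- The element `t` of `R_n`. -/
def tVar (k : Type u) [Field k] (n : ℕ) : TruncPoly k n := Ideal.Quotient.mk _ Polynomial.X

/-- The augmentation `R_n → k`, `t ↦ 0`. -/
def augm (k : Type u) [Field k] (n : ℕ) : TruncPoly k n →ₐ[k] k :=
  Ideal.Quotient.liftₐ _ (Polynomial.aeval (0 : k)) (by
    intro a ha
    obtain ⟨b, rfl⟩ := Ideal.mem_span_singleton.1 ha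
    simp)

variable {k : Type u} [Field k]

/-- The reduction `R_n ⊗_k V → V` modulo `t`. -/
def redTensor (n : ℕ) (V : Type u) [AddCommGroup V] [Module k V] :
    TruncPoly k n ⊗[k] V →ₗ[k] V :=
  (TensorProduct.lid k V).toLinearMap ∘ₗ LinearMap.rTensor V (augm k n).toLinearMap

/-- A cdg deformation `A_n` of the dg algebra `A` over `R_n = k[t]/(t^(n+1))`: a cdg algebra `alg`
over `R_n`, whose underlying graded `R_n`-module is identified with `R_n ⊗_k A`, and whose structure
(multiplication, unit, predifferential and curvature) reduces modulo `t` to the one of `A`. -/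
structure Deformation (A : DGAlgebra k) (n : ℕ) where
  alg : CDGAlgebra (TruncPoly k n)
  iso : ∀ i, (TruncPoly k n ⊗[k] A.C i) ≃ₗ[TruncPoly k n] alg.C i
  red_mul : ∀ {i j l : ℤ} (h : i + j = l) (a : alg.C i) (b : alg.C j),
    redTensor n _ ((iso l).symm (alg.mul h a b)) =
      A.mul h (redTensor n _ ((iso i).symm a)) (redTensor n _ ((iso j).symm b))
  red_one : redTensor n _ ((iso 0).symm alg.one) = A.one
  red_d : ∀ {i j : ℤ} (h : i + 1 = j) (a : alg.C i),
    redTensor n _ ((iso j).symm (alg.d h a)) = A.d h (redTensor n _ ((iso i).symm a))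
  red_curv : redTensor n _ ((iso 2).symm alg.curv) = A.curv

namespace Deformation

variable {n : ℕ} {A B : DGAlgebra k} (An : Deformation A n) (Bn : Deformation B n)

/-- The reduction map `A_n → A` modulo `t`. -/
def red (i : ℤ) (a : An.alg.C i) : A.C i := redTensor n _ ((An.iso i).symm a)

/-- The `k`-linear section `a ↦ 1 ⊗ a` of the reduction map `A_n → A`. -/
def lift (i : ℤ) (a : A.C i) : An.alg.C i := An.iso i (1 ⊗ₜ a)

theorem red_lift (i : ℤ) (a : A.C i) : An.red i (An.lift i a) = a := by
  simp [red, lift, redTensor]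

theorem exists_sub_eq_tVar_smul (r : TruncPoly k n) :
    ∃ s, r - algebraMap k _ (augm k n r) = s * tVar k n := by
  obtain ⟨p, rfl⟩ := Ideal.Quotient.mk_surjective r
  have h : (Polynomial.X : Polynomial k) ∣ p - Polynomial.C (p.eval 0) := by
    rw [Polynomial.X_dvd_iff]
    simp [Polynomial.coeff_zero_eq_eval_zero]
  obtain ⟨q, hq⟩ := h
  refine ⟨Ideal.Quotient.mk _ q, ?_⟩
  rw [tVar, ← map_mul, mul_comm q, ← hq, map_sub]
  congr 1

theorem exists_sub_lift_red (i : ℤ) (a : An.alg.C i) :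
    ∃ b, a - An.lift i (An.red i a) = tVar k n • b := by
  obtain ⟨z, rfl⟩ := (An.iso i).surjective a
  simp only [red, lift, LinearEquiv.symm_apply_apply]
  induction z with
  | zero => exact ⟨0, by simp⟩
  | add x y hx hy =>
    obtain ⟨b, hb⟩ := hx
    obtain ⟨c, hc⟩ := hy
    refine ⟨b + c, ?_⟩
    rw [smul_add, ← hb, ← hc]
    simp only [map_add, TensorProduct.tmul_add]
    abel
  | tmul r v =>
    obtain ⟨s, hs⟩ := exists_sub_eq_tVar_smul r
    refine ⟨An.iso i (s ⊗ₜ v), ?_⟩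
    rw [← map_sub, ← map_smul]
    congr 1
    simp only [redTensor, LinearMap.comp_apply, LinearMap.rTensor_tmul, LinearEquiv.coe_coe,
      TensorProduct.lid_tmul, AlgHom.toLinearMap_apply, TensorProduct.smul_tmul']
    rw [← TensorProduct.smul_tmul, ← TensorProduct.sub_tmul, smul_eq_mul, mul_comm, ← hs,
      Algebra.algebraMap_eq_smul_one]

theorem sub_mem_of_red_eq {M : GrModule An.alg} {i j l : ℤ} (h : i + j = l) (x : M.C i)
    (a b : An.alg.C j) (hab : An.red j a = An.red j b) :
    M.act h x a - M.act h x b ∈ tFil (tVar k n) M 1 l := by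
  obtain ⟨c, hc⟩ := An.exists_sub_lift_red j a
  obtain ⟨c', hc'⟩ := An.exists_sub_lift_red j b
  refine ⟨M.act h x (c - c'), ?_⟩
  rw [← map_sub, ← sub_sub_sub_cancel_right a b (An.lift j (An.red j a)), hc]
  nth_rw 1 [hab]
  rw [hc', ← smul_sub]
  simp

variable (X : CDGBimodule An.alg Bn.alg)

/-- The degree `i` part of the reduction `X_n ⊗_{R_n} k = X_n / t X_n`. -/
def RedC (i : ℤ) : Type u := X.C i ⧸ tFil (tVar k n) X.toGrModule 1 i

instance (i : ℤ) : AddCommGroup (RedC An Bn X i) :=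
  inferInstanceAs (AddCommGroup (X.C i ⧸ tFil (tVar k n) X.toGrModule 1 i))

instance (i : ℤ) : Module (TruncPoly k n) (RedC An Bn X i) :=
  inferInstanceAs (Module (TruncPoly k n) (X.C i ⧸ tFil (tVar k n) X.toGrModule 1 i))

instance (i : ℤ) : Module k (RedC An Bn X i) :=
  Module.compHom _ (algebraMap k (TruncPoly k n))

/-- The projection `X_n → X_n / t X_n`. -/
def redMk (i : ℤ) : X.C i →ₗ[TruncPoly k n] RedC An Bn X i := Submodule.mkQ _

theorem redMk_surjective (i : ℤ) : Function.Surjective (redMk An Bn X i) :=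
  Submodule.mkQ_surjective _

theorem redMk_eq {i : ℤ} {x y : X.C i} (h : x - y ∈ tFil (tVar k n) X.toGrModule 1 i) :
    redMk An Bn X i x = redMk An Bn X i y := (Submodule.Quotient.eq _).2 h

theorem algebraMap_smul_redC (i : ℤ) (c : k) (x : RedC An Bn X i) :
    c • x = algebraMap k (TruncPoly k n) c • x := rfl

theorem sgn_smul_redC (i j : ℤ) (x : RedC An Bn X i) :
    sgn k j • x = sgn (TruncPoly k n) j • x := by
  rw [algebraMap_smul_redC, sgn, sgn, map_intCast]

/-- The action of `B_n` on `X_n / t X_n`. -/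
def redAct {i j l : ℤ} (h : i + j = l) (b : Bn.alg.C j) :
    RedC An Bn X i →ₗ[TruncPoly k n] RedC An Bn X l :=
  Submodule.mapQ _ _ ((X.act h).flip b) (by
    rintro _ ⟨x, rfl⟩
    exact ⟨X.act h x b, by simp⟩)

theorem redAct_redMk {i j l : ℤ} (h : i + j = l) (b : Bn.alg.C j) (x : X.C i) :
    redAct An Bn X h b (redMk An Bn X i x) = redMk An Bn X l (X.act h x b) := rfl

theorem red_lift_mul {j l jl : ℤ} (h : j + l = jl) (a : B.C j) (b : B.C l) :
    Bn.red jl (Bn.alg.mul h (Bn.lift j a) (Bn.lift l b)) =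
      Bn.red jl (Bn.lift jl (B.mul h a b)) := by
  rw [red_lift]
  refine (Bn.red_mul h _ _).trans ?_
  exact congrArg₂ (fun u v => B.mul h u v) (Bn.red_lift j a) (Bn.red_lift l b)

theorem redAct_redAct {i j l ij jl m : ℤ} (h₁ : i + j = ij) (h₂ : ij + l = m) (h₃ : j + l = jl)
    (h₄ : i + jl = m) (x : RedC An Bn X i) (a : B.C j) (b : B.C l) :
    redAct An Bn X h₂ (Bn.lift l b) (redAct An Bn X h₁ (Bn.lift j a) x) =
      redAct An Bn X h₄ (Bn.lift jl (B.mul h₃ a b)) x := by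
  obtain ⟨x, rfl⟩ := redMk_surjective An Bn X _ x
  rw [redAct_redMk, redAct_redMk, redAct_redMk, X.act_act h₁ h₂ h₃ h₄]
  exact redMk_eq _ _ _ (Bn.sub_mem_of_red_eq _ _ _ _ (red_lift_mul Bn h₃ a b))

/-- The predifferential of `X_n / t X_n`. -/
def redD {i j : ℤ} (h : i + 1 = j) : RedC An Bn X i →ₗ[TruncPoly k n] RedC An Bn X j :=
  Submodule.mapQ _ _ (X.d h) (by
    rintro _ ⟨x, rfl⟩
    exact ⟨X.d h x, by simp⟩)

theorem redD_redMk {i j : ℤ} (h : i + 1 = j) (x : X.C i) :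
    redD An Bn X h (redMk An Bn X i x) = redMk An Bn X j (X.d h x) := rfl

/-- The action of `B` on `X_n / t X_n`: the action of `b : B` is that of any lift of `b` to `B_n`. -/
def redActB {i j l : ℤ} (h : i + j = l) : RedC An Bn X i →ₗ[k] B.C j →ₗ[k] RedC An Bn X l :=
  LinearMap.mk₂ k (fun x b => redAct An Bn X h (Bn.lift j b) x)
    (fun x y b => map_add _ x y)
    (fun c x b => map_smul (redAct An Bn X h (Bn.lift j b)) (algebraMap k (TruncPoly k n) c) x)
    (by
      intro x b b'
      obtain ⟨x, rfl⟩ := redMk_surjective An Bn X _ x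
      rw [redAct_redMk, redAct_redMk, redAct_redMk, lift, lift, lift, TensorProduct.tmul_add,
        map_add, map_add, map_add])
    (by
      intro c x b
      obtain ⟨x, rfl⟩ := redMk_surjective An Bn X _ x
      rw [redAct_redMk, redAct_redMk, algebraMap_smul_redC, ← map_smul, ← map_smul, lift, lift,
        ← map_smul, TensorProduct.tmul_smul, algebraMap_smul])

theorem redAct_one {i : ℤ} (h : i + 0 = i) (x : RedC An Bn X i) :
    redAct An Bn X h (Bn.lift 0 B.one) x = x := by
  obtain ⟨x, rfl⟩ := redMk_surjective An Bn X _ x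
  rw [redAct_redMk]
  apply redMk_eq
  have := Bn.sub_mem_of_red_eq (M := X.toGrModule) h x (Bn.lift 0 B.one) Bn.alg.one
    (by rw [red_lift]; exact Bn.red_one.symm)
  rwa [X.act_one] at this

theorem redD_redAct {i j l i' j' l' : ℤ} (h : i + j = l) (hi : i + 1 = i') (hj : j + 1 = j')
    (hl : l + 1 = l') (h₁ : i' + j = l') (h₂ : i + j' = l') (x : RedC An Bn X i) (b : B.C j) :
    redD An Bn X hl (redAct An Bn X h (Bn.lift j b) x) =
      redAct An Bn X h₁ (Bn.lift j b) (redD An Bn X hi x) +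
        sgn k i • redAct An Bn X h₂ (Bn.lift j' (B.d hj b)) x := by
  obtain ⟨x, rfl⟩ := redMk_surjective An Bn X _ x
  rw [redAct_redMk, redD_redMk, redD_redMk, redAct_redMk, redAct_redMk, sgn_smul_redC,
    X.d_act h hi hj hl h₁ h₂, map_add, map_smul]
  have hb : Bn.red j' (Bn.alg.d hj (Bn.lift j b)) = Bn.red j' (Bn.lift j' (B.d hj b)) := by
    rw [red_lift]
    exact (Bn.red_d hj _).trans (congrArg (B.d hj) (Bn.red_lift j b))
  rw [redMk_eq An Bn X (Bn.sub_mem_of_red_eq h₂ x _ _ hb)]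

theorem redD_redD {i j l : ℤ} (h : i + 1 = j) (h' : j + 1 = l) (h₁ : i + 2 = l)
    (x : RedC An Bn X i) :
    redD An Bn X h' (redD An Bn X h x) = - redAct An Bn X h₁ (Bn.lift 2 B.curv) x := by
  obtain ⟨x, rfl⟩ := redMk_surjective An Bn X _ x
  rw [redD_redMk, redD_redMk, redAct_redMk, X.d_d h h' (by omega) h₁, map_sub, sub_eq_add_neg]
  have hA : redMk An Bn X l (X.lact (show 2 + i = l by omega) An.alg.curv x) = 0 := by
    obtain ⟨c, hc⟩ := An.exists_sub_lift_red 2 An.alg.curv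
    have h0 : An.red 2 An.alg.curv = 0 := An.red_curv.trans A.curv_eq_zero
    rw [h0, lift, TensorProduct.tmul_zero, map_zero, sub_zero] at hc
    refine (Submodule.Quotient.mk_eq_zero _).2 ⟨X.lact (show 2 + i = l by omega) c x, ?_⟩
    rw [hc]
    simp
  have hb : Bn.red 2 Bn.alg.curv = Bn.red 2 (Bn.lift 2 B.curv) := by
    rw [red_lift]
    exact Bn.red_curv
  rw [hA, zero_add, redMk_eq An Bn X (Bn.sub_mem_of_red_eq h₁ x _ _ hb)]

/-- The reduction `X = X_n ⊗_{R_n} k = X_n / t X_n` of a cdg `A_n`-`B_n` bimodule `X_n`, as a dg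
module over `B`. -/
def reduction : CDGModule B.toCDGAlgebra where
  C i := RedC An Bn X i
  act h := redActB An Bn X h
  act_one h x := redAct_one An Bn X h x
  act_act h₁ h₂ h₃ h₄ x a b := redAct_redAct An Bn X h₁ h₂ h₃ h₄ x a b
  d h :=
    { toFun := redD An Bn X h
      map_add' := map_add _
      map_smul' := fun c x => map_smul (redD An Bn X h) (algebraMap k (TruncPoly k n) c) x }
  d_act h hi hj hl h₁ h₂ x b := redD_redAct An Bn X h hi hj hl h₁ h₂ x b
  d_d h h' h₁ x := redD_redD An Bn X h h' h₁ x

variable {An Bn X}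

/-- The morphisms of `Hot(A_n)` whose cone is `n`-acyclic, i.e. has acyclic associated graded with
respect to the `t`-adic filtration. -/
def nW (An : Deformation A n) : MorphismProperty (Hot An.alg) := fun M N f =>
  ∃ φ : M.as ⟶ N.as, (toHot _).map φ = f ∧
    IsGrAcyclic (tVar k n) (CDGModule.cone φ)

/-- The `n`-derived category `D^n(A_n)`: the (Verdier) quotient of the homotopy category `Hot(A_n)`
by the subcategory of `n`-acyclic modules, i.e. its localization at the morphisms with `n`-acyclic
cone. -/
abbrev NDerived (An : Deformation A n) := An.nW.Localization

/-- The quotient functor `Hot(A_n) ⥤ D^n(A_n)`. -/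
abbrev quot (An : Deformation A n) : Hot An.alg ⥤ An.NDerived := An.nW.Q

end Deformation

end CDG

end

open CDG

noncomputable section

namespace CDG

/-! ### Derived functors and adjunctions between localizations. -/

section Formal

open Functor

variable {C D E : Type*} [Category* C] [Category* D] [Category* E]

/-! Most of the statement is formal. If `p ⊣ L`, then `p ⋙ F` with the whiskered counit is the right
Kan extension of any `F` along `L`, which is part 3. The same holds after composition with any
further functor, so once Hom descends to the localizations, the adjunction `- ⊗ X ⊣ Hom(X, -)` on
homotopy categories passes to derived functors, with the expected counit
(`exists_derived_adjunction`). Two facts with content remain.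

Existence of `p_n`. It suffices to find for each `M` a morphism `P ⟶ M` with acyclic cone such that
every morphism from `P` to a module with acyclic associated graded is nullhomotopic
(`isRightAdjoint_Q_of_resolutions`, `bijective_comp_of_isHProj`). Acyclicity of `Gr_t` is an
elementwise condition: if `t^s d x = t^(s+1) w`, then `t^s x = t^s d y + t^(s+1) z` for some `y`,
`z` (`IsTAcyclic`). Hence one can freely adjoin to `M` symbols for all such `y` and `z`, obtaining a
universal `M ⟶ N` with `N` acyclic in this sense. Let `P` be its fiber. The cone of `P ⟶ M` is
acyclic because `N` is (`isTAcyclic_cone_fromFiber`). A nullhomotopy of `F : P ⟶ Z` is an `A`-linear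
extension to `N` of minus the restriction of `F` to `M`, whose failure to commute with `d` is the
restriction of `F` to `N[-1]`. Such an extension is defined by recursion on expressions, acyclicity
of `Z` providing the values of the new symbols (`isHProj_fiber_toRes`).

Descent of Hom. Since `Hom(X, -)` commutes with cones, it is enough that it preserves acyclicity of
`Gr_t` (`isTAcyclic_hom`). A map `f : X ⟶ Z` closed at level `s` induces a dg morphism from the
reduction of `X` to a shift of the acyclic module `Gr^s Z`. Cofibrancy makes it nullhomotopic, and
graded projectivity lifts first the nullhomotopy and then the remaining error term to `Z`. -/

/-- If `p` is left adjoint to `L`, then `p ⋙ F` is the right Kan extension of `F` along `L`. -/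
theorem isRightKanExtension_of_adjunction {L : C ⥤ D} {p : D ⥤ C} (adj : p ⊣ L) (F : C ⥤ E)
    (α : L ⋙ (p ⋙ F) ⟶ F) (hα : ∀ X, α.app X = F.map (adj.counit.app X)) :
    (p ⋙ F).IsRightKanExtension α where
  nonempty_isUniversal := by
    refine ⟨Limits.IsTerminal.ofUniqueHom (fun G => CostructuredArrow.homMk
      (show G.left ⟶ p ⋙ F from
        { app := fun Y => G.left.map (adj.unit.app Y) ≫ G.hom.app (p.obj Y)
          naturality := ?_ }) ?_) ?_⟩
    · intro Y Z f
      have h₁ := G.hom.naturality (p.map f)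
      have h₂ := adj.unit.naturality f
      dsimp at h₁ h₂ ⊢
      rw [← Category.assoc, ← Functor.map_comp, h₂, Category.assoc, Functor.map_comp,
        Category.assoc, h₁]
    · ext X
      have h := G.hom.naturality (adj.counit.app X)
      change (G.left.map (adj.unit.app (L.obj X)) ≫ G.hom.app (p.obj (L.obj X))) ≫ α.app X = _
      dsimp at h
      rw [hα, Category.assoc, ← h, ← Category.assoc, ← Functor.map_comp,
        adj.right_triangle_components]
      exact (congrArg (· ≫ G.hom.app X) (G.left.map_id _)).trans (Category.id_comp _)
    · intro G m
      apply CostructuredArrow.hom_ext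
      ext Y
      let n : G.left ⟶ p ⋙ F := m.left
      -- Naturality of `n` along the unit expresses `n` at `Y` through its value at `L (p Y)`, which
      -- is fixed by compatibility with `α`; the left triangle identity cancels the rest.
      have h₁ : n.app (L.obj (p.obj Y)) ≫ α.app (p.obj Y) = G.hom.app (p.obj Y) :=
        NatTrans.congr_app (CostructuredArrow.w m) (p.obj Y)
      have h₂ : G.left.map (adj.unit.app Y) ≫ n.app (L.obj (p.obj Y)) =
          n.app Y ≫ F.map (p.map (adj.unit.app Y)) := n.naturality (adj.unit.app Y)
      change n.app Y = G.left.map (adj.unit.app Y) ≫ G.hom.app (p.obj Y)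
      rw [← h₁, reassoc_of% h₂, hα, ← F.map_comp, adj.left_triangle_components, F.map_id]
      exact (Category.comp_id _).symm

theorem isLeftDerivedFunctor_of_adjunction {L : C ⥤ D} {p : D ⥤ C} (adj : p ⊣ L) (F : C ⥤ E)
    (α : L ⋙ (p ⋙ F) ⟶ F) (hα : ∀ X, α.app X = F.map (adj.counit.app X))
    (W : MorphismProperty C) [L.IsLocalization W] : (p ⋙ F).IsLeftDerivedFunctor α W :=
  ⟨isRightKanExtension_of_adjunction adj F α hα⟩

section Corepresents

variable (W : MorphismProperty C) {P : C}

/-- If `Hom(P, -)` inverts `W`, then every morphism of the localization out of the image of `P`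
comes from a morphism of the original category. -/
theorem map_surjective_of_isColocal
    (hP : ∀ ⦃M N : C⦄ (w : M ⟶ N), W w → Function.Bijective fun g : P ⟶ M => g ≫ w)
    {N : C} (g : W.Q.obj P ⟶ W.Q.obj N) : ∃ b : P ⟶ N, W.Q.map b = g := by
  -- `T g` says that `g` comes from the original category. The morphisms `f` such that `T` is stable
  -- under `- ≫ f` are closed under composition, so it is enough to treat the generators of the
  -- localization: morphisms of `C` and formal inverses of `W`.
  let T : ∀ {d : W.Localization}, (W.Q.obj P ⟶ d) → Prop := fun {d} g =>
    ∀ (N : C) (e : W.Q.obj N = d), ∃ b : P ⟶ N, W.Q.map b ≫ eqToHom e = g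
  let S : MorphismProperty W.Localization := fun d d' f =>
    ∀ g : W.Q.obj P ⟶ d, T g → T (g ≫ f)
  have hS : S.IsStableUnderComposition := ⟨fun f f' hf hf' g hg => by
    rw [← Category.assoc]
    exact hf' _ (hf _ hg)⟩
  have inj : ∀ {X Y : C}, W.Q.obj X = W.Q.obj Y → X = Y := fun h =>
    (Localization.Construction.objEquiv W).injective h
  have top : S = ⊤ := by
    apply Localization.Construction.morphismProperty_eq_top
    · intro X Y f g hg N e
      obtain rfl := inj e
      obtain ⟨b, rfl⟩ := hg X rfl
      exact ⟨b ≫ f, by simp⟩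
    · intro X Y w hw g hg N e
      obtain rfl := inj e
      obtain ⟨b, rfl⟩ := hg Y rfl
      -- For a formal inverse, the representative `b` is factored through `w` by the surjectivity
      -- half of `hP`.
      obtain ⟨c, rfl⟩ := (hP w hw).2 b
      refine ⟨c, ?_⟩
      have : W.Q.map w ≫ Localization.Construction.wInv w hw = 𝟙 _ :=
        (Localization.Construction.wIso w hw).hom_inv_id
      simp [this]
  have hg : S g := by rw [top]; trivial
  obtain ⟨b, hb⟩ := hg (𝟙 _) (by
    intro N e
    obtain rfl := inj e
    exact ⟨𝟙 _, by simp⟩) N rfl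
  exact ⟨b, by simpa using hb⟩

/-- If `Hom(P, -)` inverts `W`, then the localization functor is faithful on morphisms out of
`P`. -/
theorem map_injective_of_isColocal
    (hP : ∀ ⦃M N : C⦄ (w : M ⟶ N), W w → Function.Bijective fun g : P ⟶ M => g ≫ w)
    {N : C} {a b : P ⟶ N} (h : W.Q.map a = W.Q.map b) : a = b := by
  -- `Hom(P, -)` factors through the localization, so `a` and `b` act on it in the same way;
  -- evaluating at `𝟙 P` recovers them.
  have hF : W.IsInvertedBy (coyoneda.obj (Opposite.op P)) := by
    intro M N w hw
    rw [isIso_iff_bijective]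
    exact hP w hw
  have key := congrArg (fun g => (Localization.Construction.lift _ hF).map g) h
  have fac := Localization.Construction.fac _ hF
  have h' : (W.Q ⋙ Localization.Construction.lift _ hF).map a =
    (W.Q ⋙ Localization.Construction.lift _ hF).map b := key
  rw [fac] at h'
  simpa using ConcreteCategory.congr_hom h' (𝟙 P)

/-- A localization functor has a left adjoint as soon as every object `M` admits a morphism
`P ⟶ M` in `W` such that `Hom(P, -)` inverts `W`. -/
theorem isRightAdjoint_Q_of_resolutions
    (h : ∀ M : C, ∃ (P : C) (w : P ⟶ M), W w ∧
      ∀ ⦃M N : C⦄ (w : M ⟶ N), W w → Function.Bijective fun g : P ⟶ M => g ≫ w) :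
    W.Q.IsRightAdjoint := by
  rw [isRightAdjoint_iff_hasInitial_structuredArrow]
  intro d
  obtain ⟨M, rfl⟩ := (Localization.Construction.objEquiv W).surjective d
  obtain ⟨P, w, hw, hP⟩ := h M
  -- The object `P` with the inverse of `w` is initial among the arrows from `W.Q.obj M` to the
  -- image of `W.Q`: a morphism out of `W.Q.obj P` has exactly one representative out of `P`.
  let i : W.Q.obj P ≅ W.Q.obj M := Localization.Construction.wIso w hw
  have desc : ∀ Y : StructuredArrow (W.Q.obj M) W.Q, ∃ b : P ⟶ Y.right,
      W.Q.map b = i.hom ≫ Y.hom := fun Y => map_surjective_of_isColocal W hP _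
  refine (Limits.IsInitial.ofUniqueHom (X := StructuredArrow.mk (T := W.Q) i.inv)
    (fun Y => StructuredArrow.homMk (desc Y).choose ?_) ?_).hasInitial
  · simp [(desc Y).choose_spec]
  · intro Y m
    apply StructuredArrow.hom_ext
    apply map_injective_of_isColocal W hP
    have := StructuredArrow.w m
    dsimp at this ⊢
    rw [(desc Y).choose_spec, ← this, i.hom_inv_id_assoc]

end Corepresents

/-- An adjunction `F ⊣ G` induces an adjunction between localizations: if the localization functor
`L₁` has a left adjoint `p` and `G` descends to a functor `H` between the localizations, then
`p ⋙ F ⋙ L₂ ⊣ H`, and the counit is induced by the counits of `p ⊣ L₁` and `F ⊣ G`. -/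
theorem exists_derived_adjunction {C₁ C₂ D₁ D₂ : Type*} [Category* C₁] [Category* C₂]
    [Category* D₁] [Category* D₂] {F : C₁ ⥤ C₂} {G : C₂ ⥤ C₁} (adj₀ : F ⊣ G) {L₁ : C₁ ⥤ D₁}
    {L₂ : C₂ ⥤ D₂} (W₁ : MorphismProperty C₁) (W₂ : MorphismProperty C₂) [L₁.IsLocalization W₁]
    [L₂.IsLocalization W₂] {p : D₁ ⥤ C₁} (adj : p ⊣ L₁) {H : D₂ ⥤ D₁} (e : L₂ ⋙ H ≅ G ⋙ L₁) :
    ∃ adj' : (p ⋙ F ⋙ L₂) ⊣ H, ∀ N : C₂, adj'.counit.app (L₂.obj N) =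
      (p ⋙ F ⋙ L₂).map (e.hom.app N) ≫ (F ⋙ L₂).map (adj.counit.app (G.obj N)) ≫
        L₂.map (adj₀.counit.app N) := by
  let α : L₁ ⋙ (p ⋙ F ⋙ L₂) ⟶ F ⋙ L₂ :=
    { app := fun X => (F ⋙ L₂).map (adj.counit.app X)
      naturality := fun X Y f => by
        have := adj.counit.naturality f
        dsimp at this ⊢
        simp only [← Functor.map_comp, this] }
  have : (p ⋙ F ⋙ L₂).IsLeftDerivedFunctor α W₁ :=
    isLeftDerivedFunctor_of_adjunction adj _ _ (fun _ => rfl) _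
  -- Deriving an adjunction requires each derived functor to remain one after composition with the
  -- other. On the left this is automatic, since `p ⋙ -` computes the Kan extension of every
  -- functor; on the right, functors that descend along `L₂` are their own derived functors.
  have : ((p ⋙ F ⋙ L₂) ⋙ H).IsLeftDerivedFunctor
      ((Functor.associator _ _ _).inv ≫ whiskerRight α H) W₁ :=
    isLeftDerivedFunctor_of_adjunction (F := (F ⋙ L₂) ⋙ H) adj _ (fun X => by simp [α]) _
  have : H.IsRightDerivedFunctor e.inv W₂ := isRightDerivedFunctor_of_inverts W₂ H e
  have : (H ⋙ (p ⋙ F ⋙ L₂)).IsRightDerivedFunctor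
      (whiskerRight e.inv (p ⋙ F ⋙ L₂) ≫ (Functor.associator _ _ _).hom) W₂ :=
    isRightDerivedFunctor_of_inverts W₂ _
      ((Functor.associator _ _ _).symm ≪≫ isoWhiskerRight e (p ⋙ F ⋙ L₂))
  refine ⟨adj₀.derived W₁ W₂ α e.inv, fun N => ?_⟩
  have h := adj₀.derivedε_fac_app W₂ α e.inv N
  dsimp [α] at h ⊢
  rw [← h, ← Category.assoc, ← Functor.map_comp, ← Functor.map_comp, ← Functor.map_comp,
    Iso.hom_inv_id_app]
  simp

end Formal

section

variable {R : Type u} [CommRing R] {A B : CDGAlgebra R}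

namespace CDGModule

/-! ### Acyclicity of the associated graded, elementwise -/

/-- The elementwise form of the acyclicity of `Gr_t(M)`. -/
def IsTAcyclic (t : R) (M : CDGModule A) : Prop :=
  ∀ (s : ℕ) {i j l : ℤ} (h : i + 1 = j) (h' : j + 1 = l) (x : M.C j) (w : M.C l),
    t ^ s • M.d h' x = t ^ (s + 1) • w →
      ∃ (y : M.C i) (z : M.C j), t ^ s • x = t ^ s • M.d h y + t ^ (s + 1) • z

theorem grD_mk_eq_zero_iff (t : R) (M : CDGModule A) (s : ℕ) {p q : ℤ} (h : p + 1 = q)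
    (x : tFil t M.toGrModule s p) :
    grD t M s h (Submodule.Quotient.mk x) = 0 ↔ M.d h x.1 ∈ tFil t M.toGrModule (s + 1) q := by
  rw [grD, Submodule.mapQ_apply, Submodule.Quotient.mk_eq_zero]
  rfl

theorem isTAcyclic_of_isGrAcyclic {t : R} {M : CDGModule A} (hM : IsGrAcyclic t M) :
    M.IsTAcyclic t := by
  intro s i j l h h' x w hw
  have hx := (hM s i j l h h' (Submodule.Quotient.mk ⟨t ^ s • x, x, rfl⟩)).1
    ((grD_mk_eq_zero_iff t M s h' _).2 ⟨w, by simp [hw]⟩)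
  obtain ⟨y, hy⟩ := hx
  obtain ⟨⟨_, y, rfl⟩, rfl⟩ := Submodule.Quotient.mk_surjective _ y
  obtain ⟨z, hz⟩ := (Submodule.Quotient.eq _).1 hy
  refine ⟨y, -z, ?_⟩
  have hz' : t ^ (s + 1) • z = t ^ s • M.d h y - t ^ s • x := by
    refine hz.trans ?_
    simp
  rw [smul_neg, hz']
  abel

/-- Exactness also asks that the composite of two differentials vanish on `Gr_t`. As `d²` is minus
the action of the curvature, this follows from divisibility of the curvature by `t`. -/
theorem isGrAcyclic_of_isTAcyclic {t : R} {c : A.C 2} (hc : A.curv = t • c) {M : CDGModule A}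
    (hM : M.IsTAcyclic t) : IsGrAcyclic t M := by
  intro s p q r h h' x
  obtain ⟨⟨_, x, rfl⟩, rfl⟩ := Submodule.Quotient.mk_surjective _ x
  constructor
  · intro hx
    obtain ⟨w, hw⟩ := (grD_mk_eq_zero_iff t M s h' _).1 hx
    obtain ⟨y, z, hyz⟩ := hM s h h' x w (by simpa using hw.symm)
    refine ⟨Submodule.Quotient.mk ⟨t ^ s • y, y, rfl⟩, (Submodule.Quotient.eq _).2 ⟨-z, ?_⟩⟩
    simp [hyz]
  · rintro ⟨y, hy⟩
    obtain ⟨⟨_, y, rfl⟩, rfl⟩ := Submodule.Quotient.mk_surjective _ y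
    rw [← hy]
    refine (grD_mk_eq_zero_iff t M s h' ⟨_, map_mem_tFil h ⟨y, rfl⟩⟩).2
      ⟨-M.act (show p + 2 = r by omega) y c, ?_⟩
    simp [M.d_d h h' (show p + 2 = r by omega), hc, pow_succ, mul_smul]

/-! ### Zero morphisms, shifts, cones and fibers -/

instance (M N : CDGModule A) : Zero (M ⟶ N) :=
  ⟨{ f := fun _ => 0, f_act := by intros; simp, f_d := by intros; simp }⟩

@[simp] theorem zero_f (M N : CDGModule A) (i : ℤ) (m : M.C i) : Hom.f (0 : M ⟶ N) i m = 0 := rfl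

/-- The shift of a cdg module by `n`, with `(M[n])_i = M_{i+n}` and `d_{M[n]} = (-1)^n d_M`. -/
def shift (M : CDGModule A) (n : ℤ) : CDGModule A where
  C i := M.C (i + n)
  act {i j l} h := M.act (show i + n + j = l + n by omega)
  act_one h m := M.act_one _ m
  act_act h₁ h₂ h₃ h₄ x a b := M.act_act _ _ h₃ _ x a b
  d {i j} h := sgn R n • M.d (show i + n + 1 = j + n by omega)
  d_act {i j l i' j' l'} h hi hj hl h₁ h₂ m a := by
    simp only [LinearMap.smul_apply]
    rw [M.d_act _ (show i + n + 1 = i' + n by omega) hj _ (show i' + n + j = l' + n by omega)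
      (show i + n + j' = l' + n by omega), sgn_add]
    simp only [map_smul, LinearMap.smul_apply]
    have := sgn_mul_self (R := R) n
    rw [smul_add, smul_smul, mul_left_comm, this, mul_one]
  d_d {i j l} h h' h₁ m := by
    simp only [LinearMap.smul_apply, map_smul]
    rw [smul_smul, sgn_mul_self, one_smul, M.d_d _ _ (show i + n + 2 = l + n by omega)]

/-- The identification `(M[n])_i = M_j` for `i + n = j`. -/
def shiftEquiv (M : CDGModule A) (n : ℤ) {i j : ℤ} (h : i + n = j) :
    (M.shift n).C i ≃ₗ[R] M.C j := by
  subst h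
  exact LinearEquiv.refl R (M.C (i + n))

theorem shiftEquiv_d (M : CDGModule A) (n : ℤ) {i j i' j' : ℤ} (h : i + n = i') (h' : j + n = j')
    (e : i + 1 = j) (e' : i' + 1 = j') (x : (M.shift n).C i) :
    M.shiftEquiv n h' ((M.shift n).d e x) = sgn R n • M.d e' (M.shiftEquiv n h x) := by
  subst h h'
  rfl

theorem shiftEquiv_act (M : CDGModule A) (n : ℤ) {i j l i' l' : ℤ} (h : i + n = i')
    (h' : l + n = l') (e : i + j = l) (e' : i' + j = l') (x : (M.shift n).C i) (a : A.C j) :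
    M.shiftEquiv n h' ((M.shift n).act e x a) = M.act e' (M.shiftEquiv n h x) a := by
  subst h h'
  rfl

theorem IsTAcyclic.shift {t : R} {M : CDGModule A} (hM : M.IsTAcyclic t) (n : ℤ) :
    (M.shift n).IsTAcyclic t := by
  intro s i j l h h' x w hw
  obtain ⟨y, z, hyz⟩ := hM s (show i + n + 1 = j + n by omega) (show j + n + 1 = l + n by omega)
    (M.shiftEquiv n rfl x) (sgn R n • M.shiftEquiv n rfl w) (by
      have := congrArg (fun v => sgn R n • M.shiftEquiv n rfl v) hw
      simp only [map_smul] at this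
      rwa [shiftEquiv_d M n rfl rfl h' (by omega), smul_comm (sgn R n) (t ^ s),
        smul_smul (sgn R n) (sgn R n), sgn_mul_self, one_smul,
        smul_comm (sgn R n) (t ^ (s + 1))] at this)
  refine ⟨sgn R n • (M.shiftEquiv n rfl).symm y, (M.shiftEquiv n rfl).symm z,
    (M.shiftEquiv n rfl).injective ?_⟩
  simp only [map_smul, map_add]
  rw [shiftEquiv_d M n rfl rfl h (by omega), smul_smul (sgn R n) (sgn R n), sgn_mul_self, one_smul]
  simpa using hyz

section Cone

variable {M N : CDGModule A} (φ : M ⟶ N)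

/-- The component of the cone of `φ : M ⟶ N` in `N`. -/
def coneFst (i : ℤ) : (cone φ).C i →ₗ[R] N.C i := LinearMap.fst R _ _

/-- The component of the cone of `φ : M ⟶ N` in `M[1]`. -/
def coneSnd {i j : ℤ} (h : i + 1 = j) : (cone φ).C i →ₗ[R] M.C j := by
  subst h
  exact LinearMap.snd R _ _

/-- The inclusion of `N` in the cone of `φ : M ⟶ N`. -/
def coneInl (i : ℤ) : N.C i →ₗ[R] (cone φ).C i := LinearMap.inl R _ _

/-- The inclusion of `M[1]` in the cone of `φ : M ⟶ N`. -/
def coneInr {i j : ℤ} (h : i + 1 = j) : M.C j →ₗ[R] (cone φ).C i := by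
  subst h
  exact LinearMap.inr R _ _

theorem cone_ext {i j : ℤ} (h : i + 1 = j) {x y : (cone φ).C i}
    (h₁ : coneFst φ i x = coneFst φ i y) (h₂ : coneSnd φ h x = coneSnd φ h y) : x = y := by
  subst h
  exact Prod.ext h₁ h₂

@[simp] theorem coneFst_inl {i : ℤ} (x : N.C i) : coneFst φ i (coneInl φ i x) = x := rfl

@[simp] theorem coneSnd_inl {i j : ℤ} (h : i + 1 = j) (x : N.C i) :
    coneSnd φ h (coneInl φ i x) = 0 := by
  subst h
  rfl

@[simp] theorem coneFst_inr {i j : ℤ} (h : i + 1 = j) (x : M.C j) :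
    coneFst φ i (coneInr φ h x) = 0 := by
  subst h
  rfl

@[simp] theorem coneSnd_inr {i j : ℤ} (h : i + 1 = j) (x : M.C j) :
    coneSnd φ h (coneInr φ h x) = x := by
  subst h
  rfl

theorem coneFst_act {i j l : ℤ} (h : i + j = l) (x : (cone φ).C i) (a : A.C j) :
    coneFst φ l ((cone φ).act h x a) = N.act h (coneFst φ i x) a := rfl

theorem coneSnd_act {i j l i' l' : ℤ} (hi : i + 1 = i') (hl : l + 1 = l') (h : i + j = l)
    (h' : i' + j = l') (x : (cone φ).C i) (a : A.C j) :
    coneSnd φ hl ((cone φ).act h x a) = M.act h' (coneSnd φ hi x) a := by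
  subst hi hl
  rfl

theorem coneFst_d {i j : ℤ} (h : i + 1 = j) (x : (cone φ).C i) :
    coneFst φ j ((cone φ).d h x) = N.d h (coneFst φ i x) + Hom.f φ j (coneSnd φ h x) := by
  subst h
  rfl

theorem coneSnd_d {i j l : ℤ} (h : i + 1 = j) (h' : j + 1 = l) (x : (cone φ).C i) :
    coneSnd φ h' ((cone φ).d h x) = - M.d h' (coneSnd φ h x) := by
  subst h h'
  rfl

/-- The fiber `cone(φ)[-1]` of `φ : M ⟶ N`. -/
abbrev fiber : CDGModule A := (cone φ).shift (-1)

/-- The component of the fiber of `φ : M ⟶ N` in `M`. -/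
def fiberFst (i : ℤ) : (fiber φ).C i →ₗ[R] M.C i :=
  coneSnd φ (show i + -1 + 1 = i by omega) ∘ₗ ((cone φ).shiftEquiv (-1) rfl).toLinearMap

/-- The component of the fiber of `φ : M ⟶ N` in `N[-1]`. -/
def fiberSnd {i j : ℤ} (h : j + 1 = i) : (fiber φ).C i →ₗ[R] N.C j :=
  coneFst φ j ∘ₗ ((cone φ).shiftEquiv (-1) (show i + -1 = j by omega)).toLinearMap

/-- The inclusion of `M` in the fiber of `φ : M ⟶ N`. -/
def fiberInl (i : ℤ) : M.C i →ₗ[R] (fiber φ).C i :=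
  ((cone φ).shiftEquiv (-1) rfl).symm.toLinearMap ∘ₗ coneInr φ (show i + -1 + 1 = i by omega)

/-- The inclusion of `N[-1]` in the fiber of `φ : M ⟶ N`. -/
def fiberInr {i j : ℤ} (h : j + 1 = i) : N.C j →ₗ[R] (fiber φ).C i :=
  ((cone φ).shiftEquiv (-1) (show i + -1 = j by omega)).symm.toLinearMap ∘ₗ coneInl φ j

theorem fiberFst_eq {i j : ℤ} (h : i + -1 = j) (h' : j + 1 = i) (x : (fiber φ).C i) :
    fiberFst φ i x = coneSnd φ h' ((cone φ).shiftEquiv (-1) h x) := by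
  subst h
  rfl

theorem fiberInl_eq {i j : ℤ} (h : i + -1 = j) (h' : j + 1 = i) (x : M.C i) :
    fiberInl φ i x = ((cone φ).shiftEquiv (-1) h).symm (coneInr φ h' x) := by
  subst h
  rfl

@[simp] theorem fiberFst_inl {i : ℤ} (x : M.C i) : fiberFst φ i (fiberInl φ i x) = x := by
  simp [fiberFst, fiberInl]

@[simp] theorem fiberSnd_inl {i j : ℤ} (h : j + 1 = i) (x : M.C i) :
    fiberSnd φ h (fiberInl φ i x) = 0 := by
  simp [fiberSnd, fiberInl_eq φ (show i + -1 = j by omega) h]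

@[simp] theorem fiberFst_inr {i j : ℤ} (h : j + 1 = i) (x : N.C j) :
    fiberFst φ i (fiberInr φ h x) = 0 := by
  simp [fiberInr, fiberFst_eq φ (show i + -1 = j by omega) h]

@[simp] theorem fiberSnd_inr {i j : ℤ} (h : j + 1 = i) (x : N.C j) :
    fiberSnd φ h (fiberInr φ h x) = x := by
  simp [fiberInr, fiberSnd]

theorem fiber_ext {i j : ℤ} (h : j + 1 = i) {x y : (fiber φ).C i}
    (h₁ : fiberFst φ i x = fiberFst φ i y) (h₂ : fiberSnd φ h x = fiberSnd φ h y) : x = y := by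
  apply ((cone φ).shiftEquiv (-1) (show i + -1 = j by omega)).injective
  exact cone_ext φ h h₂ ((fiberFst_eq φ _ h x).symm.trans (h₁.trans (fiberFst_eq φ _ h y)))

theorem fiberFst_act {i j l : ℤ} (h : i + j = l) (x : (fiber φ).C i) (a : A.C j) :
    fiberFst φ l ((fiber φ).act h x a) = M.act h (fiberFst φ i x) a := by
  simp only [fiberFst, LinearMap.comp_apply, LinearEquiv.coe_coe, fiber]
  rw [shiftEquiv_act _ _ rfl rfl h (by omega), coneSnd_act]

theorem fiberSnd_act {i j l i' l' : ℤ} (hi : i' + 1 = i) (hl : l' + 1 = l) (h : i + j = l)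
    (h' : i' + j = l') (x : (fiber φ).C i) (a : A.C j) :
    fiberSnd φ hl ((fiber φ).act h x a) = N.act h' (fiberSnd φ hi x) a := by
  simp only [fiberSnd, LinearMap.comp_apply, LinearEquiv.coe_coe, fiber]
  rw [shiftEquiv_act _ _ _ _ h h', coneFst_act]

theorem fiberFst_d {i j : ℤ} (h : i + 1 = j) (x : (fiber φ).C i) :
    fiberFst φ j ((fiber φ).d h x) = M.d h (fiberFst φ i x) := by
  simp only [fiberFst, LinearMap.comp_apply, LinearEquiv.coe_coe, fiber]
  rw [shiftEquiv_d _ _ rfl rfl h (show i + -1 + 1 = j + -1 by omega), map_smul,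
    coneSnd_d _ _ (show j + -1 + 1 = j by omega)]
  have hs : sgn R (-1) = -1 := by simp [sgn]
  rw [hs, neg_smul, one_smul, neg_neg]
  have : ∀ (p : ℤ) (h₁ : i + -1 + 1 = p) (h₂ : p + 1 = j) (h₃ : i + -1 + 1 = i)
    (z : (cone φ).C (i + -1)), M.d h₂ (coneSnd φ h₁ z) = M.d h (coneSnd φ h₃ z) := by
    intro p h₁ h₂ h₃ z
    obtain rfl : p = i := by omega
    rfl
  exact this _ _ _ _ _

theorem fiberSnd_d {i j l : ℤ} (h : l + 1 = i) (h' : i + 1 = j) (x : (fiber φ).C i) :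
    fiberSnd φ h' ((fiber φ).d h' x) = - N.d h (fiberSnd φ h x) - Hom.f φ i (fiberFst φ i x) := by
  rw [fiberFst_eq φ (show i + -1 = l by omega) h]
  simp only [fiberSnd, LinearMap.comp_apply, LinearEquiv.coe_coe, fiber]
  rw [shiftEquiv_d _ _ (show i + -1 = l by omega) _ _ h, map_smul, coneFst_d]
  have hs : sgn R (-1) = -1 := by simp [sgn]
  rw [hs]
  module

theorem fiber_eq {i j : ℤ} (h : j + 1 = i) (x : (fiber φ).C i) :
    x = fiberInl φ i (fiberFst φ i x) + fiberInr φ h (fiberSnd φ h x) := by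
  apply fiber_ext φ h <;> simp

theorem cone_eq {i j : ℤ} (h : i + 1 = j) (x : (cone φ).C i) :
    x = coneInl φ i (coneFst φ i x) + coneInr φ h (coneSnd φ h x) := by
  apply cone_ext φ h <;> simp

/-- The inclusion of `N` in the cone of `φ : M ⟶ N`. -/
def toCone : N ⟶ cone φ where
  f i := coneInl φ i
  f_act {i j l} h m a := by
    apply cone_ext φ rfl
    · rw [coneFst_act]; simp
    · rw [coneSnd_act φ rfl rfl h (by omega)]; simp
  f_d {i j} h m := by
    apply cone_ext φ rfl
    · rw [coneFst_d]; simp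
    · rw [coneSnd_d]; simp

/-- The projection of the fiber of `φ : M ⟶ N` to `M`. -/
def fromFiber : fiber φ ⟶ M where
  f i := fiberFst φ i
  f_act h m a := fiberFst_act φ h m a
  f_d h m := fiberFst_d φ h m

@[simp] theorem fromFiber_f {i : ℤ} (x : (fiber φ).C i) :
    Hom.f (fromFiber φ) i x = fiberFst φ i x := rfl

end Cone

/-! ### Homotopy projective modules -/

/-- A module is `t`-homotopy projective if all its morphisms to modules with acyclic associated
graded are nullhomotopic. -/
def IsHProj (t : R) (P : CDGModule A) : Prop :=
  ∀ Z : CDGModule A, Z.IsTAcyclic t → ∀ f : P ⟶ Z, Nonempty (Homotopy f 0)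

/-- A nullhomotopy of `P ⟶ N ⟶ cone φ` has two components. The one in `M` is a closed morphism `P ⟶
M`, and minus the one in `N` is a homotopy from its composite with `φ` to `g`. -/
theorem IsHProj.exists_lift {t : R} {P : CDGModule A} (hP : P.IsHProj t) {M N : CDGModule A}
    (φ : M ⟶ N) (hφ : (cone φ).IsTAcyclic t) (g : P ⟶ N) :
    ∃ k : P ⟶ M, Nonempty (Homotopy (k ≫ φ) g) := by
  obtain ⟨s⟩ := hP _ hφ (g ≫ toCone φ)
  have hs : ∀ {i j l : ℤ} (e : j + 1 = i) (e' : i + 1 = l) (m : P.C i),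
      coneInl φ i (Hom.f g i m) = (cone φ).d e (s.h e m) + s.h e' (P.d e' m) := by
    intro i j l e e' m
    simpa [toCone] using s.comm e e' m
  have hd : ∀ {i j l : ℤ} (e : j + 1 = i) (e' : i + 1 = l) (m : P.C i),
      coneSnd φ e' (s.h e' (P.d e' m)) = M.d e' (coneSnd φ e (s.h e m)) := by
    intro i j l e e' m
    have := congrArg (coneSnd φ e') (hs e e' m)
    rw [coneSnd_inl, map_add, coneSnd_d φ e e'] at this
    exact (neg_add_eq_zero.1 this.symm).symm
  have idx : ∀ {i p q : ℤ} (h : p + 1 = i) (h' : q + 1 = i) (m : P.C i),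
      coneSnd φ h (s.h h m) = coneSnd φ h' (s.h h' m) := by
    intro i p q h h' m
    obtain rfl : p = q := by omega
    rfl
  refine ⟨{ f := fun i => coneSnd φ (show i - 1 + 1 = i by omega) ∘ₗ s.h (by omega)
            f_act := ?_, f_d := ?_ },
    ⟨{ h := fun e => -(coneFst φ _ ∘ₗ s.h e), h_act := ?_, comm := ?_ }⟩⟩
  · intro i j l h m a
    simp only [LinearMap.comp_apply]
    rw [s.h_act h (show i - 1 + 1 = i by omega) _ (by omega), coneSnd_act]
  · intro i j h m
    simp only [LinearMap.comp_apply]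
    rw [idx _ h, hd]
  · intro i j l i' l' e hi hl e' m a
    simp only [LinearMap.comp_apply, LinearMap.neg_apply]
    rw [s.h_act e hi hl e', coneFst_act]
    simp
  · intro i j l e e' m
    have := congrArg (coneFst φ i) (hs e e' m)
    rw [coneFst_inl, map_add, coneFst_d] at this
    simp only [comp_f, LinearMap.comp_apply, LinearMap.neg_apply, map_neg]
    rw [this, idx _ e]
    abel

theorem IsTAcyclic.fiber {t : R} {M N : CDGModule A} {φ : M ⟶ N} (h : (cone φ).IsTAcyclic t) :
    (fiber φ).IsTAcyclic t := h.shift _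

/-- The difference `g - g'` and minus the given homotopy are the components of a closed morphism
from `P` to the fiber of `φ`, which is acyclic as a shift of the cone. The component in `M` of a
nullhomotopy of this morphism is a homotopy from `g` to `g'`. -/
theorem IsHProj.homotopic_of_comp {t : R} {P : CDGModule A} (hP : P.IsHProj t) {M N : CDGModule A}
    (φ : M ⟶ N) (hφ : (cone φ).IsTAcyclic t) {g g' : P ⟶ M}
    (h : Nonempty (Homotopy (g ≫ φ) (g' ≫ φ))) : Nonempty (Homotopy g g') := by
  obtain ⟨s⟩ := h
  let G {i p : ℤ} (e : p + 1 = i) : P.C i →ₗ[R] (CDGModule.fiber φ).C i :=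
    fiberInl φ i ∘ₗ (Hom.f g i - Hom.f g' i) - fiberInr φ e ∘ₗ s.h e
  have hG₁ {i p : ℤ} (e : p + 1 = i) (m : P.C i) :
      fiberFst φ i (G e m) = Hom.f g i m - Hom.f g' i m := by simp [G]
  have hG₂ {i p : ℤ} (e : p + 1 = i) (m : P.C i) : fiberSnd φ e (G e m) = - s.h e m := by simp [G]
  have idx {i p q : ℤ} (e : p + 1 = i) (e' : q + 1 = i) (m : P.C i) : G e m = G e' m := by
    obtain rfl : p = q := by omega
    rfl
  let F : P ⟶ CDGModule.fiber φ :=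
    { f := fun i => G (show i - 1 + 1 = i by omega)
      f_act := by
        intro i j l h m a
        apply fiber_ext φ (show l - 1 + 1 = l by omega)
        · rw [fiberFst_act, hG₁, hG₁, Hom.f_act g, Hom.f_act g']
          simp
        · rw [fiberSnd_act φ (show i - 1 + 1 = i by omega) _ _ (by omega), hG₂, hG₂,
            s.h_act h (show i - 1 + 1 = i by omega) (show l - 1 + 1 = l by omega) (by omega)]
          simp
      f_d := by
        intro i j h m
        apply fiber_ext φ h
        · rw [fiberFst_d, hG₁, hG₁, Hom.f_d g, Hom.f_d g', map_sub]
        · rw [idx _ h, hG₂, fiberSnd_d φ (show i - 1 + 1 = i by omega) h, hG₁, hG₂, map_sub]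
          have := s.comm (show i - 1 + 1 = i by omega) h m
          simp only [comp_f] at this
          rw [this, map_neg]
          abel }
  obtain ⟨k⟩ := hP _ hφ.fiber F
  refine ⟨{ h := fun e => fiberFst φ _ ∘ₗ k.h e, h_act := ?_, comm := ?_ }⟩
  · intro i j l i' l' e hi hl e' m a
    simp only [LinearMap.comp_apply]
    rw [k.h_act e hi hl e', fiberFst_act]
  · intro i j l e e' m
    have := congrArg (fiberFst φ i) (k.comm e e' m)
    rw [map_add, fiberFst_d, zero_f, sub_zero] at this
    exact (hG₁ _ m).symm.trans this

end CDGModule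

/-- `Hom(P, -)` inverts the morphisms with acyclic cone if `P` is homotopy projective. -/
theorem bijective_comp_of_isHProj {t : R} {P : CDGModule A} (hP : P.IsHProj t) {M N : CDGModule A}
    (φ : M ⟶ N) (hφ : (CDGModule.cone φ).IsTAcyclic t) :
    Function.Bijective fun g : (toHot A).obj P ⟶ (toHot A).obj M => g ≫ (toHot A).map φ := by
  constructor
  · intro g g' h
    obtain ⟨g, rfl⟩ := (toHot A).map_surjective g
    obtain ⟨g', rfl⟩ := (toHot A).map_surjective g'
    dsimp only at h
    rw [← Functor.map_comp, ← Functor.map_comp] at h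
    exact CategoryTheory.Quotient.sound _
      (hP.homotopic_of_comp φ hφ ((CategoryTheory.Quotient.functor_map_eq_iff _ _ _).1 h))
  · intro g
    obtain ⟨g, rfl⟩ := (toHot A).map_surjective g
    obtain ⟨k, hk⟩ := hP.exists_lift φ hφ g
    exact ⟨(toHot A).map k, ((toHot A).map_comp _ _).symm.trans
      (CategoryTheory.Quotient.sound _ hk)⟩

end

section

variable {R : Type u} [CommRing R] {A B : CDGAlgebra R}

/-! ### The universal map to a module with acyclic associated graded -/

/-- Formal expressions in the elements of `M`, the operations of a cdg module, and, for each pair of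
expressions `x`, `w` and each `s`, two further symbols. -/
inductive ResPre (M : CDGModule A) : ℤ → Type u
  | of {i : ℤ} (m : M.C i) : ResPre M i
  | add {i : ℤ} (x y : ResPre M i) : ResPre M i
  | smul {i : ℤ} (r : R) (x : ResPre M i) : ResPre M i
  | act {i j l : ℤ} (h : i + j = l) (x : ResPre M i) (a : A.C j) : ResPre M l
  | d {i j : ℤ} (h : i + 1 = j) (x : ResPre M i) : ResPre M j
  | fill (s : ℕ) {i j l : ℤ} (h : i + 1 = j) (h' : j + 1 = l) (x : ResPre M j) (w : ResPre M l) :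
    ResPre M i
  | corr (s : ℕ) {i j l : ℤ} (h : i + 1 = j) (h' : j + 1 = l) (x : ResPre M j) (w : ResPre M l) :
    ResPre M j

open ResPre in
/-- The congruence generated by the axioms of a cdg module under `M` and by the relations
`t^s x = t^s d (fill x w) + t^(s+1) corr x w` whenever `t^s d x = t^(s+1) w`. -/
inductive ResRel (t : R) (M : CDGModule A) : ∀ {i : ℤ}, ResPre M i → ResPre M i → Prop
  | refl {i : ℤ} (x : ResPre M i) : ResRel t M x x
  | symm {i : ℤ} {x y : ResPre M i} : ResRel t M x y → ResRel t M y x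
  | trans {i : ℤ} {x y z : ResPre M i} : ResRel t M x y → ResRel t M y z → ResRel t M x z
  | congr_add {i : ℤ} {x x' y y' : ResPre M i} : ResRel t M x x' → ResRel t M y y' →
    ResRel t M (add x y) (add x' y')
  | congr_smul {i : ℤ} (r : R) {x x' : ResPre M i} : ResRel t M x x' →
    ResRel t M (smul r x) (smul r x')
  | congr_act {i j l : ℤ} (h : i + j = l) {x x' : ResPre M i} (a : A.C j) : ResRel t M x x' →
    ResRel t M (act h x a) (act h x' a)
  | congr_d {i j : ℤ} (h : i + 1 = j) {x x' : ResPre M i} : ResRel t M x x' →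
    ResRel t M (d h x) (d h x')
  | add_comm {i : ℤ} (x y : ResPre M i) : ResRel t M (add x y) (add y x)
  | add_assoc {i : ℤ} (x y z : ResPre M i) : ResRel t M (add (add x y) z) (add x (add y z))
  | zero_add {i : ℤ} (x : ResPre M i) : ResRel t M (add (of 0) x) x
  | neg_add {i : ℤ} (x : ResPre M i) : ResRel t M (add (smul (-1) x) x) (of 0)
  | smul_add {i : ℤ} (r : R) (x y : ResPre M i) :
    ResRel t M (smul r (add x y)) (add (smul r x) (smul r y))
  | add_smul {i : ℤ} (r r' : R) (x : ResPre M i) :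
    ResRel t M (smul (r + r') x) (add (smul r x) (smul r' x))
  | mul_smul {i : ℤ} (r r' : R) (x : ResPre M i) :
    ResRel t M (smul (r * r') x) (smul r (smul r' x))
  | one_smul {i : ℤ} (x : ResPre M i) : ResRel t M (smul 1 x) x
  | add_act {i j l : ℤ} (h : i + j = l) (x y : ResPre M i) (a : A.C j) :
    ResRel t M (act h (add x y) a) (add (act h x a) (act h y a))
  | smul_act {i j l : ℤ} (h : i + j = l) (r : R) (x : ResPre M i) (a : A.C j) :
    ResRel t M (act h (smul r x) a) (smul r (act h x a))
  | act_add {i j l : ℤ} (h : i + j = l) (x : ResPre M i) (a b : A.C j) :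
    ResRel t M (act h x (a + b)) (add (act h x a) (act h x b))
  | act_smul {i j l : ℤ} (h : i + j = l) (r : R) (x : ResPre M i) (a : A.C j) :
    ResRel t M (act h x (r • a)) (smul r (act h x a))
  | act_one {i : ℤ} (h : i + 0 = i) (x : ResPre M i) : ResRel t M (act h x A.one) x
  | act_act {i j l ij jl m : ℤ} (h₁ : i + j = ij) (h₂ : ij + l = m) (h₃ : j + l = jl)
    (h₄ : i + jl = m) (x : ResPre M i) (a : A.C j) (b : A.C l) :
    ResRel t M (act h₂ (act h₁ x a) b) (act h₄ x (A.mul h₃ a b))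
  | d_add {i j : ℤ} (h : i + 1 = j) (x y : ResPre M i) :
    ResRel t M (d h (add x y)) (add (d h x) (d h y))
  | d_smul {i j : ℤ} (h : i + 1 = j) (r : R) (x : ResPre M i) :
    ResRel t M (d h (smul r x)) (smul r (d h x))
  | d_act {i j l i' j' l' : ℤ} (h : i + j = l) (hi : i + 1 = i') (hj : j + 1 = j')
    (hl : l + 1 = l') (h₁ : i' + j = l') (h₂ : i + j' = l') (x : ResPre M i) (a : A.C j) :
    ResRel t M (d hl (act h x a))
      (add (act h₁ (d hi x) a) (smul (sgn R i) (act h₂ x (A.d hj a))))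
  | d_d {i j l : ℤ} (h : i + 1 = j) (h' : j + 1 = l) (h₁ : i + 2 = l) (x : ResPre M i) :
    ResRel t M (d h' (d h x)) (smul (-1) (act h₁ x A.curv))
  | of_add {i : ℤ} (m m' : M.C i) : ResRel t M (of (m + m')) (add (of m) (of m'))
  | of_smul {i : ℤ} (r : R) (m : M.C i) : ResRel t M (of (r • m)) (smul r (of m))
  | of_act {i j l : ℤ} (h : i + j = l) (m : M.C i) (a : A.C j) :
    ResRel t M (of (M.act h m a)) (act h (of m) a)
  | of_d {i j : ℤ} (h : i + 1 = j) (m : M.C i) : ResRel t M (of (M.d h m)) (d h (of m))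
  | fill (s : ℕ) {i j l : ℤ} (h : i + 1 = j) (h' : j + 1 = l) (x : ResPre M j) (w : ResPre M l) :
    ResRel t M (smul (t ^ s) (d h' x)) (smul (t ^ (s + 1)) w) →
      ResRel t M (smul (t ^ s) x)
        (add (smul (t ^ s) (d h (fill s h h' x w))) (smul (t ^ (s + 1)) (corr s h h' x w)))

namespace Res

variable (t : R) (M : CDGModule A)

/-- Expressions up to the relation `ResRel`. -/
abbrev setoid (i : ℤ) : Setoid (ResPre M i) where
  r := ResRel t M
  iseqv := ⟨ResRel.refl, ResRel.symm, ResRel.trans⟩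

/-- The degree `i` part of the universal module under `M` with acyclic associated graded. -/
def Carrier (i : ℤ) : Type u := Quotient (setoid t M i)

variable {t M}

/-- The class of an expression. -/
def mk {i : ℤ} (x : ResPre M i) : Carrier t M i := Quotient.mk (setoid t M i) x

theorem mk_surjective {i : ℤ} (z : Carrier t M i) : ∃ x, mk x = z := Quotient.exists_rep z

theorem sound {i : ℤ} {x y : ResPre M i} (h : ResRel t M x y) : (mk x : Carrier t M i) = mk y :=
  Quotient.sound (s := setoid t M i) h

theorem exact {i : ℤ} {x y : ResPre M i} (h : (mk x : Carrier t M i) = mk y) : ResRel t M x y :=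
  Quotient.exact (s := setoid t M i) h

instance (i : ℤ) : Zero (Carrier t M i) := ⟨mk (.of 0)⟩

instance (i : ℤ) : Add (Carrier t M i) :=
  ⟨Quotient.map₂ ResPre.add fun _ _ h _ _ h' => ResRel.congr_add h h'⟩

instance (i : ℤ) : SMul R (Carrier t M i) :=
  ⟨fun r => Quotient.map (ResPre.smul r) fun _ _ h => ResRel.congr_smul r h⟩

instance (i : ℤ) : Neg (Carrier t M i) := ⟨fun x => (-1 : R) • x⟩

theorem mk_add {i : ℤ} (x y : ResPre M i) : (mk (.add x y) : Carrier t M i) = mk x + mk y := rfl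

theorem mk_smul {i : ℤ} (r : R) (x : ResPre M i) :
    (mk (.smul r x) : Carrier t M i) = r • mk x := rfl

instance (i : ℤ) : AddCommGroup (Carrier t M i) where
  add_assoc x y z := by
    obtain ⟨x, rfl⟩ := mk_surjective x
    obtain ⟨y, rfl⟩ := mk_surjective y
    obtain ⟨z, rfl⟩ := mk_surjective z
    exact sound (.add_assoc x y z)
  add_comm x y := by
    obtain ⟨x, rfl⟩ := mk_surjective x
    obtain ⟨y, rfl⟩ := mk_surjective y
    exact sound (.add_comm x y)
  zero_add x := by
    obtain ⟨x, rfl⟩ := mk_surjective x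
    exact sound (.zero_add x)
  add_zero x := by
    obtain ⟨x, rfl⟩ := mk_surjective x
    exact (sound (.add_comm x _)).trans (sound (.zero_add x))
  neg_add_cancel x := by
    obtain ⟨x, rfl⟩ := mk_surjective x
    exact sound (.neg_add x)
  nsmul := nsmulRec
  zsmul := zsmulRec

instance (i : ℤ) : Module R (Carrier t M i) :=
  Module.ofMinimalAxioms
    (fun r x y => by
      obtain ⟨x, rfl⟩ := mk_surjective x
      obtain ⟨y, rfl⟩ := mk_surjective y
      exact sound (.smul_add r x y))
    (fun r r' x => by
      obtain ⟨x, rfl⟩ := mk_surjective x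
      exact sound (.add_smul r r' x))
    (fun r r' x => by
      obtain ⟨x, rfl⟩ := mk_surjective x
      exact sound (.mul_smul r r' x))
    (fun x => by
      obtain ⟨x, rfl⟩ := mk_surjective x
      exact sound (.one_smul x))

/-- The action of `A` on expressions up to `ResRel`. -/
def actₗ {i j l : ℤ} (h : i + j = l) : Carrier t M i →ₗ[R] A.C j →ₗ[R] Carrier t M l :=
  LinearMap.mk₂ R
    (fun x a => Quotient.map (ResPre.act h · a) (fun _ _ r => ResRel.congr_act h a r) x)
    (fun x y a => by
      obtain ⟨x, rfl⟩ := mk_surjective x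
      obtain ⟨y, rfl⟩ := mk_surjective y
      exact sound (.add_act h x y a))
    (fun r x a => by
      obtain ⟨x, rfl⟩ := mk_surjective x
      exact sound (.smul_act h r x a))
    (fun x a b => by
      obtain ⟨x, rfl⟩ := mk_surjective x
      exact sound (.act_add h x a b))
    (fun r x a => by
      obtain ⟨x, rfl⟩ := mk_surjective x
      exact sound (.act_smul h r x a))

/-- The predifferential of expressions up to `ResRel`. -/
def dₗ {i j : ℤ} (h : i + 1 = j) : Carrier t M i →ₗ[R] Carrier t M j where
  toFun := Quotient.map (ResPre.d h) fun _ _ r => ResRel.congr_d h r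
  map_add' x y := by
    obtain ⟨x, rfl⟩ := mk_surjective x
    obtain ⟨y, rfl⟩ := mk_surjective y
    exact sound (.d_add h x y)
  map_smul' r x := by
    obtain ⟨x, rfl⟩ := mk_surjective x
    exact sound (.d_smul h r x)

theorem mk_act {i j l : ℤ} (h : i + j = l) (x : ResPre M i) (a : A.C j) :
    (mk (.act h x a) : Carrier t M l) = actₗ h (mk x) a := rfl

theorem mk_d {i j : ℤ} (h : i + 1 = j) (x : ResPre M i) :
    (mk (.d h x) : Carrier t M j) = dₗ h (mk x) := rfl

end Res

open Res

/-- The universal module under `M` with acyclic associated graded. -/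
def resModule (t : R) (M : CDGModule A) : CDGModule A where
  C := Carrier t M
  act h := actₗ h
  act_one h x := by
    obtain ⟨x, rfl⟩ := mk_surjective x
    exact sound (.act_one h x)
  act_act h₁ h₂ h₃ h₄ x a b := by
    obtain ⟨x, rfl⟩ := mk_surjective x
    exact sound (.act_act h₁ h₂ h₃ h₄ x a b)
  d h := dₗ h
  d_act h hi hj hl h₁ h₂ x a := by
    obtain ⟨x, rfl⟩ := mk_surjective x
    exact sound (.d_act h hi hj hl h₁ h₂ x a)
  d_d h h' h₁ x := by
    obtain ⟨x, rfl⟩ := mk_surjective x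
    exact sound (.d_d h h' h₁ x)

/-- The universal morphism from `M` to a module with acyclic associated graded. -/
def toRes (t : R) (M : CDGModule A) : M ⟶ resModule t M where
  f _ :=
    { toFun := fun m => Res.mk (.of m)
      map_add' := fun m m' => sound (.of_add m m')
      map_smul' := fun r m => sound (.of_smul r m) }
  f_act h m a := sound (.of_act h m a)
  f_d h m := sound (.of_d h m)

/-- The premise of the `fill` relation is itself an instance of `ResRel`. An equation in the
quotient can therefore be read back on representatives as that premise, and cycles that involve
earlier symbols are filled as well, with no iteration of the construction. -/
theorem isTAcyclic_resModule (t : R) (M : CDGModule A) : (resModule t M).IsTAcyclic t := by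
  intro s i j l h h' x w hw
  obtain ⟨x, rfl⟩ := mk_surjective x
  obtain ⟨w, rfl⟩ := mk_surjective w
  exact ⟨Res.mk (.fill s h h' x w), Res.mk (.corr s h h' x w),
    sound (.fill s h h' x w (Res.exact hw))⟩

/-! ### Evaluation of formal expressions in an acyclic module. -/

section Eval

variable {t : R} {M Z : CDGModule A} (β : ∀ i, M.C i →ₗ[R] Z.C i)
  (α : ∀ {i j : ℤ}, i + 1 = j → Carrier t M i →ₗ[R] Z.C j)

open Classical in
/-- The evaluation of expressions in `Z` given by `β` on the elements of `M` and such that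
`d (eval x) - eval (d x) = α x`. -/
def ResPre.eval : ∀ {i : ℤ}, ResPre M i → Z.C i
  | _, .of m => β _ m
  | _, .add x y => eval x + eval y
  | _, .smul r x => r • eval x
  | _, .act h x a => Z.act h (eval x) a
  | _, .d h x => Z.d h (eval x) - α h (Res.mk x)
  | _, .fill (i := i) (j := j) s h h' x w =>
    -- The equation is the image of the `fill` relation once `eval (d y)` is replaced by `d (eval y)
    -- - α y`. It involves no value of the new symbols: `α` is given on the quotient, so the class
    -- of `fill` can be used before its evaluation. The value `0` is harmless, since a solution
    -- exists whenever the relation is imposed.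
    if H : ∃ p : Z.C i × Z.C j, t ^ s • (eval x + α h (Res.mk (.fill s h h' x w))) =
        t ^ s • Z.d h p.1 + t ^ (s + 1) • p.2 then H.choose.1 else 0
  | _, .corr (i := i) (j := j) s h h' x w =>
    if H : ∃ p : Z.C i × Z.C j, t ^ s • (eval x + α h (Res.mk (.fill s h h' x w))) =
        t ^ s • Z.d h p.1 + t ^ (s + 1) • p.2 then H.choose.2 else 0

/-- `fill` and `corr` are evaluated by the two components of one and the same choice, which
therefore solve the equation jointly. -/
theorem ResPre.eval_fill (s : ℕ) {i j l : ℤ} (h : i + 1 = j) (h' : j + 1 = l) (x : ResPre M j)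
    (w : ResPre M l)
    (H : ∃ (y : Z.C i) (z : Z.C j), t ^ s • (eval β α x + α h (Res.mk (.fill s h h' x w))) =
      t ^ s • Z.d h y + t ^ (s + 1) • z) :
    t ^ s • (eval β α x + α h (Res.mk (.fill s h h' x w))) =
      t ^ s • Z.d h (eval β α (.fill s h h' x w)) + t ^ (s + 1) • eval β α (.corr s h h' x w) := by
  have H' : ∃ p : Z.C i × Z.C j, t ^ s • (eval β α x + α h (Res.mk (.fill s h h' x w))) =
        t ^ s • Z.d h p.1 + t ^ (s + 1) • p.2 := by
    obtain ⟨y, z, H⟩ := H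
    exact ⟨(y, z), H⟩
  rw [eval, eval, dif_pos H', dif_pos H']
  exact H'.choose_spec

variable (hZ : Z.IsTAcyclic t)
  (hβ : ∀ {i j l : ℤ} (h : i + j = l) (m : M.C i) (a : A.C j),
    β l (M.act h m a) = Z.act h (β i m) a)
  (hβα : ∀ {i j : ℤ} (h : i + 1 = j) (m : M.C i),
    β j (M.d h m) = Z.d h (β i m) - α h (Res.mk (.of m)))
  (hα : ∀ {i j l i' l' : ℤ} (e : i + j = l) (hi : i + 1 = i') (hl : l + 1 = l') (e' : i' + j = l')
    (x : Carrier t M i) (a : A.C j), α hl (actₗ e x a) = Z.act e' (α hi x) a)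
  (hαd : ∀ {i j l : ℤ} (h : i + 1 = j) (h' : j + 1 = l) (x : Carrier t M i),
    Z.d h' (α h x) = - α h' (dₗ h x))

include hZ hβ hβα hα hαd in
-- Induction on the relation. The module axioms come from those of `Z` and from the compatibilities
-- of `α` and `β`; acyclicity of `Z` enters only in the case `fill`.
theorem ResPre.eval_eq {i : ℤ} {x y : ResPre M i} (r : ResRel t M x y) :
    eval β α x = eval β α y := by
  induction r with
  | refl => rfl
  | symm _ h => exact h.symm
  | trans _ _ h h' => exact h.trans h'
  | congr_add _ _ h h' => simp only [eval, h, h']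
  | congr_smul _ _ h => simp only [eval, h]
  | congr_act _ _ _ h => simp only [eval, h]
  | congr_d _ r h => simp only [eval, h, sound r]
  | add_comm => simp only [eval]; exact add_comm _ _
  | add_assoc => simp only [eval]; exact add_assoc _ _ _
  | zero_add => simp only [eval, map_zero]; exact zero_add _
  | neg_add => simp [eval]
  | smul_add => simp only [eval]; exact smul_add _ _ _
  | add_smul => simp only [eval]; exact add_smul _ _ _
  | mul_smul => simp only [eval]; exact mul_smul _ _ _
  | one_smul => simp only [eval]; exact one_smul _ _
  | add_act => simp [eval]
  | smul_act => simp [eval]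
  | act_add => simp [eval]
  | act_smul => simp [eval]
  | act_one h x => simp only [eval]; exact Z.act_one h _
  | act_act h₁ h₂ h₃ h₄ x a b => simp only [eval]; exact Z.act_act h₁ h₂ h₃ h₄ _ _ _
  | d_add => simp only [eval, mk_add, map_add]; abel
  | d_smul => simp only [eval, mk_smul, map_smul, smul_sub]
  | d_act h hi hj hl h₁ h₂ x a =>
    simp only [eval, mk_act]
    rw [Z.d_act h hi hj hl h₁ h₂, hα h hi hl h₁]
    simp only [map_sub, LinearMap.sub_apply]
    abel
  | d_d h h' h₁ x =>
    simp only [eval, mk_d]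
    rw [map_sub, Z.d_d h h' h₁, hαd h h']
    simp
  | of_add => simp [eval]
  | of_smul => simp [eval]
  | of_act h m a => simp only [eval]; exact hβ h m a
  | of_d h m => simp only [eval]; exact hβα h m
  | fill s h h' x w r ih =>
    have e := sound (ResRel.fill s h h' x w r)
    rw [mk_smul, mk_add, mk_smul, mk_smul, mk_d] at e
    -- Acyclicity is applied to `eval x + α fill`. The induction hypothesis gives `t^s d (eval x)`
    -- as `t^s α x + t^(s+1) eval w`, and `d (α fill) = -α (d fill)`. Applying `α` to the relation
    -- `e` turns `t^s (α x - α (d fill))` into `t^(s+1) α corr`, whence the witness `eval w + α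
    -- corr`.
    have H := eval_fill β α s h h' x w (hZ s h h' _
      (eval β α w + α h' (Res.mk (.corr s h h' x w))) (by
        simp only [eval] at ih
        have e' := congrArg (α h') e
        simp only [map_add, map_smul] at e'
        rw [map_add, hαd h h', smul_add, smul_add, ← ih, smul_sub, e', smul_neg]
        abel))
    simp only [eval] at H ⊢
    rw [smul_sub, sub_add_eq_add_sub, ← H, smul_add]
    abel

/-- The family of linear maps induced by `ResPre.eval`. -/
def resEval (i : ℤ) : (resModule t M).C i →ₗ[R] Z.C i where
  toFun := Quotient.lift (ResPre.eval β α) fun _ _ r => ResPre.eval_eq β α hZ hβ hβα hα hαd r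
  map_add' x y := by
    obtain ⟨x, rfl⟩ := mk_surjective x
    obtain ⟨y, rfl⟩ := mk_surjective y
    rfl
  map_smul' r x := by
    obtain ⟨x, rfl⟩ := mk_surjective x
    rfl

end Eval

/-- Let `β` be minus the restriction of `F` to `M` and `α` its restriction to the shifted universal
module. The evaluation `ev` extends `β` and satisfies `d ev - ev d = α`. Since the differential of
the fiber has second component `-d n - toRes m`, the map `ev ∘ fiberSnd` has differential `α n - β
m`, which is `F`. -/
theorem isHProj_fiber_toRes (t : R) (M : CDGModule A) :
    (CDGModule.fiber (toRes t M)).IsHProj t := by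
  intro Z hZ F
  let β (i : ℤ) : M.C i →ₗ[R] Z.C i := -(CDGModule.Hom.f F i ∘ₗ CDGModule.fiberInl (toRes t M) i)
  let α {i j : ℤ} (h : i + 1 = j) : (resModule t M).C i →ₗ[R] Z.C j :=
    CDGModule.Hom.f F j ∘ₗ CDGModule.fiberInr (toRes t M) h
  have hβ : ∀ {i j l : ℤ} (h : i + j = l) (m : M.C i) (a : A.C j),
      β l (M.act h m a) = Z.act h (β i m) a := by
    intro i j l h m a
    have : CDGModule.fiberInl (toRes t M) l (M.act h m a) =
        (CDGModule.fiber (toRes t M)).act h (CDGModule.fiberInl (toRes t M) i m) a := by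
      apply CDGModule.fiber_ext (toRes t M) (show l - 1 + 1 = l by omega)
      · rw [CDGModule.fiberFst_act]; simp
      · rw [CDGModule.fiberSnd_act _ (show i - 1 + 1 = i by omega) _ _ (by omega)]; simp
    simp only [β, LinearMap.neg_apply, LinearMap.comp_apply, map_neg]
    rw [this, CDGModule.Hom.f_act F]
  have hα : ∀ {i j l i' l' : ℤ} (e : i + j = l) (hi : i + 1 = i') (hl : l + 1 = l')
      (e' : i' + j = l') (x : (resModule t M).C i) (a : A.C j),
      α hl ((resModule t M).act e x a) = Z.act e' (α hi x) a := by
    intro i j l i' l' e hi hl e' x a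
    have : CDGModule.fiberInr (toRes t M) hl ((resModule t M).act e x a) =
        (CDGModule.fiber (toRes t M)).act e' (CDGModule.fiberInr (toRes t M) hi x) a := by
      apply CDGModule.fiber_ext (toRes t M) hl
      · rw [CDGModule.fiberFst_act]; simp
      · rw [CDGModule.fiberSnd_act _ hi _ _ e]; simp
    simp only [α, LinearMap.comp_apply]
    rw [this, CDGModule.Hom.f_act F]
  have hβα : ∀ {i j : ℤ} (h : i + 1 = j) (m : M.C i),
      β j (M.d h m) = Z.d h (β i m) - α h (CDGModule.Hom.f (toRes t M) i m) := by
    intro i j h m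
    have : (CDGModule.fiber (toRes t M)).d h (CDGModule.fiberInl (toRes t M) i m) =
        CDGModule.fiberInl (toRes t M) j (M.d h m) -
          CDGModule.fiberInr (toRes t M) h (CDGModule.Hom.f (toRes t M) i m) := by
      apply CDGModule.fiber_ext (toRes t M) h
      · rw [CDGModule.fiberFst_d]; simp
      · rw [CDGModule.fiberSnd_d _ (show i - 1 + 1 = i by omega)]; simp
    have h₂ := congrArg (CDGModule.Hom.f F j) this
    rw [CDGModule.Hom.f_d F, map_sub] at h₂
    simp only [α, β, LinearMap.neg_apply, LinearMap.comp_apply, map_neg]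
    rw [h₂]
    abel
  have hαd : ∀ {i j l : ℤ} (h : i + 1 = j) (h' : j + 1 = l) (x : (resModule t M).C i),
      Z.d h' (α h x) = - α h' ((resModule t M).d h x) := by
    intro i j l h h' x
    have : (CDGModule.fiber (toRes t M)).d h' (CDGModule.fiberInr (toRes t M) h x) =
        - CDGModule.fiberInr (toRes t M) h' ((resModule t M).d h x) := by
      apply CDGModule.fiber_ext (toRes t M) h'
      · rw [CDGModule.fiberFst_d]; simp
      · rw [CDGModule.fiberSnd_d _ h]; simp
    simp only [α, LinearMap.comp_apply]
    rw [← CDGModule.Hom.f_d F, this, map_neg]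
  let ev (i : ℤ) := resEval β (fun h => α h) hZ hβ hβα hα hαd i
  have ev_act : ∀ {i j l : ℤ} (h : i + j = l) (x : (resModule t M).C i) (a : A.C j),
      ev l ((resModule t M).act h x a) = Z.act h (ev i x) a := by
    intro i j l h x a
    obtain ⟨x, rfl⟩ := mk_surjective x
    rfl
  have ev_d : ∀ {i j : ℤ} (h : i + 1 = j) (x : (resModule t M).C i),
      ev j ((resModule t M).d h x) = Z.d h (ev i x) - α h x := by
    intro i j h x
    obtain ⟨x, rfl⟩ := mk_surjective x
    rfl
  have ev_of : ∀ {i : ℤ} (m : M.C i), ev i (CDGModule.Hom.f (toRes t M) i m) = β i m :=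
    fun m => rfl
  refine ⟨{ h := fun e => ev _ ∘ₗ CDGModule.fiberSnd (toRes t M) e, h_act := ?_, comm := ?_ }⟩
  · intro i j l i' l' e hi hl e' m a
    simp only [LinearMap.comp_apply]
    rw [CDGModule.fiberSnd_act _ hi hl e e', ev_act]
  · intro i j l e e' x
    simp only [LinearMap.comp_apply]
    rw [CDGModule.fiberSnd_d _ e e', map_sub, map_neg, ev_d, ev_of, CDGModule.zero_f]
    conv_lhs => rw [CDGModule.fiber_eq (toRes t M) e x, map_add]
    simp only [α, β, LinearMap.neg_apply, LinearMap.comp_apply]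
    abel

/-- Up to homotopy the cone of `fiber φ ⟶ M` is `N`. Here the filler is transported by hand: `m`,
`m'` and `n` are the components of `x` in `M`, in the copy of `M` inside the fiber, and in `N`. -/
theorem isTAcyclic_cone_fromFiber {t : R} {M N : CDGModule A} (φ : M ⟶ N) (hN : N.IsTAcyclic t) :
    (CDGModule.cone (CDGModule.fromFiber φ)).IsTAcyclic t := by
  intro s i j l h h' x w hw
  set m := CDGModule.coneFst _ j x with hm
  set m' := CDGModule.fiberFst φ l (CDGModule.coneSnd _ h' x) with hm'
  set n := CDGModule.fiberSnd φ h' (CDGModule.coneSnd _ h' x) with hn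
  have e₁ : t ^ s • (M.d h' m + m') =
      t ^ (s + 1) • CDGModule.coneFst (CDGModule.fromFiber φ) l w := by
    have := congrArg (CDGModule.coneFst (CDGModule.fromFiber φ) l) hw
    simp only [map_smul] at this
    rwa [CDGModule.coneFst_d] at this
  have e₂ : t ^ s • (N.d h' n + CDGModule.Hom.f φ l m') = t ^ (s + 1) •
      CDGModule.fiberSnd φ rfl (CDGModule.coneSnd (CDGModule.fromFiber φ) rfl w) := by
    have := congrArg (fun v => CDGModule.fiberSnd φ (rfl : l + 1 = l + 1)
      (CDGModule.coneSnd (CDGModule.fromFiber φ) rfl v)) hw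
    simp only [map_smul] at this
    rw [CDGModule.coneSnd_d _ h', map_neg, CDGModule.fiberSnd_d φ h'] at this
    rw [← this, neg_sub, sub_neg_eq_add, add_comm]
  -- By `e₁` and `e₂`, `d m` is congruent to `-m'` and `d n` to `-φ m'` at level `s`, so `n - φ m`
  -- is closed at this level.
  obtain ⟨y, z, hyz⟩ := hN s h h' (n - CDGModule.Hom.f φ j m)
    (CDGModule.fiberSnd φ rfl (CDGModule.coneSnd (CDGModule.fromFiber φ) rfl w) -
      CDGModule.Hom.f φ l (CDGModule.coneFst (CDGModule.fromFiber φ) l w)) (by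
    rw [smul_sub, ← e₂, ← map_smul (CDGModule.Hom.f φ l), ← e₁, map_smul, map_sub, map_add,
      CDGModule.Hom.f_d φ]
    module)
  -- Taking `m` as the first component makes the differential of `coneInr p` agree exactly with `x`
  -- in `M`; only the fiber part then needs a correction, given by `q`.
  obtain ⟨p, hp₁, hp₂⟩ : ∃ p, CDGModule.fiberFst φ j p = m ∧ CDGModule.fiberSnd φ h p = y :=
    ⟨CDGModule.fiberInl φ j m + CDGModule.fiberInr φ h y, by simp, by simp⟩
  obtain ⟨q, hq₁, hq₂⟩ : ∃ q, CDGModule.fiberFst φ l q =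
      CDGModule.coneFst (CDGModule.fromFiber φ) l w ∧ CDGModule.fiberSnd φ h' q = z :=
    ⟨CDGModule.fiberInl φ l (CDGModule.coneFst (CDGModule.fromFiber φ) l w) +
      CDGModule.fiberInr φ h' z, by simp, by simp⟩
  refine ⟨CDGModule.coneInr _ h p, CDGModule.coneInr _ h' q, ?_⟩
  apply CDGModule.cone_ext _ h'
  · rw [map_add, map_smul, map_smul, map_smul, CDGModule.coneFst_d]
    simp [hm, hp₁]
  · rw [map_add, map_smul, map_smul, map_smul, CDGModule.coneSnd_d _ h h', CDGModule.coneSnd_inr,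
      CDGModule.coneSnd_inr]
    apply CDGModule.fiber_ext φ h'
    · simp only [map_add, map_smul, map_neg]
      rw [CDGModule.fiberFst_d, hp₁, hq₁, ← hm', ← e₁]
      module
    · simp only [map_add, map_smul, map_neg]
      rw [CDGModule.fiberSnd_d φ h, hp₁, hp₂, hq₂, ← hn, ← sub_eq_iff_eq_add'.2 hyz]
      module

end

/-! ### Homotopy projective resolutions over a deformation. -/

section

variable {k : Type u} [Field k]

namespace Deformation

variable {n : ℕ} {A B : DGAlgebra k} (An : Deformation A n) (Bn : Deformation B n)

theorem exists_curv_eq : ∃ c, An.alg.curv = tVar k n • c := by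
  obtain ⟨c, hc⟩ := An.exists_sub_lift_red 2 An.alg.curv
  have h0 : An.red 2 An.alg.curv = 0 := An.red_curv.trans A.curv_eq_zero
  rw [h0, lift, TensorProduct.tmul_zero, map_zero, sub_zero] at hc
  exact ⟨c, hc⟩

theorem isGrAcyclic_iff {M : CDGModule An.alg} :
    IsGrAcyclic (tVar k n) M ↔ M.IsTAcyclic (tVar k n) := by
  obtain ⟨c, hc⟩ := An.exists_curv_eq
  exact ⟨CDGModule.isTAcyclic_of_isGrAcyclic, CDGModule.isGrAcyclic_of_isTAcyclic hc⟩

/-- The quotient functor to the `n`-derived category has a left adjoint. -/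
theorem isRightAdjoint_quot : An.quot.IsRightAdjoint := by
  apply isRightAdjoint_Q_of_resolutions
  intro M
  -- The resolution is the fiber of the universal morphism to a module with acyclic associated
  -- graded.
  refine ⟨(toHot _).obj (CDGModule.fiber (toRes (tVar k n) M.as)),
    (toHot _).map (CDGModule.fromFiber _), ⟨CDGModule.fromFiber _, rfl, ?_⟩, ?_⟩
  · exact An.isGrAcyclic_iff.2 (isTAcyclic_cone_fromFiber _ (isTAcyclic_resModule _ _))
  · rintro M N _ ⟨φ, rfl, hφ⟩
    exact bijective_comp_of_isHProj (isHProj_fiber_toRes _ _) φ (An.isGrAcyclic_iff.1 hφ)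

end Deformation

end

section

variable {R : Type u} [CommRing R] {A B : CDGAlgebra R}

/-! ### The tensor-hom adjunction -/

section TensorHom

variable (X : CDGBimodule A B)

/-- The coevaluation `M ⟶ Hom_B(X, M ⊗_A X)`, `m ↦ (x ↦ m ⊗ x)`, in degree `l`. -/
def coevLin (M : CDGModule A) (l : ℤ) :
    M.C l →ₗ[R] homSub X.toGrModule (M.tensor X).toGrModule l where
  toFun m := homMk (fun i j h => tmk M.toGrModule X (show l + i = j by omega) m) (by
    intro i b ib j jb h₁ h₂ h₃ h₄ x y
    have : ∀ (e : l + i = j) (ib' : ℤ) (h₁' : i + b = ib') (e' : l + ib' = jb),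
        tmk M.toGrModule X e' m (X.act h₁' x y) =
          tensAct M.toGrModule X h₄ y (tmk M.toGrModule X e m x) := by
      intro e ib' h₁' e'
      subst h₁'
      simp [tensAct]
    exact this _ _ _ _)
  map_add' m m' := by
    apply homSub_ext
    intro i j h x
    exact LinearMap.congr_fun (map_add (tmk M.toGrModule X _) m m') x
  map_smul' r m := by
    apply homSub_ext
    intro i j h x
    exact LinearMap.congr_fun (map_smul (tmk M.toGrModule X _) r m) x

theorem tensD_tmk (M : CDGModule A) {i j l l' i' j' : ℤ} (h : i + j = l) (hl : l + 1 = l')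
    (hi : i + 1 = i') (hj : j + 1 = j') (h₁ : i' + j = l') (h₂ : i + j' = l') (m : M.C i)
    (x : X.C j) : tensD M X hl (tmk M.toGrModule X h m x) =
      tmk M.toGrModule X h₁ (M.d hi m) x + sgn R i • tmk M.toGrModule X h₂ m (X.d hj x) := by
  subst hi hj
  simp [tensD]

/-- The coevaluation `M ⟶ Hom_B(X, M ⊗_A X)`, `m ↦ (x ↦ m ⊗ x)`. -/
def coevHom (M : CDGModule A) : M ⟶ (homFunctor X).obj ((tensorFunctor X).obj M) where
  f l := coevLin X M l
  f_act := by
    intro i j l h m a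
    refine homSub_ext (N := (M.tensor X).toGrModule) fun p q e x => ?_
    refine Eq.trans ?_
      (homAct_apply X (M.tensor X).toGrModule h (coevLin X M i m) a e rfl (by omega) x).symm
    exact tmk_act h rfl _ _ m a x
  f_d := by
    intro i j h m
    refine homSub_ext (N := (M.tensor X).toGrModule) fun p q e x => ?_
    refine Eq.trans ?_
      (homD_apply X (M.tensor X) h (coevLin X M i m) e rfl (by omega) rfl (by omega) x).symm
    refine Eq.trans ?_ (congrArg (· - sgn R i • homAp (p + 1) q (by omega) (coevLin X M i m)
      (X.d rfl x)) (tensD_tmk X M (show i + p = p + i by omega) (show p + i + 1 = q by omega)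
        h rfl (by omega) (by omega) m x).symm)
    exact (add_sub_cancel_right _ _).symm

/-- The adjunction between `- ⊗_A X` and `Hom_B(X, -)` on cdg modules. -/
def tensorHomAdjunction : tensorFunctor X ⊣ homFunctor X :=
  Adjunction.mkOfUnitCounit
    { unit :=
        { app := fun M => coevHom X M
          naturality := by
            intro M N f
            apply CDGModule.hom_ext
            intro l m
            refine homSub_ext (N := (N.tensor X).toGrModule) fun p q e x => ?_
            exact (tensMap_tmk X f (show l + p = q by omega) m x).symm }
      counit :=
        { app := fun N => evalHom X N
          naturality := by
            intro M N f
            apply CDGModule.hom_ext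
            intro l z
            refine LinearMap.congr_fun (f := evalLin X N l ∘ₗ tensMap X ((homFunctor X).map f) l)
              (g := CDGModule.Hom.f f l ∘ₗ evalLin X M l) (tens_ext ?_) z
            intro p q e g x
            refine (congrArg (evalLin X N l) (tensMap_tmk X _ e g x)).trans ?_
            refine (evalLin_tmk X N e (show q + p = l by omega) _ x).trans ?_
            exact congrArg (CDGModule.Hom.f f l)
              (evalLin_tmk X M e (show q + p = l by omega) g x).symm }
      left_triangle := by
        ext M : 2
        apply CDGModule.hom_ext
        intro l z
        refine LinearMap.congr_fun
          (f := evalLin X (M.tensor X) l ∘ₗ tensMap X (coevHom X M) l)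
          (g := LinearMap.id) (tens_ext ?_) z
        intro p q e m x
        refine (congrArg (evalLin X (M.tensor X) l) (tensMap_tmk X _ e m x)).trans ?_
        exact evalLin_tmk X (M.tensor X) e (show q + p = l by omega) (coevLin X M p m) x
      right_triangle := by
        ext N : 2
        apply CDGModule.hom_ext
        intro l f
        refine homSub_ext (N := N.toGrModule) fun p q e x => ?_
        exact evalLin_tmk X N (show l + p = q by omega) e f x }

/-- The adjunction between `- ⊗_A X` and `Hom_B(X, -)` on homotopy categories. -/
def hotTensorHomAdjunction : hotTensor X ⊣ hotHom X :=
  Adjunction.mkOfUnitCounit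
    { unit := CategoryTheory.Quotient.natTransLift _
        { app := fun M => (toHot A).map ((tensorHomAdjunction X).unit.app M)
          naturality := fun M N f =>
            congrArg (toHot A).map ((tensorHomAdjunction X).unit.naturality f) }
      counit := CategoryTheory.Quotient.natTransLift _
        { app := fun M => (toHot B).map ((tensorHomAdjunction X).counit.app M)
          naturality := fun M N f =>
            congrArg (toHot B).map ((tensorHomAdjunction X).counit.naturality f) }
      left_triangle := by
        ext ⟨M⟩
        exact congrArg (toHot B).map
          (congrArg (fun τ => τ.app M) (tensorHomAdjunction X).left_triangle)
      right_triangle := by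
        ext ⟨N⟩
        exact congrArg (toHot A).map
          (congrArg (fun τ => τ.app N) (tensorHomAdjunction X).right_triangle) }

end TensorHom

end

section General

variable {R : Type u} [CommRing R] {A B : CDGAlgebra R}

namespace CDGModule

theorem IsTAcyclic.of_bijective {t : R} {M N : CDGModule A} (f : M ⟶ N)
    (hf : ∀ i, Function.Bijective (Hom.f f i)) (hN : N.IsTAcyclic t) : M.IsTAcyclic t := by
  intro s i j l h h' x w hw
  obtain ⟨y, z, hyz⟩ := hN s h h' (Hom.f f j x) (Hom.f f l w) (by
    rw [← Hom.f_d f, ← map_smul (Hom.f f l), ← map_smul (Hom.f f l), hw])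
  obtain ⟨y, rfl⟩ := (hf i).2 y
  obtain ⟨z, rfl⟩ := (hf j).2 z
  refine ⟨y, z, (hf j).1 ?_⟩
  rw [map_smul, hyz, map_add, map_smul, map_smul, Hom.f_d f]

/-! ### Nullhomotopies out of cofibrant modules -/

/-- Acyclicity: every cycle is a boundary. -/
def IsAcyclic (M : CDGModule A) : Prop :=
  ∀ ⦃i j l : ℤ⦄ (h : i + 1 = j) (h' : j + 1 = l) (x : M.C j), M.d h' x = 0 → ∃ y, M.d h y = x

theorem IsAcyclic.shift {M : CDGModule A} (hM : M.IsAcyclic) (n : ℤ) : (M.shift n).IsAcyclic := by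
  intro i j l h h' x hx
  have e := shiftEquiv_d M n rfl rfl h' (show j + n + 1 = l + n by omega) x
  rw [hx, map_zero] at e
  have e' := congrArg (fun v => sgn R n • v) e
  simp only [smul_zero, smul_smul, sgn_mul_self, one_smul] at e'
  obtain ⟨y, hy⟩ := hM (show i + n + 1 = j + n by omega) _ _ e'.symm
  refine ⟨sgn R n • (M.shiftEquiv n rfl).symm y, (M.shiftEquiv n rfl).injective ?_⟩
  rw [map_smul, map_smul, shiftEquiv_d M n rfl rfl h (by omega), smul_smul, sgn_mul_self, one_smul,
    LinearEquiv.apply_symm_apply, hy]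

/-- A cycle with components `m`, `n` satisfies `m = -d n`, so it is the boundary of `-n` placed in
the first summand. This needs no assumption on the curvature. -/
theorem isAcyclic_fiber_id (M : CDGModule A) : (fiber (𝟙 M)).IsAcyclic := by
  intro i j l h h' x hx
  refine ⟨-fiberInl _ i (fiberSnd _ h x), ?_⟩
  have e := congrArg (fiberSnd (𝟙 M) h') hx
  rw [fiberSnd_d _ h, map_zero, id_f, sub_eq_zero] at e
  apply fiber_ext (𝟙 M) h
  · rw [fiberFst_d, map_neg, map_neg, fiberFst_inl, e]
  · rw [fiberSnd_d _ (show i - 1 + 1 = i by omega)]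
    simp

theorem IsAcyclic.subsingleton_cohomology {M : CDGModule A} (hM : M.IsAcyclic) (i : ℤ) :
    Subsingleton (M.cohomology i) := by
  refine ⟨fun x y => ?_⟩
  have key : ∀ x : M.cohomology i, x = 0 := by
    intro x
    obtain ⟨⟨x, hx⟩, rfl⟩ := Submodule.Quotient.mk_surjective _ x
    exact (Submodule.Quotient.mk_eq_zero _).2 (hM (sub_add_cancel i 1) rfl x hx)
  rw [key x, key y]

/-- The fiber of `𝟙 M` surjects onto `M`, and both are acyclic, so this is a surjective
quasi-isomorphism. In a lift of `f` to the fiber, minus the second component is a nullhomotopy of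
`f`. -/
theorem IsCofibrant.nullhomotopic {P M : CDGModule A} (hP : P.IsCofibrant) (hM : M.IsAcyclic)
    (f : P ⟶ M) : Nonempty (Homotopy f 0) := by
  obtain ⟨g, hg⟩ := hP _ _ (fromFiber (𝟙 M)) f (fun i x => ⟨fiberInl _ i x, by simp⟩) (by
    intro i
    have := (isAcyclic_fiber_id M).subsingleton_cohomology i
    have := hM.subsingleton_cohomology i
    exact ⟨Function.injective_of_subsingleton _, fun x => ⟨0, Subsingleton.elim _ _⟩⟩)
  refine ⟨{ h := fun e => -(fiberSnd _ e ∘ₗ Hom.f g _), h_act := ?_, comm := ?_ }⟩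
  · intro i j l i' l' e hi hl e' m a
    simp only [LinearMap.neg_apply, LinearMap.comp_apply]
    rw [Hom.f_act g, fiberSnd_act _ hi hl e e']
    simp
  · intro i j l e e' m
    simp only [LinearMap.neg_apply, LinearMap.comp_apply]
    rw [Hom.f_d g, fiberSnd_d _ e e', id_f, map_neg]
    have : Hom.f f i m = fiberFst _ i (Hom.f g i m) := by rw [← hg]; rfl
    rw [this, zero_f]
    abel

/-! ### Quotients by the elements whose product with `t^s` is divisible by `t^(s+1)` -/

/-- The elements `z` such that `t^s z` is divisible by `t^(s+1)`. -/
def tKer (t : R) (M : GrModule A) (s : ℕ) (i : ℤ) : Submodule R (M.C i) :=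
  (tFil t M (s + 1) i).comap (LinearMap.lsmul R (M.C i) (t ^ s))

/-- The action of `A` on the quotient by `tKer t M s`. -/
def tQuotAct (t : R) (M : GrModule A) (s : ℕ) {i j l : ℤ} (h : i + j = l) (a : A.C j) :
    (M.C i ⧸ tKer t M s i) →ₗ[R] M.C l ⧸ tKer t M s l :=
  Submodule.mapQ _ _ ((M.act h).flip a) (by
    rintro x ⟨w, hw⟩
    exact ⟨M.act h w a, by simpa using congrArg (M.act h · a) hw⟩)

/-- The quotient of `M` by `tKer t M s`, which is isomorphic to `Gr^s_t(M)`. -/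
def tQuot (t : R) (M : CDGModule A) (s : ℕ) : CDGModule A where
  C i := M.C i ⧸ tKer t M.toGrModule s i
  act {i j l} h := LinearMap.mk₂ R (fun x a => tQuotAct t M.toGrModule s h a x)
    (fun x y a => map_add _ x y) (fun r x a => map_smul _ r x)
    (by
      intro x a b
      obtain ⟨x, rfl⟩ := Submodule.Quotient.mk_surjective _ x
      exact congrArg Submodule.Quotient.mk (map_add (M.act h x) a b))
    (by
      intro r x a
      obtain ⟨x, rfl⟩ := Submodule.Quotient.mk_surjective _ x
      exact congrArg Submodule.Quotient.mk (map_smul (M.act h x) r a))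
  act_one h x := by
    obtain ⟨x, rfl⟩ := Submodule.Quotient.mk_surjective _ x
    exact congrArg Submodule.Quotient.mk (M.act_one h x)
  act_act h₁ h₂ h₃ h₄ x a b := by
    obtain ⟨x, rfl⟩ := Submodule.Quotient.mk_surjective _ x
    exact congrArg Submodule.Quotient.mk (M.act_act h₁ h₂ h₃ h₄ x a b)
  d {i j} h := Submodule.mapQ _ (tKer t M.toGrModule s j) (M.d h) (by
    rintro x ⟨w, hw⟩
    exact ⟨M.d h w, by simpa using congrArg (M.d h) hw⟩)
  d_act h hi hj hl h₁ h₂ x a := by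
    obtain ⟨x, rfl⟩ := Submodule.Quotient.mk_surjective _ x
    exact congrArg Submodule.Quotient.mk (M.d_act h hi hj hl h₁ h₂ x a)
  d_d h h' h₁ x := by
    obtain ⟨x, rfl⟩ := Submodule.Quotient.mk_surjective _ x
    exact congrArg Submodule.Quotient.mk (M.d_d h h' h₁ x)

/-- The projection `M ⟶ tQuot t M s`. -/
def toTQuot (t : R) (M : CDGModule A) (s : ℕ) : M ⟶ tQuot t M s where
  f i := (tKer t M.toGrModule s i).mkQ
  f_act _ _ _ := rfl
  f_d _ _ := rfl

theorem toTQuot_surjective (t : R) (M : CDGModule A) (s : ℕ) (i : ℤ) :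
    Function.Surjective (Hom.f (toTQuot t M s) i) := Submodule.mkQ_surjective _

theorem toTQuot_eq_zero_iff {t : R} {M : CDGModule A} {s : ℕ} {i : ℤ} {x : M.C i} :
    Hom.f (toTQuot t M s) i x = 0 ↔ ∃ w : M.C i, t ^ (s + 1) • w = t ^ s • x :=
  Submodule.Quotient.mk_eq_zero _

/-- Being killed by `t` is what makes this quotient, over a deformation, a dg module over the
undeformed algebra. Unlike `t^s M / t^(s+1) M`, it is directly a quotient of `M`, so maps from
projectives into it lift to `M`. -/
theorem smul_tQuot (t : R) (M : CDGModule A) (s : ℕ) {i : ℤ} (x : (tQuot t M s).C i) :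
    t • x = 0 := by
  obtain ⟨x, rfl⟩ := toTQuot_surjective t M s i x
  rw [← map_smul]
  exact toTQuot_eq_zero_iff.2 ⟨x, by rw [smul_smul, pow_succ]⟩

theorem IsTAcyclic.isAcyclic_tQuot {t : R} {M : CDGModule A} (hM : M.IsTAcyclic t) (s : ℕ) :
    (tQuot t M s).IsAcyclic := by
  intro i j l h h' x hx
  obtain ⟨x, rfl⟩ := toTQuot_surjective t M s j x
  rw [← Hom.f_d (toTQuot t M s)] at hx
  obtain ⟨w, hw⟩ := toTQuot_eq_zero_iff.1 hx
  obtain ⟨y, z, hyz⟩ := hM s h h' x w hw.symm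
  refine ⟨Hom.f (toTQuot t M s) i y, ?_⟩
  rw [← Hom.f_d (toTQuot t M s), ← sub_eq_zero, ← map_sub]
  refine toTQuot_eq_zero_iff.2 ⟨-z, ?_⟩
  rw [smul_sub, hyz, smul_neg]
  abel

end CDGModule

/-! ### Lifting homogeneous maps out of projective graded modules -/

namespace GrModule

/-- The shift of a graded module. -/
def shift (M : GrModule A) (n : ℤ) : GrModule A where
  C i := M.C (i + n)
  act {i j l} h := M.act (show i + n + j = l + n by omega)
  act_one h m := M.act_one _ m
  act_act h₁ h₂ h₃ h₄ x a b := M.act_act _ _ h₃ _ x a b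

/-- The graded submodule `t^s M`. -/
def tFilModule (t : R) (M : GrModule A) (s : ℕ) : GrModule A where
  C i := tFil t M s i
  act {i j l} h := LinearMap.mk₂ R
    (fun x a => (⟨M.act h x.1 a, by
      obtain ⟨_, x, rfl⟩ := x
      exact ⟨M.act h x a, by simp⟩⟩ : tFil t M s l))
    (by intros; ext; simp) (by intros; ext; simp) (by intros; ext; simp) (by intros; ext; simp)
  act_one h m := Subtype.ext (M.act_one h m.1)
  act_act h₁ h₂ h₃ h₄ x a b := Subtype.ext (M.act_act h₁ h₂ h₃ h₄ x.1 a b)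

/-- Multiplication by `t^s`, as a morphism onto `t^s M`. -/
def toTFilModule (t : R) (M : GrModule A) (s : ℕ) : GrModule.Hom M (M.tFilModule t s) where
  f i := (LinearMap.lsmul R (M.C i) (t ^ s)).rangeRestrict
  f_act h m a := Subtype.ext (by
    change t ^ s • M.act h m a = M.act h (t ^ s • m) a
    simp)

/-- A map of degree `l` is a map of degree `0` into the shift by `l`, to which projectivity applies.
-/
theorem IsProjective.exists_homSub_lift {P M N : GrModule A} (hP : P.IsProjective)
    (p : GrModule.Hom M N) (hp : ∀ i, Function.Surjective (p.f i)) {l : ℤ} (f : homSub P N l) :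
    ∃ g : homSub P M l, ∀ (i j : ℤ) (h : i + l = j) (x : P.C i),
      p.f j (homAp i j h g x) = homAp i j h f x := by
  obtain ⟨g, hg⟩ := hP (M.shift l) (N.shift l)
    { f := fun i => p.f (i + l), f_act := fun h m a => p.f_act _ m a }
    { f := fun i => homAp i (i + l) rfl f, f_act := fun h m a => homAp_act f h _ _ _ m a }
    (fun i => hp _)
  refine ⟨homMk (fun i j h => by subst h; exact g.f i) ?_, ?_⟩
  · intro i b ib j jb h₁ h₂ h₃ h₄ x y
    subst h₂ h₃
    exact g.f_act h₁ x y
  · intro i j h x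
    subst h
    exact hg i x

end GrModule

/-! ### The cone of `Hom_B(X, φ)` -/

namespace CDGModule

variable {M N : CDGModule A} (φ : M ⟶ N)

theorem coneInl_act {i j l : ℤ} (h : i + j = l) (x : N.C i) (a : A.C j) :
    coneInl φ l (N.act h x a) = (cone φ).act h (coneInl φ i x) a := by
  apply cone_ext φ rfl
  · rw [coneFst_act]; simp
  · rw [coneSnd_act φ rfl rfl h (by omega)]; simp

theorem coneInr_act {i j l i' l' : ℤ} (hi : i' + 1 = i) (hl : l' + 1 = l) (h : i + j = l)
    (h' : i' + j = l') (x : M.C i) (a : A.C j) :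
    coneInr φ hl (M.act h x a) = (cone φ).act h' (coneInr φ hi x) a := by
  apply cone_ext φ hl
  · rw [coneFst_act]; simp
  · rw [coneSnd_act φ hi hl h' h]; simp

theorem d_coneInl {i j : ℤ} (h : i + 1 = j) (x : N.C i) :
    (cone φ).d h (coneInl φ i x) = coneInl φ j (N.d h x) := by
  apply cone_ext φ rfl
  · rw [coneFst_d]; simp
  · rw [coneSnd_d]; simp

theorem d_coneInr {i j l : ℤ} (h : i + 1 = j) (h' : j + 1 = l) (x : M.C j) :
    (cone φ).d h (coneInr φ h x) = coneInl φ j (Hom.f φ j x) - coneInr φ h' (M.d h' x) := by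
  apply cone_ext φ h'
  · rw [coneFst_d]; simp
  · rw [coneSnd_d]; simp

end CDGModule

section ConeHom

open CDGModule

variable (X : CDGBimodule A B) {M N : CDGModule B} (φ : M ⟶ N)

/-- The map `X ⟶ cone φ` with components `f : X ⟶ N` and `g : X ⟶ M[1]`. -/
def homConeMk {l l' : ℤ} (hl : l + 1 = l') :
    (homSub X.toGrModule N.toGrModule l × homSub X.toGrModule M.toGrModule l') →ₗ[R]
      homSub X.toGrModule (cone φ).toGrModule l where
  toFun z := homMk (fun i j h => coneInl φ j ∘ₗ homAp i j h z.1 +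
      coneInr φ rfl ∘ₗ homAp i (j + 1) (by omega) z.2) (by
    intro i b ib j jb h₁ h₂ h₃ h₄ x y
    simp only [LinearMap.add_apply, LinearMap.comp_apply, map_add]
    rw [homAp_act z.1 h₁ h₂ h₃ h₄,
      homAp_act z.2 h₁ (show i + l' = j + 1 by omega) _ (show j + 1 + b = jb + 1 by omega),
      coneInl_act, coneInr_act φ rfl rfl _ h₄])
  map_add' z z' := by
    apply homSub_ext
    intro i j h x
    simp only [homAp_homMk, map_add, LinearMap.add_apply, LinearMap.comp_apply, Prod.fst_add,
      Prod.snd_add]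
    abel
  map_smul' r z := by
    apply homSub_ext
    intro i j h x
    simp

theorem homAp_homConeMk {l l' : ℤ} (hl : l + 1 = l')
    (z : homSub X.toGrModule N.toGrModule l × homSub X.toGrModule M.toGrModule l') {i j j' : ℤ}
    (h : i + l = j) (hj : j + 1 = j') (h' : i + l' = j') (x : X.C i) :
    homAp i j h (homConeMk X φ hl z) x =
      coneInl φ j (homAp i j h z.1 x) + coneInr φ hj (homAp i j' h' z.2 x) := by
  subst hj
  rfl

theorem homConeMk_bijective {l l' : ℤ} (hl : l + 1 = l') :
    Function.Bijective (homConeMk X φ hl) := by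
  constructor
  · rw [← LinearMap.ker_eq_bot, LinearMap.ker_eq_bot']
    rintro z hz
    have key : ∀ {i j j' : ℤ} (h : i + l = j) (hj : j + 1 = j') (h' : i + l' = j') (x : X.C i),
        coneInl φ j (homAp i j h z.1 x) + coneInr φ hj (homAp i j' h' z.2 x) = 0 := by
      intro i j j' h hj h' x
      rw [← homAp_homConeMk X φ hl z h hj h' x, hz]
      simp
    apply Prod.ext
    · apply homSub_ext
      intro i j h x
      simpa using congrArg (coneFst φ j) (key h rfl (by omega) x)
    · apply homSub_ext
      intro i j h x
      simpa using congrArg (coneSnd φ (show j - 1 + 1 = j by omega))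
        (key (show i + l = j - 1 by omega) (show j - 1 + 1 = j by omega) h x)
  · intro F
    refine ⟨(homMk (fun i j h => coneFst φ j ∘ₗ homAp i j h F) ?_,
      homMk (fun i j h => coneSnd φ (show j - 1 + 1 = j by omega) ∘ₗ
        homAp i (j - 1) (by omega) F) ?_), ?_⟩
    · intro i b ib j jb h₁ h₂ h₃ h₄ x y
      simp only [LinearMap.comp_apply]
      rw [homAp_act F h₁ h₂ h₃ h₄, coneFst_act]
    · intro i b ib j jb h₁ h₂ h₃ h₄ x y
      simp only [LinearMap.comp_apply]
      rw [homAp_act F h₁ (show i + l = j - 1 by omega) _ (show j - 1 + b = jb - 1 by omega),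
        coneSnd_act φ _ _ _ h₄]
    · apply homSub_ext
      intro i j h x
      rw [homAp_homConeMk X φ hl _ h rfl (by omega)]
      have : ∀ (p : ℤ) (hp : p = j) (e : i + l = p) (e' : p + 1 = j + 1),
          coneSnd φ e' (homAp i p e F x) = coneSnd φ rfl (homAp i j h F x) := by
        rintro p rfl e e'
        rfl
      simp only [homAp_homMk, LinearMap.comp_apply]
      rw [this _ (by omega)]
      exact (cone_eq φ rfl _).symm

/-- The signs agree because `g` has degree one more than `f`: this changes the sign in the Hom
differential exactly as the shift changes the differential of `M` in the cone. -/
theorem homConeMk_d {i j l : ℤ} (h : i + 1 = j) (h' : j + 1 = l)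
    (f : homSub X.toGrModule N.toGrModule i) (g : homSub X.toGrModule M.toGrModule j) :
    homConeMk X φ h' (homD X N h f + homPost X φ j g, -homD X M h' g) =
      homD X (cone φ) h (homConeMk X φ h (f, g)) := by
  refine homSub_ext fun p q e x => ?_
  rw [homAp_homConeMk X φ h' _ e rfl (show p + l = q + 1 by omega) x,
    homD_apply X (cone φ) h (homConeMk X φ h (f, g)) e rfl (show p + i + 1 = q by omega) rfl
      (by omega) x,
    homAp_homConeMk X φ h _ rfl (show p + i + 1 = q by omega) e,
    homAp_homConeMk X φ h _ _ rfl (show p + 1 + j = q + 1 by omega), map_add (homAp p q e),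
    LinearMap.add_apply, homD_apply X N h f e rfl (by omega) rfl (by omega),
    homAp_homPost, map_neg (homAp p (q + 1) _), LinearMap.neg_apply,
    homD_apply X M h' g (by omega) e rfl rfl (by omega), map_add ((cone φ).d _),
    d_coneInl, d_coneInr φ _ rfl,
    show sgn R j = -sgn R i by rw [← h, sgn_add, sgn_one]; ring]
  simp only [map_add, map_sub, map_neg, map_smul]
  module

/-- The comparison isomorphism from the cone of `Hom_B(X, φ)` to `Hom_B(X, cone φ)`. -/
def coneHomComparison : cone ((homFunctor X).map φ) ⟶ (homFunctor X).obj (cone φ) where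
  f l := homConeMk X φ (rfl : l + 1 = l + 1)
  f_act {i j l} h z a := by
    refine homSub_ext (N := (cone φ).toGrModule) fun p q e x => ?_
    refine Eq.trans ?_ (homAct_apply X (cone φ).toGrModule h _ a e rfl (by omega) x).symm
    refine (homAp_homConeMk X φ rfl _ e rfl (by omega) x).trans ?_
    refine Eq.trans ?_ (homAp_homConeMk X φ rfl z (show j + p + i = q by omega) rfl
      (by omega) (X.lact rfl a x)).symm
    exact congrArg₂ (coneInl φ q · + coneInr φ rfl ·)
      (homAct_apply X N.toGrModule h z.1 a e rfl (by omega) x)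
      (homAct_apply X M.toGrModule (show i + 1 + j = l + 1 by omega) z.2 a
        (show p + (l + 1) = q + 1 by omega) rfl (by omega) x)
  f_d {i j} h z := by
    subst h
    exact homConeMk_d X φ rfl rfl z.1 z.2

/-- `Hom(X, -)` commutes with cones, so preserving morphisms with acyclic cone reduces to preserving
acyclic modules. -/
theorem isTAcyclic_cone_homFunctor_map {t : R}
    (h : ((homFunctor X).obj (cone φ)).IsTAcyclic t) :
    (cone ((homFunctor X).map φ)).IsTAcyclic t :=
  h.of_bijective (coneHomComparison X φ) fun _ => homConeMk_bijective X φ rfl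

end ConeHom

end General

/-! ### Modules annihilated by `t` as dg modules over the undeformed algebra. -/

section

variable {k : Type u} [Field k]

namespace Deformation

variable {n : ℕ} {A B : DGAlgebra k} (An : Deformation A n) (Bn : Deformation B n)

theorem lift_add (i : ℤ) (a b : A.C i) : An.lift i (a + b) = An.lift i a + An.lift i b := by
  rw [lift, lift, lift, TensorProduct.tmul_add, map_add]

theorem lift_smul (i : ℤ) (c : k) (a : A.C i) :
    An.lift i (c • a) = algebraMap k (TruncPoly k n) c • An.lift i a := by
  rw [lift, lift, ← map_smul, TensorProduct.tmul_smul, algebraMap_smul]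

theorem algebraMap_sgn (i : ℤ) :
    algebraMap k (TruncPoly k n) (sgn k i) = sgn (TruncPoly k n) i := by
  rw [sgn, sgn, map_intCast]

section Restrict

variable {An} (Q : CDGModule An.alg) (hQ : ∀ (i : ℤ) (x : Q.C i), tVar k n • x = 0)

include hQ in
-- Two elements with the same reduction act with a difference in `t Q`, which is zero. Hence `A`
-- acts on `Q` through arbitrary lifts.
theorem act_eq_of_red_eq {i j l : ℤ} (h : i + j = l) (x : Q.C i) {a b : An.alg.C j}
    (hab : An.red j a = An.red j b) : Q.act h x a = Q.act h x b := by
  obtain ⟨y, hy⟩ := An.sub_mem_of_red_eq (M := Q.toGrModule) h x a b hab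
  rw [← sub_eq_zero, ← hy, LinearMap.lsmul_apply, pow_one, hQ]

/-- The degree `i` part of a cdg `A_n`-module, as a vector space over `k`. -/
def RestrictC (i : ℤ) : Type u := Q.C i

instance (i : ℤ) : AddCommGroup (RestrictC Q i) := inferInstanceAs (AddCommGroup (Q.C i))

instance (i : ℤ) : Module (TruncPoly k n) (RestrictC Q i) :=
  inferInstanceAs (Module (TruncPoly k n) (Q.C i))

instance (i : ℤ) : Module k (RestrictC Q i) := Module.compHom _ (algebraMap k (TruncPoly k n))

theorem algebraMap_smul_restrictC (i : ℤ) (c : k) (x : RestrictC Q i) :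
    c • x = algebraMap k (TruncPoly k n) c • x := rfl

/-- A cdg `A_n`-module annihilated by `t`, as a dg module over `A`. -/
def restrict : CDGModule A.toCDGAlgebra where
  C i := RestrictC Q i
  act {i j l} h := LinearMap.mk₂ k
    (fun (x : RestrictC Q i) b => (Q.act h x (An.lift j b) : RestrictC Q l))
    (fun x y b => congrArg (fun f => f (An.lift j b)) (map_add (Q.act h) x y))
    (fun c x b => congrArg (fun f => f (An.lift j b))
      (map_smul (Q.act h) (algebraMap k (TruncPoly k n) c) x))
    (fun x a b => by
      rw [lift_add]
      exact map_add (Q.act h x) _ _)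
    (fun c x b => by
      rw [lift_smul]
      exact map_smul (Q.act h x) _ _)
  act_one {i} h x := (act_eq_of_red_eq Q hQ h x ((An.red_lift 0 _).trans An.red_one.symm)).trans
    (Q.act_one h x)
  act_act h₁ h₂ h₃ h₄ x a b := (Q.act_act h₁ h₂ h₃ h₄ x _ _).trans
    (act_eq_of_red_eq Q hQ h₄ x (red_lift_mul An h₃ a b))
  d {i j} h :=
    { toFun := fun x => (Q.d h x : RestrictC Q j)
      map_add' := fun x y => map_add (Q.d h) x y
      map_smul' := fun c x => map_smul (Q.d h) (algebraMap k (TruncPoly k n) c) x }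
  d_act {i j l i' j' l'} h hi hj hl h₁ h₂ x b := by
    refine (Q.d_act h hi hj hl h₁ h₂ x (An.lift j b)).trans ?_
    have hb : An.red j' (An.alg.d hj (An.lift j b)) = An.red j' (An.lift j' (A.d hj b)) := by
      rw [red_lift]
      exact (An.red_d hj _).trans (congrArg (A.d hj) (An.red_lift j b))
    rw [act_eq_of_red_eq Q hQ h₂ x hb, ← algebraMap_sgn]
    rfl
  d_d h h' h₁ x := (Q.d_d h h' h₁ x).trans
    (congrArg Neg.neg (act_eq_of_red_eq Q hQ h₁ x (An.red_curv.trans (An.red_lift 2 _).symm)))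

theorem isAcyclic_restrict (h : Q.IsAcyclic) : (restrict Q hQ).IsAcyclic := h

end Restrict

/-! ### Graded maps out of `X_n` and the dg morphisms they induce on its reduction. -/

section Hom

variable {An Bn} (X : CDGBimodule An.alg Bn.alg) (Z : CDGModule Bn.alg)

variable {X Z} in
theorem toTQuot_homAp_eq_zero {t : TruncPoly k n} {s : ℕ} {l : ℤ}
    {f w : homSub X.toGrModule Z.toGrModule l} (hw : t ^ s • f = t ^ (s + 1) • w) {i j : ℤ}
    (h : i + l = j) (x : X.C i) : CDGModule.Hom.f (Z.toTQuot t s) j (homAp i j h f x) = 0 := by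
  refine CDGModule.toTQuot_eq_zero_iff.2 ⟨homAp i j h w x, ?_⟩
  rw [← LinearMap.smul_apply, ← map_smul, ← hw, map_smul, LinearMap.smul_apply]

/-- The linear map `X_n / t X_n ⟶ Z / tKer t Z s` induced by a graded map `f : X_n ⟶ Z`. -/
def reductionLin (s : ℕ) {l : ℤ} (f : homSub X.toGrModule Z.toGrModule l) {i j : ℤ}
    (h : i + l = j) : RedC An Bn X i →ₗ[TruncPoly k n] (Z.tQuot (tVar k n) s).C j :=
  (tFil (tVar k n) X.toGrModule 1 i).liftQ
    (CDGModule.Hom.f (Z.toTQuot (tVar k n) s) j ∘ₗ homAp i j h f) (by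
      rintro _ ⟨x, rfl⟩
      rw [LinearMap.mem_ker, LinearMap.lsmul_apply, map_smul, pow_one]
      exact CDGModule.smul_tQuot _ Z s _)

theorem reductionLin_redMk (s : ℕ) {l : ℤ} (f : homSub X.toGrModule Z.toGrModule l) {i j : ℤ}
    (h : i + l = j) (x : X.C i) : reductionLin X Z s f h (redMk An Bn X i x) =
      CDGModule.Hom.f (Z.toTQuot (tVar k n) s) j (homAp i j h f x) := rfl

/-- The `k`-linear map underlying `reductionLin`. -/
def reductionLinₖ (s : ℕ) {l : ℤ} (f : homSub X.toGrModule Z.toGrModule l) (i : ℤ) :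
    RedC An Bn X i →ₗ[k] RestrictC (Z.tQuot (tVar k n) s) (i + l) where
  toFun := reductionLin X Z s f rfl
  map_add' := map_add (reductionLin X Z s f rfl)
  map_smul' c x := map_smul (reductionLin X Z s f rfl) (algebraMap k (TruncPoly k n) c) x

theorem reductionLin_redAct (s : ℕ) {l : ℤ} (f : homSub X.toGrModule Z.toGrModule l)
    {i b ib j jb : ℤ} (h₁ : i + b = ib) (h₂ : i + l = j) (h₃ : ib + l = jb) (h₄ : j + b = jb)
    (x : RedC An Bn X i) (y : Bn.alg.C b) :
    reductionLin X Z s f h₃ (redAct An Bn X h₁ y x) =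
      (Z.tQuot (tVar k n) s).act h₄ (reductionLin X Z s f h₂ x) y := by
  obtain ⟨x, rfl⟩ := redMk_surjective An Bn X _ x
  rw [redAct_redMk, reductionLin_redMk, reductionLin_redMk, homAp_act f h₁ h₂ h₃ h₄,
    CDGModule.Hom.f_act (Z.toTQuot (tVar k n) s)]

/-- Modulo `tKer`, the hypothesis `hw` says that the Hom differential of `f` vanishes, that is, `f`
commutes with `d` up to `(-1)^l`. This is the sign in the differential of the shift by `l`, so `f`
becomes a closed morphism into that shift. -/
theorem reductionLin_redD {s : ℕ} {l l' : ℤ} {hl : l + 1 = l'}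
    {f : homSub X.toGrModule Z.toGrModule l} {w : homSub X.toGrModule Z.toGrModule l'}
    (hw : tVar k n ^ s • homD X Z hl f = tVar k n ^ (s + 1) • w) {i i' j j' : ℤ} (h : i + l = j)
    (h' : i' + l = j') (hi : i + 1 = i') (hj : j + 1 = j') (x : RedC An Bn X i) :
    reductionLin X Z s f h' (redD An Bn X hi x) =
      sgn (TruncPoly k n) l • (Z.tQuot (tVar k n) s).d hj (reductionLin X Z s f h x) := by
  obtain ⟨x, rfl⟩ := redMk_surjective An Bn X _ x
  have e := toTQuot_homAp_eq_zero hw (show i + l' = j' by omega) x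
  rw [homD_apply X Z hl f _ h hj hi h', map_sub, map_smul, sub_eq_zero] at e
  rw [redD_redMk, reductionLin_redMk, reductionLin_redMk,
    ← CDGModule.Hom.f_d (Z.toTQuot (tVar k n) s), e, smul_smul, sgn_mul_self, one_smul]

/-- A graded map `f : X_n ⟶ Z` of degree `l` which commutes with the predifferentials modulo
`tKer t Z s` induces a morphism of dg modules from the reduction of `X_n`. -/
def reductionMap {s : ℕ} {l l' : ℤ} {hl : l + 1 = l'}
    (f : homSub X.toGrModule Z.toGrModule l) {w : homSub X.toGrModule Z.toGrModule l'}
    (hw : tVar k n ^ s • homD X Z hl f = tVar k n ^ (s + 1) • w) :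
    reduction An Bn X ⟶
      (restrict (Z.tQuot (tVar k n) s) (fun _ => CDGModule.smul_tQuot _ Z s)).shift l where
  f i := reductionLinₖ X Z s f i
  f_act {i j m} h x b :=
    reductionLin_redAct X Z s f h rfl rfl (show i + l + j = m + l by omega) x (Bn.lift j b)
  f_d {i j} h x := by
    refine (reductionLin_redD X Z hw rfl rfl h (show i + l + 1 = j + l by omega) x).trans ?_
    rw [← algebraMap_sgn]
    rfl

variable {X Z}

theorem homAp_smul_apply (c : TruncPoly k n) {l : ℤ}
    (f : homSub X.toGrModule Z.toGrModule l) {i j : ℤ} (h : i + l = j) (x : X.C i) :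
    homAp i j h (c • f) x = c • homAp i j h f x := by
  rw [map_smul, LinearMap.smul_apply]

/-! ### Homotopies on the reduction as graded maps out of `X_n`. -/

section HomotopyLift

variable {Q : CDGModule Bn.alg} {hQ : ∀ (i : ℤ) (x : Q.C i), tVar k n • x = 0} {m : ℤ}
  {g g' : reduction An Bn X ⟶ (restrict Q hQ).shift m}

/-- The components `X_n ⟶ Q` of a homotopy between morphisms from the reduction of `X_n` to a shift
of `Q`. -/
def homotopyAp (H : CDGModule.Homotopy g g') {i p q : ℤ} (hi : i + 1 = p)
    (hj : i + m = q) : X.C p →ₗ[TruncPoly k n] Q.C q where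
  toFun x := (CDGModule.shiftEquiv (restrict Q hQ) m hj (H.h hi (redMk An Bn X p x)) :
    RestrictC Q q)
  map_add' x y := by
    rw [map_add]
    refine (congrArg _ (map_add (H.h hi) _ _)).trans ?_
    exact map_add (CDGModule.shiftEquiv (restrict Q hQ) m hj) _ _
  map_smul' r x := by
    -- The homotopy is only `k`-linear. Linearity over `R_n` follows because `t` kills both the
    -- reduction and `Q`, so that `r` acts on each through its augmentation.
    obtain ⟨r', hr⟩ := exists_sub_eq_tVar_smul r
    have e₁ : redMk An Bn X p (r • x) = (augm k n r) • redMk An Bn X p x := by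
      refine redMk_eq An Bn X (y := algebraMap k (TruncPoly k n) (augm k n r) • x) ⟨r' • x, ?_⟩
      rw [← sub_smul, hr, LinearMap.lsmul_apply, pow_one, smul_smul, mul_comm]
    have e₂ : ∀ y : RestrictC Q q, r • y = augm k n r • y := by
      intro y
      have : tVar k n • y = 0 := hQ q y
      rw [algebraMap_smul_restrictC, ← sub_eq_zero, ← sub_smul, hr, mul_smul, this, smul_zero]
    refine Eq.trans ?_ (e₂ _).symm
    rw [e₁]
    refine (congrArg _ (map_smul (H.h hi) _ _)).trans ?_
    exact map_smul (CDGModule.shiftEquiv (restrict Q hQ) m hj) _ _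

/-- The homotopy is linear over `B`, and on both sides `y` acts in the same way as the lift of its
reduction. -/
theorem homotopyAp_act (H : CDGModule.Homotopy g g') {i p q i' p' q' b : ℤ} (hi : i + 1 = p)
    (hj : i + m = q) (hi' : i' + 1 = p') (hj' : i' + m = q')
    (h₁ : p + b = p') (h₂ : q + b = q') (x : X.C p) (y : Bn.alg.C b) :
    homotopyAp H hi' hj' (X.act h₁ x y) = Q.act h₂ (homotopyAp H hi hj x) y := by
  have e : redMk An Bn X p' (X.act h₁ x y) =
      redMk An Bn X p' (X.act h₁ x (Bn.lift b (Bn.red b y))) :=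
    redMk_eq An Bn X (Bn.sub_mem_of_red_eq (M := X.toGrModule) h₁ x _ _ (Bn.red_lift b _).symm)
  refine (congrArg (fun z => (CDGModule.shiftEquiv (restrict Q hQ) m hj' (H.h hi' z)))
    e).trans ?_
  refine (congrArg (CDGModule.shiftEquiv (restrict Q hQ) m hj') (H.h_act h₁ hi hi'
    (show i + b = i' by omega) (redMk An Bn X p x) (Bn.red b y))).trans ?_
  refine (CDGModule.shiftEquiv_act (restrict Q hQ) m hj hj' (show i + b = i' by omega) h₂ _
    _).trans ?_
  exact act_eq_of_red_eq Q hQ h₂ _ (Bn.red_lift b _)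

theorem homotopyAp_comm (H : CDGModule.Homotopy g g') {i p l q r : ℤ} (hi : i + 1 = p)
    (hl : p + 1 = l) (hj : i + m = q) (hr : p + m = r) (h : q + 1 = r) (x : X.C p) :
    (CDGModule.shiftEquiv (restrict Q hQ) m hr (CDGModule.Hom.f g p (redMk An Bn X p x) -
      CDGModule.Hom.f g' p (redMk An Bn X p x)) : RestrictC Q r) =
      sgn (TruncPoly k n) m • Q.d h (homotopyAp H hi hj x) +
        homotopyAp H hl hr (X.d hl x) := by
  refine (congrArg (CDGModule.shiftEquiv (restrict Q hQ) m hr) (H.comm hi hl _)).trans ?_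
  refine (map_add (CDGModule.shiftEquiv (restrict Q hQ) m hr) _ _).trans ?_
  refine congrArg₂ (fun a b : RestrictC Q r => a + b) ?_ rfl
  refine (CDGModule.shiftEquiv_d (restrict Q hQ) m hj hr hi h _).trans ?_
  rw [← algebraMap_sgn]
  rfl

/-- The homogeneous map `X_n ⟶ Q` given by a homotopy between morphisms from the reduction of `X_n`
to a shift of `Q`. -/
def homotopyHom (H : CDGModule.Homotopy g g') {j : ℤ} (hm : j + 1 = m) :
    homSub X.toGrModule Q.toGrModule j :=
  homMk (fun p q h => homotopyAp H (show p - 1 + 1 = p by omega)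
    (show p - 1 + m = q by omega)) (by
      intro p b p' q q' h₁ h₂ h₃ h₄ x y
      exact homotopyAp_act H _ _ _ _ h₁ h₄ x y)

theorem homAp_homotopyHom (H : CDGModule.Homotopy g g') {j : ℤ} (hm : j + 1 = m) {i p q : ℤ}
    (hi : i + 1 = p) (hj : i + m = q) (h : p + j = q) (x : X.C p) :
    homAp p q h (homotopyHom H hm) x = homotopyAp H hi hj x := by
  obtain rfl : i = p - 1 := by omega
  rfl

end HomotopyLift

/-- If `X_n` is projective as a graded module, with cofibrant reduction, then `Hom_{B_n}(X_n, -)`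
preserves modules with acyclic associated graded. -/
theorem isTAcyclic_hom (hproj : X.toGrModule.IsProjective)
    (hcof : (reduction An Bn X).IsCofibrant) (hZ : Z.IsTAcyclic (tVar k n)) :
    ((homFunctor X).obj Z).IsTAcyclic (tVar k n) := by
  intro s i j l h h' f w hw
  change homSub X.toGrModule Z.toGrModule j at f
  change homSub X.toGrModule Z.toGrModule l at w
  replace hw : tVar k n ^ s • homD X Z h' f = tVar k n ^ (s + 1) • w := hw
  -- Modulo `tKer` the map `f` factors through the reduction of `X_n` and becomes a closed morphism
  -- to an acyclic dg module over `B`; cofibrancy makes it nullhomotopic.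
  obtain ⟨H⟩ := hcof.nullhomotopic
    ((isAcyclic_restrict _ _ (hZ.isAcyclic_tQuot s)).shift j) (reductionMap X Z f hw)
  -- First use of projectivity: the nullhomotopy, seen as a graded map from `X_n` to a quotient of
  -- `Z`, is lifted to `Z`.
  obtain ⟨g, hg⟩ := hproj.exists_homSub_lift
    ⟨CDGModule.Hom.f (Z.toTQuot (tVar k n) s), CDGModule.Hom.f_act (Z.toTQuot (tVar k n) s)⟩
    (Z.toTQuot_surjective (tVar k n) s) (homotopyHom H h)
  -- The homotopy relation reads `f = (-1)^j d g + g d` modulo `tKer`. As `g` has degree `i = j -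
  -- 1`, the right side is the Hom differential of `(-1)^j g`.
  have key : ∀ (p q : ℤ) (e : p + j = q) (x : X.C p), ∃ v : Z.C q,
      tVar k n ^ (s + 1) • v = tVar k n ^ s •
        homAp p q e (f - homD X Z h (sgn (TruncPoly k n) j • g)) x := by
    intro p q e x
    refine CDGModule.toTQuot_eq_zero_iff.1 ?_
    have c := homotopyAp_comm H (show p - 1 + 1 = p by omega) rfl
      (show p - 1 + j = q - 1 by omega) e (by omega) x
    rw [← homAp_homotopyHom H h _ _ (by omega), ← homAp_homotopyHom H h _ _ (by omega), ← hg,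
      ← hg] at c
    have c₁ : CDGModule.Hom.f (Z.toTQuot (tVar k n) s) q (homAp p q e f x) =
        sgn (TruncPoly k n) j • (Z.tQuot (tVar k n) s).d (show q - 1 + 1 = q by omega)
          (CDGModule.Hom.f (Z.toTQuot (tVar k n) s) (q - 1) (homAp p (q - 1) (by omega) g x)) +
        CDGModule.Hom.f (Z.toTQuot (tVar k n) s) q
          (homAp (p + 1) q (by omega) g (X.d rfl x)) := by
      refine Eq.trans ?_ c
      subst e
      exact (sub_zero (CDGModule.Hom.f (Z.toTQuot (tVar k n) s) _ (homAp p _ rfl f x))).symm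
    rw [← CDGModule.Hom.f_d (Z.toTQuot (tVar k n) s)] at c₁
    rw [map_sub (homAp p q e), LinearMap.sub_apply,
      homD_apply X Z h _ e (show p + i = q - 1 by omega) (by omega) rfl (by omega), map_sub, c₁,
      homAp_smul_apply, homAp_smul_apply]
    have hs : sgn (TruncPoly k n) j = - sgn (TruncPoly k n) i := by
      rw [← h, sgn_add, sgn_one]
      ring
    have hi := sgn_mul_self (R := TruncPoly k n) i
    simp only [map_smul, map_sub, hs, neg_smul, smul_neg, map_neg, smul_smul, hi, one_smul]
    abel
  -- Second use of projectivity: `key` gives divisibility by `t^(s+1)` value by value. Lifting along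
  -- multiplication by `t^(s+1)`, from `Z` onto its image, makes the quotients into one `B_n`-linear
  -- map.
  obtain ⟨z, hz⟩ := hproj.exists_homSub_lift (Z.toTFilModule (tVar k n) (s + 1))
    (fun i => LinearMap.surjective_rangeRestrict _)
    (homMk (N := Z.tFilModule (tVar k n) (s + 1)) (fun p q e => LinearMap.codRestrict
      (tFil (tVar k n) Z.toGrModule (s + 1) q)
      (tVar k n ^ s • homAp p q e (f - homD X Z h (sgn (TruncPoly k n) j • g)))
      (fun x => key p q e x)) (by
        intro p b p' q q' h₁ h₂ h₃ h₄ x y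
        refine Subtype.ext ?_
        refine (congrArg (tVar k n ^ s • ·) (homAp_act (f - homD X Z h
          (sgn (TruncPoly k n) j • g)) h₁ h₂ h₃ h₄ x y)).trans ?_
        exact (congrArg (fun v => v y) (map_smul (Z.act h₄) (tVar k n ^ s) _)).symm))
  refine ⟨sgn (TruncPoly k n) j • g, z, ?_⟩
  refine homSub_ext (N := Z.toGrModule) fun p q e x => ?_
  have := congrArg Subtype.val (hz p q e x)
  replace this : tVar k n ^ (s + 1) • homAp p q e z x = tVar k n ^ s •
      homAp p q e (f - homD X Z h (sgn (TruncPoly k n) j • g)) x := this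
  rw [map_sub, LinearMap.sub_apply, smul_sub, eq_sub_iff_add_eq'] at this
  exact this.symm

end Hom

end Deformation

end

/-! ### Descent of `Hom(X_n, -)` to the `n`-derived categories. -/

section

namespace Deformation

variable {k : Type u} [Field k] {n : ℕ} {A B : DGAlgebra k} {An : Deformation A n}
  {Bn : Deformation B n} {X : CDGBimodule An.alg Bn.alg}

theorem nW_hotHom_map (hproj : X.toGrModule.IsProjective)
    (hcof : (reduction An Bn X).IsCofibrant) {M N : Hot Bn.alg} {f : M ⟶ N} (hf : Bn.nW f) :
    An.nW ((hotHom X).map f) := by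
  obtain ⟨φ, rfl, hφ⟩ := hf
  refine ⟨(homFunctor X).map φ, rfl, An.isGrAcyclic_iff.2 ?_⟩
  exact isTAcyclic_cone_homFunctor_map X φ
    (isTAcyclic_hom hproj hcof (Bn.isGrAcyclic_iff.1 hφ))

theorem hotHom_comp_quot_inverts (hproj : X.toGrModule.IsProjective)
    (hcof : (reduction An Bn X).IsCofibrant) :
    Bn.nW.IsInvertedBy (hotHom X ⋙ An.quot) := fun _ _ _ hf =>
  MorphismProperty.Q_inverts An.nW _ (nW_hotHom_map hproj hcof hf)

end Deformation

end

end CDG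

end

theorem mainTheorem4 {k : Type u} [Field k] (n : ℕ) (A B : DGAlgebra k)
    (An : Deformation A n) (Bn : Deformation B n) (X : CDGBimodule An.alg Bn.alg)
    (hproj : X.toGrModule.IsProjective)
    (hcof : (Deformation.reduction An Bn X).IsCofibrant) :
    An.quot.IsRightAdjoint ∧
    (∃ H : Bn.NDerived ⥤ An.NDerived, Nonempty (Bn.quot ⋙ H ≅ hotHom X ⋙ An.quot)) ∧
    ∀ (p : An.NDerived ⥤ Hot An.alg) (adj : p ⊣ An.quot)
      (H : Bn.NDerived ⥤ An.NDerived) (e : Bn.quot ⋙ H ≅ hotHom X ⋙ An.quot),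
      (p ⋙ hotTensor X ⋙ Bn.quot).IsLeftDerivedFunctor
        ((Functor.associator An.quot p (hotTensor X ⋙ Bn.quot)).inv ≫
          Functor.whiskerRight adj.counit (hotTensor X ⋙ Bn.quot) ≫
          (Functor.leftUnitor (hotTensor X ⋙ Bn.quot)).hom) An.nW ∧
      ∃ adj' : (p ⋙ hotTensor X ⋙ Bn.quot) ⊣ H, ∀ N : CDGModule Bn.alg,
        adj'.counit.app (Bn.quot.obj ((toHot _).obj N)) =
          (p ⋙ hotTensor X ⋙ Bn.quot).map
              (e.hom.app ((toHot _).obj N)) ≫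
            (hotTensor X ⋙ Bn.quot).map (adj.counit.app
              ((homFunctor X ⋙ toHot _).obj N)) ≫
            Bn.quot.map ((toHot _).map (evalHom X N)) := by
  refine ⟨An.isRightAdjoint_quot, ?_, fun p adj H e => ⟨?_, ?_⟩⟩
  · exact ⟨Localization.lift _ (Deformation.hotHom_comp_quot_inverts hproj hcof) Bn.quot,
      ⟨Localization.fac _ _ _⟩⟩
  -- The associator and the unitor have identity components, so the transformation is the image of
  -- the counit under `hotTensor X ⋙ Bn.quot`.
  · exact isLeftDerivedFunctor_of_adjunction adj (hotTensor X ⋙ Bn.quot) _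
      (fun M => by simp) An.nW
  · obtain ⟨adj', h⟩ := exists_derived_adjunction (hotTensorHomAdjunction X) An.nW Bn.nW adj e
    exact ⟨adj', fun N => h ((toHot _).obj N)⟩
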